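/- **Connecting orbits.** Let $\Sigma$ be a closed connected oriented smooth surface (any genus) and $\Sigma_0\subset\Sigma$ a compact two-dimensional submanifold with smooth boundary, not necessarily connected. Let $N_0\subset\Sigma_0$ be a collar neighborhood of $\partial\Sigma_0$; on each of its finitely many components fix smooth coordinates $(q,p)\in[0,1]\times S^1$, $S^1=\mathbb R/\mathbb Z$, such that $\partial\Sigma_0$ consists of the circles $\{1\}\times S^1$. Let $\omega$ be an area form on $\Sigma$ with $\omega=dq\wedge dp$ on $N_0$, let $\Phi$ be a diffeomorphism of $\Sigma$ with $\Phi^*\omega=\omega$, let $H:\Sigma\to\mathbb R$ be smooth, and let $J=(J_t)_{t\in\mathbb R}$ be a smooth path of $\omega$-compatible complex structures on $\Sigma$ (so that $\omega(\cdot,J_t\cdot)$ is a Riemannian metric). For a $\Phi$-invariant area form $\omega'$ let $$\alpha_{\omega'}(y)\xi=\int_0^1\omega'\big(\dot y(t),\xi(t)\big)\,dt$$ be the action form on $\Omega_\Phi=\{y\in C^\infty(\mathbb R,\Sigma)\mid y(t)=\Phi(y(t+1))\}$. Assume: * (H1) $\Phi(\Sigma_0)=\Sigma_0$, and $\Phi=\psi_1$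 on $\Sigma_0$, where $\partial_t\psi_t=X\circ\psi_t$, $\psi_0=\mathrm{id}$ and $dH=\omega(X,\cdot)$. * (H2) There is a constant $0<\delta<1/4$ such that on each component of $N_0$ either $\Phi(q,p)=(q,p-\delta)$ or $\Phi(q,p)=(q,p+\delta)$; the sign may depend on the component. * (H3) $\mathrm{Fix}(\Phi)\cap\Sigma_0=\mathrm{Crit}(H)\cap\Sigma_0$. * (H4) If $\omega'$ is a $\Phi$-invariant area form with $\omega'=\omega$ on $\Sigma\setminus N_0$, then $\alpha_{\omega'}$ has vanishing periods, i.e. its integral over every smooth loop in $\Omega_\Phi$ is $0$. * (H5) For all $t$, $J_t$ restricts to the standard complex structure ($\partial_q\mapsto\partial_p$, $\partial_p\mapsto-\partial_q$) on $N_0$, and $J_{t+1}=\Phi^*J_t$. Let $x^-,x^+\in\mathrm{Fix}(\Phi)\cap\Sigma_0$ lie in the same connected component of $\Sigma_0$, and let $u:\mathbb R^2\to\Sigma$ be a smooth map with $$u(s,t)=\Phi(u(s,t+1)),\qquad \partial_su+J_t(u)\,\partial_tu=0,\qquad \lim_{s\to\pm\infty}u(s,t)=x^\pm\ \text{ for all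 } t,$$ and finite energy $\int_{\mathbb R}\int_0^1\omega(\partial_tu,J_t(u)\,\partial_tu)\,dt\,ds<\infty$. Then for every $t\in\mathbb R$ the image of $u$ is contained in the open $\delta$-neighborhood of $\Sigma_0\setminus N_0$ with respect to the Riemannian metric $\omega(\cdot,J_t\cdot)$. -/

import Mathlib

open Set Filter Topology MeasureTheory
open scoped Manifold ContDiff

noncomputable section

namespace ConnectingOrbits

variable {M : Type*} [TopologicalSpace M] [ChartedSpace (EuclideanSpace ℝ (Fin 2)) M]

/-! ### Area forms and complex structures on a surface -/

/-- A (not necessarily continuous) field of bilinear forms on the tangent planes of `M`. -/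
abbrev BilinField (M : Type*) [TopologicalSpace M]
    [ChartedSpace (EuclideanSpace ℝ (Fin 2)) M] : Type _ :=
  ∀ x : M, TangentSpace (𝓡 2) x →L[ℝ] TangentSpace (𝓡 2) x →L[ℝ] ℝ

/-- A (not necessarily continuous) field of endomorphisms of the tangent planes of `M`. -/
abbrev EndField (M : Type*) [TopologicalSpace M]
    [ChartedSpace (EuclideanSpace ℝ (Fin 2)) M] : Type _ :=
  ∀ x : M, TangentSpace (𝓡 2) x →L[ℝ] TangentSpace (𝓡 2) x

/-- `σ` is an area form: a smooth, alternating, nowhere degenerate 2-form on the surface `M`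
(the orientation of `M` is the one given by `σ`). -/
structure IsAreaForm [IsManifold (𝓡 2) ∞ M] (σ : BilinField M) : Prop where
  smooth : ContMDiff (𝓡 2)
    ((𝓡 2).prod 𝓘(ℝ, EuclideanSpace ℝ (Fin 2) →L[ℝ] EuclideanSpace ℝ (Fin 2) →L[ℝ] ℝ)) ∞
    (fun x ↦ Bundle.TotalSpace.mk'
      (EuclideanSpace ℝ (Fin 2) →L[ℝ] EuclideanSpace ℝ (Fin 2) →L[ℝ] ℝ)
      (E := fun x : M ↦ TangentSpace (𝓡 2) x →L[ℝ] TangentSpace (𝓡 2) x →L[ℝ] ℝ) x (σ x))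
  alternating : ∀ (x : M) (v : TangentSpace (𝓡 2) x), σ x v v = 0
  nondegenerate : ∀ (x : M) (v : TangentSpace (𝓡 2) x), v ≠ 0 → ∃ w, σ x v w ≠ 0

/-- `Φ` preserves `σ`, i.e. `Φ^* σ = σ`. -/
def IsInvariantForm (Φ : M → M) (σ : BilinField M) : Prop :=
  ∀ (x : M) (v w : TangentSpace (𝓡 2) x),
    σ (Φ x) (mfderiv (𝓡 2) (𝓡 2) Φ x v) (mfderiv (𝓡 2) (𝓡 2) Φ x w) = σ x v w

/-- `j` is an `σ`-compatible complex structure: `j² = -1`, `σ(j·, j·) = σ`, and `σ(·, j·)` is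
positive definite. -/
structure IsCompatible (σ : BilinField M) (j : EndField M) : Prop where
  sq : ∀ (x : M) (v : TangentSpace (𝓡 2) x), j x (j x v) = -v
  invariant : ∀ (x : M) (v w : TangentSpace (𝓡 2) x), σ x (j x v) (j x w) = σ x v w
  pos : ∀ (x : M) (v : TangentSpace (𝓡 2) x), v ≠ 0 → 0 < σ x v (j x v)

/-- The family `J = (J_t)` depends smoothly on `(t, x)`. -/
def IsSmoothPath [IsManifold (𝓡 2) ∞ M] (J : ℝ → EndField M) : Prop :=
  ContMDiff (𝓘(ℝ, ℝ).prod (𝓡 2))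
    ((𝓡 2).prod 𝓘(ℝ, EuclideanSpace ℝ (Fin 2) →L[ℝ] EuclideanSpace ℝ (Fin 2))) ∞
    (fun y : ℝ × M ↦ Bundle.TotalSpace.mk'
      (EuclideanSpace ℝ (Fin 2) →L[ℝ] EuclideanSpace ℝ (Fin 2))
      (E := fun x : M ↦ TangentSpace (𝓡 2) x →L[ℝ] TangentSpace (𝓡 2) x) y.2 (J y.1 y.2))

/-- The distance of the Riemannian metric `σ(·, j·)`: the infimum of the lengths
`∫ √(σ(γ', jγ'))` of `C^1` paths. -/
def metricDist (σ : BilinField M) (j : EndField M) (x y : M) : ENNReal :=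
  @Manifold.riemannianEDist _ _ _ _ _ (𝓡 2) M _ _
    (fun x ↦ ⟨fun v ↦ ENNReal.ofReal (Real.sqrt (σ x v (j x v)))⟩) x y

/-- The (open) `δ`-neighborhood of `A` with respect to the metric `σ(·, j·)`. -/
def metricNhd (σ : BilinField M) (j : EndField M) (δ : ℝ) (A : Set M) : Set M :=
  {x | ∃ a ∈ A, metricDist σ j a x < ENNReal.ofReal δ}

/-! ### The submanifold and its collar -/

/-- `S` is a compact (two-dimensional) submanifold of `M`, with smooth boundary `frontier S`. -/
def IsCompactSubsurface [IsManifold (𝓡 2) ∞ M] (S : Set M) : Prop :=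
  IsCompact S ∧ ∀ x ∈ frontier S, ∃ c ∈ IsManifold.maximalAtlas (𝓡 2) ∞ M,
    x ∈ c.source ∧ ∀ y ∈ c.source, y ∈ S ↔ 0 ≤ c y 0

/-- The strip `[0,1] × ℝ`, the universal cover of `[0,1] × S^1`, where `S^1 = ℝ / ℤ`. -/
def strip : Set (ℝ × ℝ) := Icc 0 1 ×ˢ univ

/-- The derivative (along the strip) of a map parametrized by the strip. -/
def stripDeriv (κ : ℝ × ℝ → M) (z : ℝ × ℝ) : ℝ × ℝ →L[ℝ] TangentSpace (𝓡 2) (κ z) :=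
  mfderivWithin 𝓘(ℝ, ℝ × ℝ) (𝓡 2) κ strip z

/-- The maps `κ i` are coordinates `(q,p) ∈ [0,1] × S^1` on the components of a collar
neighborhood of the boundary of `S`; points of `S^1 = ℝ / ℤ` are represented by real numbers. So the
`κ i` are smooth embeddings of `[0,1] × S^1` with pairwise disjoint images in `S`, and
the circles `q = 1` make up the boundary of `S`. -/
structure IsCollar {m : ℕ} (S : Set M) (κ : Fin m → ℝ × ℝ → M) : Prop where
  smooth : ∀ i, ContMDiffOn 𝓘(ℝ, ℝ × ℝ) (𝓡 2) ∞ (κ i) strip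
  eq_iff : ∀ i, ∀ z ∈ strip, ∀ w ∈ strip,
    κ i z = κ i w ↔ z.1 = w.1 ∧ ∃ n : ℤ, w.2 = z.2 + n
  immersion : ∀ i, ∀ z ∈ strip, Function.Injective (stripDeriv (κ i) z)
  disjoint : ∀ i j, i ≠ j → Disjoint (κ i '' strip) (κ j '' strip)
  subset : ∀ i, κ i '' strip ⊆ S
  boundary : frontier S = ⋃ i, κ i '' ({1} ×ˢ univ)

/-- The collar `N_0` itself. -/
def collarSet {m : ℕ} (κ : Fin m → ℝ × ℝ → M) : Set M := ⋃ i, κ i '' strip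

/-- `σ` is `dq ∧ dp` in the collar coordinates. -/
def IsStandardFormOn {m : ℕ} (κ : Fin m → ℝ × ℝ → M) (σ : BilinField M) : Prop :=
  ∀ i, ∀ z ∈ strip, ∀ a b : ℝ × ℝ,
    σ (κ i z) (stripDeriv (κ i) z a) (stripDeriv (κ i) z b) = a.1 * b.2 - a.2 * b.1

/-- `j` is the standard complex structure `∂_q ↦ ∂_p`, `∂_p ↦ -∂_q` in the collar coordinates. -/
def IsStandardComplexOn {m : ℕ} (κ : Fin m → ℝ × ℝ → M) (j : EndField M) : Prop :=
  ∀ i, ∀ z ∈ strip, ∀ a : ℝ × ℝ,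
    j (κ i z) (stripDeriv (κ i) z a) = stripDeriv (κ i) z (-a.2, a.1)

/-! ### The Hamiltonian flow and the action form -/

/-- `ψ` is the Hamiltonian flow of `H`: `ψ_0 = id` and `∂_t ψ_t = X ∘ ψ_t`,
where `dH = σ(X, ·)`. -/
def IsHamiltonianFlow (σ : BilinField M) (H : M → ℝ) (ψ : ℝ → M → M) : Prop :=
  ∃ X : ∀ x : M, TangentSpace (𝓡 2) x,
    (∀ (x : M) (v : TangentSpace (𝓡 2) x), mfderiv (𝓡 2) 𝓘(ℝ, ℝ) H x v = σ x (X x) v) ∧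
    ∀ x, ψ 0 x = x ∧ IsMIntegralCurve (I := 𝓡 2) (fun t ↦ ψ t x) X

/-- The partial derivative `∂_s u` at `z = (s,t)`. -/
def partialS (u : ℝ × ℝ → M) (z : ℝ × ℝ) : TangentSpace (𝓡 2) (u z) :=
  mfderiv 𝓘(ℝ, ℝ × ℝ) (𝓡 2) u z ((1, 0) : ℝ × ℝ)

/-- The partial derivative `∂_t u` at `z = (s,t)`. -/
def partialT (u : ℝ × ℝ → M) (z : ℝ × ℝ) : TangentSpace (𝓡 2) (u z) :=
  mfderiv 𝓘(ℝ, ℝ × ℝ) (𝓡 2) u z ((0, 1) : ℝ × ℝ)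

/-- The twisted loop space `Ω_Φ`: smooth `y : ℝ → M` with `y(t) = Φ(y(t+1))`. -/
def twistedLoops (Φ : M → M) : Set (ℝ → M) :=
  {y | ContMDiff 𝓘(ℝ, ℝ) (𝓡 2) ∞ y ∧ ∀ t, y t = Φ (y (t + 1))}

/-- The action form `α_σ(y) ξ = ∫_0^1 σ(dy/dt, ξ(t)) dt`, for a vector field `ξ` along `y`. -/
def actionForm (σ : BilinField M) (y : ℝ → M) (ξ : ∀ t, TangentSpace (𝓡 2) (y t)) : ℝ :=
  ∫ t in (0 : ℝ)..1, σ (y t) (mfderiv 𝓘(ℝ, ℝ) (𝓡 2) y t (1 : ℝ)) (ξ t)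

/-- The action form has vanishing periods on `Ω_Φ`: its integral over every smooth loop
`s ↦ v(s, ·)`, `s ∈ ℝ / ℤ`, in `Ω_Φ` is zero. -/
def HasVanishingPeriods (Φ : M → M) (σ : BilinField M) : Prop :=
  ∀ v : ℝ × ℝ → M, ContMDiff 𝓘(ℝ, ℝ × ℝ) (𝓡 2) ∞ v →
    (∀ s t, v (s + 1, t) = v (s, t)) → (∀ s, (fun t ↦ v (s, t)) ∈ twistedLoops Φ) →
    ∫ s in (0 : ℝ)..1, actionForm σ (fun t ↦ v (s, t)) (fun t ↦ partialS v (s, t)) = 0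

/-! ### Floer connecting orbits -/

/-- The set `M(x⁻, x⁺; J, Φ)` of finite energy Floer connecting orbits, as maps of `(s,t)`. -/
structure IsConnectingOrbit (σ : BilinField M) (Φ : M → M) (J : ℝ → EndField M) (xm xp : M)
    (u : ℝ × ℝ → M) : Prop where
  smooth : ContMDiff 𝓘(ℝ, ℝ × ℝ) (𝓡 2) ∞ u
  twisted : ∀ s t, u (s, t) = Φ (u (s, t + 1))
  floer : ∀ s t, partialS u (s, t) + J t (u (s, t)) (partialT u (s, t)) = 0
  lim_neg : ∀ t, Tendsto (fun s ↦ u (s, t)) atBot (𝓝 xm)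
  lim_pos : ∀ t, Tendsto (fun s ↦ u (s, t)) atTop (𝓝 xp)
  energy : ∫⁻ s : ℝ, ∫⁻ t in Icc (0 : ℝ) 1, ENNReal.ofReal
    (σ (u (s, t)) (partialT u (s, t)) (J t (u (s, t)) (partialT u (s, t)))) < ⊤

/-! ### The hypotheses -/

/-- `S` is `Φ`-invariant, and on `S` the map `Φ` is the time-1-map of the Hamiltonian flow
of `H`. -/
def HypH1 (σ : BilinField M) (Φ : M → M) (H : M → ℝ) (S : Set M) : Prop :=
  Φ '' S = S ∧ ∃ ψ : ℝ → M → M, IsHamiltonianFlow σ H ψ ∧ ∀ x ∈ S, Φ x = ψ 1 x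

/-- On each component of the collar, `Φ(q,p) = (q,p-δ)`, or `Φ(q,p) = (q,p+δ)`. -/
def HypH2 {m : ℕ} (Φ : M → M) (κ : Fin m → ℝ × ℝ → M) (δ : ℝ) : Prop :=
  0 < δ ∧ δ < 1 / 4 ∧ ∀ i,
    (∀ q ∈ Icc (0 : ℝ) 1, ∀ p : ℝ, Φ (κ i (q, p)) = κ i (q, p - δ)) ∨
    (∀ q ∈ Icc (0 : ℝ) 1, ∀ p : ℝ, Φ (κ i (q, p)) = κ i (q, p + δ))

/-- The fixed points of `Φ` in `S` are the critical points of `H` in `S`. -/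
def HypH3 (Φ : M → M) (H : M → ℝ) (S : Set M) : Prop :=
  {x | Φ x = x} ∩ S = {x | mfderiv (𝓡 2) 𝓘(ℝ, ℝ) H x = 0} ∩ S

/-- For every `Φ`-invariant area form `σ'` that agrees with `σ` outside the collar, the action
form of `σ'` has vanishing periods on `Ω_Φ`. -/
def HypH4 [IsManifold (𝓡 2) ∞ M] {m : ℕ} (σ : BilinField M) (Φ : M → M)
    (κ : Fin m → ℝ × ℝ → M) : Prop :=
  ∀ σ' : BilinField M, IsAreaForm σ' → IsInvariantForm Φ σ' →
    (∀ x ∉ collarSet κ, σ' x = σ x) → HasVanishingPeriods Φ σ'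

/-- `J` is a smooth path of `σ`-compatible complex structures, standard on the collar, with
`J_{t+1} = Φ^* J_t`, i.e. `dΦ ∘ J_{t+1} = J_t ∘ dΦ`. -/
def HypH5 [IsManifold (𝓡 2) ∞ M] {m : ℕ} (σ : BilinField M) (Φ : M → M)
    (κ : Fin m → ℝ × ℝ → M) (J : ℝ → EndField M) : Prop :=
  IsSmoothPath J ∧ (∀ t, IsCompatible σ (J t)) ∧ (∀ t, IsStandardComplexOn κ (J t)) ∧
  ∀ (t : ℝ) (x : M) (v : TangentSpace (𝓡 2) x),
    mfderiv (𝓡 2) (𝓡 2) Φ x (J (t + 1) x v) = J t (Φ x) (mfderiv (𝓡 2) (𝓡 2) Φ x v)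

end ConnectingOrbits

end

/-!
Let `g ≥ 0` be a `Φ`-invariant function supported in the collar. Both `σ` and `(1 + g)σ` are
invariant area forms, so the vanishing of the periods of their action forms shows that a loop of
twisted loops sweeps out zero `g`-weighted area (`HypH4.integral_weight_eq_zero`,
`SweepsArea.eq_zero`). A connecting orbit `u` is closed up to such a loop as follows. By finiteness
of the energy, there are slices `u(s, ·)` with `s → ±∞` that are uniformly close to `x^±`
(`frequently_forall_mem`), and such twisted loops can be contracted to the constants `x^±` without
meeting the support of `g` (`exists_nhds_sweepsArea_zero`). The two constants are joined by the
square `(s,t) ↦ ψ_{-t} γ(s)`, for a path `γ` in `S` from `x⁻` to `x⁺` that does not enter the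
support of `g` (`sweepsArea_flowSquare`). The `g`-weighted area swept out by `u` itself is minus its
`g`-weighted energy. So, if the square sweeps out no `g`-weighted area, then `du = 0` wherever
`g(u) > 0`; as `u` is not constant with a value in the collar, it does not meet the set `g > 0`
(`IsConnectingOrbit.notMem_collar`).

It remains to find, around each circle `q = q₀` of the open collar, a weight `g = h(q)` with
`h(q₀) > 0` for which the square sweeps out no weighted area (`IsCollar.exists_weight`). The flow
`ψ_t` of `H` need not preserve the circles of the collar: only `ψ_1`, the rotation by `c = ±δ`, is
known there. If `c` is irrational, then `H`, being invariant under `ψ_1`, is constant on the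
circles, the flow preserves them, and the square does not meet the support of `g` at all. If `c` has
denominator `b`, then `ψ_b` is the identity on the collar. Averaging over this period gives a field
`Y` which is invariant under the flow and satisfies `σ(X, Y) = 1` (`exists_invariant_field`). The
1-form `θ = σ(·, Y)` is invariant, `θ(X) = 1`, and its integral `e(q)` over a circle is not zero
(`IsCollar.integral_circleDensity_ne_zero`). For a cut-off function `f` of `q` and the weight
`h = f e²` one has `h dq ∧ dp = f e dq ∧ θ + d(f e R) ∧ dq`, where `∂_p R = θ(∂_p) - e`. On the
square, `θ` has a component along `ds` that depends on `s` only and one along `dt` that depends on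
`t` only; as all terms vanish on the boundary of the square, their integrals are zero by Stokes'
theorem (`integral_square_eq_zero`, `IsCollar.integral_sweepRate_eq_zero`).

Hence the connected image of `u` avoids the open collar. It lies in the closure of the complement of
the collar in `S` (`IsCollar.subset_diff_collar`), and so in each of its metric neighborhoods
(`IsCollar.diff_collar_subset_metricNhd`).
-/

noncomputable section

namespace ConnectingOrbits

/-! ### Smooth dependence of flows on the initial point -/

section CompOperator

universe w
variable {K : Type*} [TopologicalSpace K] [CompactSpace K]

/-- The pointwise application `C(K, E →L F) → C(K, E) → C(K, F)` as a bounded bilinear map. -/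
def pointwiseApply (K : Type*) [TopologicalSpace K] [CompactSpace K]
    (E F : Type*) [NormedAddCommGroup E] [NormedSpace ℝ E]
    [NormedAddCommGroup F] [NormedSpace ℝ F] :
    C(K, E →L[ℝ] F) →L[ℝ] C(K, E) →L[ℝ] C(K, F) :=
  LinearMap.mkContinuous₂
    (LinearMap.mk₂ ℝ (fun (A : C(K, E →L[ℝ] F)) (v : C(K, E)) ↦
        (⟨fun k ↦ A k (v k), A.continuous.clm_apply v.continuous⟩ : C(K, F)))
      (fun _ _ _ ↦ by ext; simp) (fun _ _ _ ↦ by ext; simp)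
      (fun _ _ _ ↦ by ext; simp) (fun _ _ _ ↦ by ext; simp)) 1
    (fun A v ↦ by
      rw [one_mul]
      refine (ContinuousMap.norm_le _ (by positivity)).2 fun k ↦ ?_
      exact ((A k).le_opNorm (v k)).trans (mul_le_mul (A.norm_coe_le_norm k)
        (v.norm_coe_le_norm k) (norm_nonneg _) (norm_nonneg A)))

@[simp] lemma pointwiseApply_apply {E F : Type*} [NormedAddCommGroup E] [NormedSpace ℝ E]
    [NormedAddCommGroup F] [NormedSpace ℝ F] (A : C(K, E →L[ℝ] F)) (v : C(K, E)) (k : K) :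
    pointwiseApply K E F A v k = A k (v k) := rfl

variable {E F : Type w} [NormedAddCommGroup E] [NormedSpace ℝ E]
  [NormedAddCommGroup F] [NormedSpace ℝ F]

lemma hasFDerivAt_comp_continuousMap {f : E → F} (hf : ContDiff ℝ 1 f) (u : C(K, E)) :
    HasFDerivAt (fun u : C(K, E) ↦ (⟨f, hf.continuous⟩ : C(E, F)).comp u)
      (pointwiseApply K E F
        ((⟨fderiv ℝ f, hf.continuous_fderiv one_ne_zero⟩ : C(E, E →L[ℝ] F)).comp u)) u := by
  rw [hasFDerivAt_iff_isLittleO_nhds_zero, Asymptotics.isLittleO_iff]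
  intro ε hε
  have hK : IsCompact (range u) := isCompact_range u.continuous
  have hunif := hK.uniformContinuousAt_of_continuousAt (fderiv ℝ f)
    (fun x _ ↦ (hf.continuous_fderiv one_ne_zero).continuousAt) (Metric.dist_mem_uniformity hε)
  obtain ⟨δ, hδ, hδ'⟩ := Metric.mem_uniformity_dist.1 hunif
  filter_upwards [Metric.ball_mem_nhds (0 : C(K, E)) hδ] with v hv
  refine (ContinuousMap.norm_le _ (by positivity)).2 fun k ↦ ?_
  have hvk : ‖v k‖ < δ := (v.norm_coe_le_norm k).trans_lt (by simpa using hv)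
  have key := (convex_ball (u k) δ).norm_image_sub_le_of_norm_hasFDerivWithin_le'
    (f := f) (f' := fderiv ℝ f) (φ := fderiv ℝ f (u k)) (C := ε) (x := u k) (y := u k + v k)
    (fun x _ ↦ (hf.differentiable one_ne_zero x).hasFDerivAt.hasFDerivWithinAt)
    (fun x hx ↦ by
      have := hδ' (a := u k) (b := x) (by rw [dist_comm]; exact hx) (mem_range_self k)
      rw [← dist_eq_norm, dist_comm]; exact le_of_lt this)
    (Metric.mem_ball_self hδ) (by simpa [Metric.mem_ball, dist_eq_norm] using hvk)
  simp only [add_sub_cancel_left] at key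
  calc _ ≤ ε * ‖v k‖ := by simpa using key
    _ ≤ ε * ‖v‖ := by gcongr; exact v.norm_coe_le_norm k

/-- Composition with a smooth map is a smooth operator on spaces of continuous functions. -/
lemma contDiff_comp_continuousMap (n : ℕ) : ∀ {F : Type w} [NormedAddCommGroup F] [NormedSpace ℝ F]
    {f : E → F} (hf : ContDiff ℝ ∞ f),
    ContDiff ℝ n (fun u : C(K, E) ↦ (⟨f, hf.continuous⟩ : C(E, F)).comp u) := by
  induction n with
  | zero =>
    intro F _ _ f hf
    rw [Nat.cast_zero, contDiff_zero]
    exact ContinuousMap.continuous_postcomp _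
  | succ n ih =>
    intro F _ _ f hf
    have h1 : ContDiff ℝ 1 f := hf.of_le (by simp)
    have hd := hasFDerivAt_comp_continuousMap (K := K) h1
    have h2 : ContDiff ℝ ∞ (fderiv ℝ f) := hf.fderiv_right (by simp)
    rw [Nat.cast_succ, contDiff_succ_iff_fderiv]
    refine ⟨fun u ↦ (hd u).differentiableAt, by simp, ?_⟩
    have : (fderiv ℝ fun u : C(K, E) ↦ (⟨f, hf.continuous⟩ : C(E, F)).comp u) = fun u ↦
        pointwiseApply K E F
          ((⟨fderiv ℝ f, h2.continuous⟩ : C(E, E →L[ℝ] F)).comp u) :=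
      funext fun u ↦ (hd u).fderiv
    rw [this]
    exact (pointwiseApply K E F).contDiff.comp (ih h2)

end CompOperator

section LocalFlow

variable {E : Type*} [NormedAddCommGroup E] [NormedSpace ℝ E] [CompleteSpace E]

/-- The primitive `u ↦ (τ ↦ ∫₀^τ u)` as a bounded operator on `C([0,1], E)`. -/
def primitiveCLM (E : Type*) [NormedAddCommGroup E] [NormedSpace ℝ E] [CompleteSpace E] :
    C(unitInterval, E) →L[ℝ] C(unitInterval, E) :=
  LinearMap.mkContinuous
    { toFun := fun u ↦ ⟨fun τ ↦ ∫ r in (0 : ℝ)..τ, u (projIcc 0 1 zero_le_one r), by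
        have hc : Continuous fun r : ℝ ↦ u (projIcc 0 1 zero_le_one r) :=
          u.continuous.comp continuous_projIcc
        exact (intervalIntegral.continuous_primitive
          (fun a b ↦ hc.intervalIntegrable a b) 0).comp continuous_subtype_val⟩
      map_add' := fun u v ↦ by
        ext τ
        have hc : ∀ u : C(unitInterval, E), Continuous fun r : ℝ ↦ u (projIcc 0 1 zero_le_one r) :=
          fun u ↦ u.continuous.comp continuous_projIcc
        simpa using intervalIntegral.integral_add ((hc u).intervalIntegrable 0 τ)
          ((hc v).intervalIntegrable 0 τ)
      map_smul' := fun c u ↦ by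
        ext τ
        simp }
    1 (fun u ↦ by
      rw [one_mul]
      refine (ContinuousMap.norm_le _ (norm_nonneg _)).2 fun τ ↦ ?_
      have := intervalIntegral.norm_integral_le_of_norm_le_const (a := 0) (b := (τ : ℝ))
        (f := fun r ↦ u (projIcc 0 1 zero_le_one r)) (C := ‖u‖) (fun r _ ↦ u.norm_coe_le_norm _)
      refine this.trans ?_
      have h1 : |(τ : ℝ) - 0| ≤ 1 := by
        rw [sub_zero, abs_of_nonneg τ.2.1]; exact τ.2.2
      exact mul_le_of_le_one_right (norm_nonneg _) h1)

lemma primitiveCLM_apply (u : C(unitInterval, E)) (τ : unitInterval) :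
    primitiveCLM E u τ = ∫ r in (0 : ℝ)..τ, u (projIcc 0 1 zero_le_one r) := rfl

/-- The flow of a bounded smooth vector field is smooth near time zero: after rescaling time, the
flow line is the solution `u ∈ C([0,1], E)` of `u = y + t ∫ f ∘ u`, and at `t = 0` the derivative of
this equation with respect to `u` is the identity. -/
theorem exists_contDiffAt_localFlow {f : E → E} (hf : ContDiff ℝ ∞ f) {L : ℝ}
    (hL : ∀ x, ‖f x‖ ≤ L) (y₀ : E) :
    ∃ φ : E × ℝ → E, ∀ᶠ z : E × ℝ in 𝓝 (y₀, 0),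
      ContDiffAt ℝ ∞ φ z ∧ φ (z.1, 0) = z.1 ∧ HasDerivAt (fun t ↦ φ (z.1, t)) (f (φ z)) z.2 := by
  have hL0 : 0 ≤ L := (norm_nonneg _).trans (hL 0)
  obtain ⟨r, hr, ε, hε, hα⟩ :=
    (hf.contDiffAt (x := y₀)).of_le (n := ∞) (m := 1) (by simp)
      |>.exists_forall_mem_closedBall_exists_eq_forall_mem_Ioo_hasDerivAt 0
  simp only [zero_sub, zero_add] at hα
  choose! α hα0 hα using hα
  let fc : C(E, E) := ⟨f, hf.continuous⟩
  let N : C(unitInterval, E) → C(unitInterval, E) := fun u ↦ fc.comp u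
  have hN : ContDiff ℝ ∞ N := by
    rw [contDiff_infty]
    exact fun n ↦ contDiff_comp_continuousMap n hf
  let P := primitiveCLM E
  let cst : E →L[ℝ] C(unitInterval, E) := ContinuousLinearMap.const ℝ unitInterval
  have hcst : ∀ y τ, cst y τ = y := fun y τ ↦ rfl
  -- the equation `u - y - t ∫ f ∘ u = 0`, completed by the parameters `(y, t)` to a map between
  -- spaces of the same kind, so that the inverse function theorem applies
  let G : (E × ℝ) × C(unitInterval, E) → (E × ℝ) × C(unitInterval, E) :=
    fun p ↦ (p.1, p.2 - cst p.1.1 - p.1.2 • P (N p.2))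
  have hG : ContDiff ℝ ∞ G := by
    have h2 : ContDiff ℝ ∞ fun p : (E × ℝ) × C(unitInterval, E) ↦ P (N p.2) :=
      P.contDiff.comp (hN.comp contDiff_snd)
    refine contDiff_fst.prodMk ((contDiff_snd.sub (cst.contDiff.comp
      (contDiff_fst.comp contDiff_fst))).sub ((contDiff_snd.comp contDiff_fst).smul h2))
  let p₀ : (E × ℝ) × C(unitInterval, E) := ((y₀, 0), cst y₀)
  let w : C(unitInterval, E) := P (N (cst y₀))
  let A : (E × ℝ) × C(unitInterval, E) →L[ℝ] (E × ℝ) × C(unitInterval, E) :=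
    (ContinuousLinearMap.fst ℝ _ _).prod (ContinuousLinearMap.snd ℝ _ _ -
      cst ∘L (ContinuousLinearMap.fst ℝ _ _) ∘L (ContinuousLinearMap.fst ℝ _ _) -
      ((ContinuousLinearMap.snd ℝ E ℝ) ∘L
        (ContinuousLinearMap.fst ℝ _ C(unitInterval, E))).smulRight w)
  let B : (E × ℝ) × C(unitInterval, E) →L[ℝ] (E × ℝ) × C(unitInterval, E) :=
    (ContinuousLinearMap.fst ℝ _ _).prod (ContinuousLinearMap.snd ℝ _ _ +
      cst ∘L (ContinuousLinearMap.fst ℝ _ _) ∘L (ContinuousLinearMap.fst ℝ _ _) +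
      ((ContinuousLinearMap.snd ℝ E ℝ) ∘L
        (ContinuousLinearMap.fst ℝ _ C(unitInterval, E))).smulRight w)
  -- at `t = 0` the derivative is unipotent, with an explicit inverse
  let A' : ((E × ℝ) × C(unitInterval, E)) ≃L[ℝ] (E × ℝ) × C(unitInterval, E) :=
    ContinuousLinearEquiv.equivOfInverse A B
    (fun p ↦ Prod.ext rfl (by simp [A, B]; abel)) (fun p ↦ Prod.ext rfl (by simp [A, B]; abel))
  have hGA : HasFDerivAt G
      (A' : (E × ℝ) × C(unitInterval, E) →L[ℝ] (E × ℝ) × C(unitInterval, E)) p₀ := by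
    have h3 : HasFDerivAt (fun p : (E × ℝ) × C(unitInterval, E) ↦ p.1.2)
        ((ContinuousLinearMap.snd ℝ E ℝ) ∘L (ContinuousLinearMap.fst ℝ _ C(unitInterval, E))) p₀ :=
      ((ContinuousLinearMap.snd ℝ E ℝ) ∘L
        (ContinuousLinearMap.fst ℝ _ C(unitInterval, E))).hasFDerivAt
    have h4 : DifferentiableAt ℝ (fun p : (E × ℝ) × C(unitInterval, E) ↦ P (N p.2)) p₀ :=
      (P.contDiff.comp (hN.comp contDiff_snd)).differentiable (by simp) p₀
    have h5 := h3.smul h4.hasFDerivAt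
    have h6 : HasFDerivAt (fun p : (E × ℝ) × C(unitInterval, E) ↦ p.2 - cst p.1.1)
        (ContinuousLinearMap.snd ℝ _ _ -
      cst ∘L (ContinuousLinearMap.fst ℝ _ _) ∘L (ContinuousLinearMap.fst ℝ _ _)) p₀ :=
      hasFDerivAt_snd.sub (cst.hasFDerivAt.comp p₀
        (hasFDerivAt_fst.comp p₀ hasFDerivAt_fst))
    refine (hasFDerivAt_fst.prodMk (h6.sub h5)).congr_fderiv ?_
    have : p₀.1.2 = 0 := rfl
    rw [this, zero_smul, zero_add]
    rfl
  have hGp : G p₀ = ((y₀, 0), 0) := by simp [G, p₀]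
  let g := hG.contDiffAt.localInverse (a := p₀) hGA (by simp)
  let F := hG.contDiffAt.toOpenPartialHomeomorph G hGA (by simp)
  -- the derivative of `G` stays invertible nearby, so that the local inverse is smooth in a whole
  -- neighbourhood and not only at one point
  have hg : ∀ᶠ q in 𝓝 ((y₀, (0 : ℝ)), (0 : C(unitInterval, E))), ContDiffAt ℝ ∞ g q := by
    have hmem : G p₀ ∈ F.target := hG.contDiffAt.image_mem_toOpenPartialHomeomorph_target hGA _
    have hcont : ContinuousAt g (G p₀) := F.symm.continuousAt hmem
    have hgp : g (G p₀) = p₀ := hG.contDiffAt.localInverse_apply_image hGA (by simp)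
    have hequiv : ∀ᶠ q in 𝓝 (G p₀), fderiv ℝ G (g q) ∈
        range ((↑) :
          (((E × ℝ) × C(unitInterval, E)) ≃L[ℝ] ((E × ℝ) × C(unitInterval, E))) → _) := by
      have h1 : ContinuousAt (fun q ↦ fderiv ℝ G (g q)) (G p₀) :=
        (hG.continuous_fderiv (by simp)).continuousAt.comp hcont
      refine h1.eventually ?_
      beta_reduce
      rw [hgp, hGA.fderiv]
      exact ContinuousLinearEquiv.nhds A'
    rw [← hGp]
    filter_upwards [hequiv, F.open_target.mem_nhds hmem] with q ⟨A₁, hA₁⟩ hq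
    refine F.contDiffAt_symm hq (f₀' := A₁) ?_ hG.contDiffAt
    rw [hA₁]
    exact (hG.differentiable (by simp) _).hasFDerivAt
  have hleft : ∀ᶠ p in 𝓝 p₀, g (G p) = p :=
    (hG.contDiffAt.hasStrictFDerivAt' hGA (by simp)).eventually_left_inverse
  let one : unitInterval := 1
  let φ : E × ℝ → E := fun z ↦ (g (z, 0)).2 one
  have hφ : ∀ᶠ z in 𝓝 (y₀, (0 : ℝ)), ContDiffAt ℝ ∞ φ z := by
    have h0 : Tendsto (fun z : E × ℝ ↦ (z, (0 : C(unitInterval, E)))) (𝓝 (y₀, 0))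
        (𝓝 ((y₀, 0), 0)) := (by fun_prop : Continuous fun z : E × ℝ ↦
          (z, (0 : C(unitInterval, E)))).tendsto' _ _ rfl
    filter_upwards [h0.eventually hg] with z hz
    have h1 : ContDiffAt ℝ ∞ (fun z : E × ℝ ↦ g (z, 0)) z :=
      ContDiffAt.comp z hz (contDiffAt_id.prodMk contDiffAt_const)
    exact (ContinuousMap.evalCLM ℝ one).contDiff.contDiffAt.comp _ (contDiffAt_snd.comp _ h1)
  refine ⟨φ, ?_⟩
  -- the flow lines stay close to their initial points, so they are the solutions found by the
  -- local inverse
  have hbound : ∀ y ∈ Metric.closedBall y₀ r, ∀ t ∈ Ioo (-ε) ε, ‖α y t - y‖ ≤ L * |t| := by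
    intro y hy t ht
    have := (convex_Ioo (-ε) ε).norm_image_sub_le_of_norm_hasDerivWithin_le (f := α y)
      (f' := fun t ↦ f (α y t)) (C := L) (x := 0) (y := t)
      (fun x hx ↦ (hα y hy x hx).hasDerivWithinAt) (fun x _ ↦ hL _) (by simpa using hε) ht
    simpa [hα0 y hy] using this
  have hsolve : ∀ᶠ z : E × ℝ in 𝓝 (y₀, 0), φ z = α z.1 z.2 := by
    obtain ⟨ρ, hρ, hρ'⟩ := Metric.eventually_nhds_iff_ball.1 hleft
    have e1 : ∀ᶠ z : E × ℝ in 𝓝 (y₀, 0), z.1 ∈ Metric.closedBall y₀ r :=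
      continuous_fst.continuousAt.eventually (Metric.closedBall_mem_nhds _ hr)
    have e2 : ∀ᶠ z : E × ℝ in 𝓝 (y₀, 0), z.2 ∈ Ioo (-ε) ε :=
      continuous_snd.continuousAt.eventually (Ioo_mem_nhds (by simpa using hε) (by simpa using hε))
    have e3 : ∀ᶠ z : E × ℝ in 𝓝 (y₀, 0), L * |z.2| + ‖z.1 - y₀‖ < ρ :=
      (by fun_prop : Continuous fun z : E × ℝ ↦ L * |z.2| + ‖z.1 - y₀‖).continuousAt.eventually
        (gt_mem_nhds (by simpa using hρ))
    have e4 : ∀ᶠ z : E × ℝ in 𝓝 (y₀, 0), z ∈ Metric.ball (y₀, (0 : ℝ)) ρ :=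
      Metric.ball_mem_nhds _ hρ
    filter_upwards [e1, e2, e3, e4] with z h1 h2 h3 h4
    have hmul : ∀ τ ∈ Icc (0 : ℝ) 1, z.2 * τ ∈ Ioo (-ε) ε := fun τ hτ ↦ by
      have : |z.2 * τ| ≤ |z.2| := by
        rw [abs_mul, abs_of_nonneg hτ.1]
        exact mul_le_of_le_one_right (abs_nonneg _) hτ.2
      exact abs_lt.1 (this.trans_lt (abs_lt.2 h2))
    have hd : ∀ τ ∈ Icc (0 : ℝ) 1, HasDerivAt (fun τ ↦ α z.1 (z.2 * τ))
        (z.2 • f (α z.1 (z.2 * τ))) τ := fun τ hτ ↦ by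
      have := (hα z.1 h1 _ (hmul τ hτ)).scomp τ (((hasDerivAt_id τ).const_mul z.2))
      simpa [Function.comp_def] using this
    let u : C(unitInterval, E) := ⟨fun τ ↦ α z.1 (z.2 * τ), continuous_iff_continuousAt.2 fun τ ↦
      ContinuousAt.comp (f := fun τ : unitInterval ↦ (τ : ℝ)) (g := fun τ : ℝ ↦ α z.1 (z.2 * τ))
        (hd τ τ.2).continuousAt continuous_subtype_val.continuousAt⟩
    have hu : G (z, u) = (z, 0) := by
      refine Prod.ext rfl ?_
      ext τ
      have hint : ∫ x in (0 : ℝ)..τ, z.2 • f (α z.1 (z.2 * x)) = α z.1 (z.2 * τ) - z.1 := by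
        have hsub : uIcc (0 : ℝ) τ ⊆ Icc 0 1 := by
          rw [uIcc_of_le τ.2.1]; exact Icc_subset_Icc_right τ.2.2
        rw [intervalIntegral.integral_eq_sub_of_hasDerivAt (fun x hx ↦ hd x (hsub hx))]
        · simp [hα0 z.1 h1]
        · refine ContinuousOn.intervalIntegrable fun x hx ↦ ContinuousAt.continuousWithinAt ?_
          exact continuousAt_const.smul (hf.continuous.continuousAt.comp
            (hd x (hsub hx)).continuousAt)
      have hP : P (N u) τ = ∫ x in (0 : ℝ)..τ, f (α z.1 (z.2 * x)) := by
        rw [primitiveCLM_apply]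
        refine intervalIntegral.integral_congr fun x hx ↦ ?_
        have hx' : x ∈ Icc (0 : ℝ) 1 := by
          rw [uIcc_of_le τ.2.1] at hx; exact ⟨hx.1, hx.2.trans τ.2.2⟩
        simp [N, fc, u, projIcc_of_mem zero_le_one hx']
      rw [intervalIntegral.integral_smul, ← hP] at hint
      have hut : u τ = α z.1 (z.2 * τ) := rfl
      change u τ - cst z.1 τ - z.2 • P (N u) τ = 0
      rw [hint, hut, hcst, sub_self]
    have hnear : (z, u) ∈ Metric.ball p₀ ρ := by
      rw [Metric.mem_ball, Prod.dist_eq, max_lt_iff]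
      refine ⟨h4, (ContinuousMap.dist_lt_iff hρ).2 fun τ ↦ ?_⟩
      have hb := hbound z.1 h1 _ (hmul τ τ.2)
      have hτ : |z.2 * (τ : ℝ)| ≤ |z.2| := by
        rw [abs_mul, abs_of_nonneg τ.2.1]
        exact mul_le_of_le_one_right (abs_nonneg _) τ.2.2
      calc dist (u τ) (cst y₀ τ) = ‖(α z.1 (z.2 * τ) - z.1) + (z.1 - y₀)‖ := by
            rw [dist_eq_norm, sub_add_sub_cancel]; rfl
        _ ≤ ‖α z.1 (z.2 * τ) - z.1‖ + ‖z.1 - y₀‖ := norm_add_le _ _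
        _ ≤ L * |z.2| + ‖z.1 - y₀‖ := by
            gcongr; exact hb.trans (mul_le_mul_of_nonneg_left hτ hL0)
        _ < ρ := h3
    have := hρ' _ hnear
    rw [hu] at this
    change (g (z, 0)).2 one = _
    rw [this]
    simp [u, one]
  have hsolve' := hsolve.eventually_nhds
  have e0 : ∀ᶠ z : E × ℝ in 𝓝 (y₀, 0), φ (z.1, 0) = α z.1 0 := by
    have : Tendsto (fun z : E × ℝ ↦ (z.1, (0 : ℝ))) (𝓝 (y₀, 0)) (𝓝 (y₀, 0)) :=
      (by fun_prop : Continuous fun z : E × ℝ ↦ (z.1, (0 : ℝ))).tendsto' _ _ rfl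
    exact this.eventually hsolve
  have e1 : ∀ᶠ z : E × ℝ in 𝓝 (y₀, 0), z.1 ∈ Metric.closedBall y₀ r :=
    continuous_fst.continuousAt.eventually (Metric.closedBall_mem_nhds _ hr)
  have e2 : ∀ᶠ z : E × ℝ in 𝓝 (y₀, 0), z.2 ∈ Ioo (-ε) ε :=
    continuous_snd.continuousAt.eventually (Ioo_mem_nhds (by simpa using hε) (by simpa using hε))
  filter_upwards [hsolve', e0, e1, e2, hφ] with z h1 h2 h3 h4 h5
  refine ⟨h5, h2.trans (hα0 _ h3), ?_⟩
  have hz : φ z = α z.1 z.2 := h1.self_of_nhds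
  rw [hz]
  refine (hα z.1 h3 _ h4).congr_of_eventuallyEq ?_
  have : Tendsto (fun t : ℝ ↦ (z.1, t)) (𝓝 z.2) (𝓝 z) :=
    (by fun_prop : Continuous fun t : ℝ ↦ (z.1, t)).tendsto' _ _ rfl
  exact this.eventually h1

end LocalFlow

/-! ### Flows of smooth vector fields on closed surfaces -/

/-- A smooth map on an open set agrees near a given point with a bounded smooth map. -/
lemma exists_contDiff_bounded_eqOn_ball {E F : Type*} [NormedAddCommGroup E]
    [InnerProductSpace ℝ E] [FiniteDimensional ℝ E] [NormedAddCommGroup F] [NormedSpace ℝ F]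
    {f : E → F} {U : Set E} (hf : ContDiffOn ℝ ∞ f U) (hU : IsOpen U) {x : E} (hx : x ∈ U) :
    ∃ (g : E → F) (L r : ℝ), 0 < r ∧ Metric.ball x r ⊆ U ∧ ContDiff ℝ ∞ g ∧ (∀ y, ‖g y‖ ≤ L) ∧
      ∀ y ∈ Metric.ball x r, g y = f y := by
  obtain ⟨r, hr, hrt⟩ := Metric.nhds_basis_closedBall.mem_iff.1 (hU.mem_nhds hx)
  let χ : ContDiffBump x := ⟨r / 2, r, by positivity, by linarith⟩
  have hχt : tsupport χ ⊆ U := by rw [χ.tsupport_eq]; exact hrt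
  have hg : ContDiff ℝ ∞ fun y ↦ χ y • f y := by
    rw [contDiff_iff_contDiffAt]
    intro y
    by_cases hy : y ∈ tsupport χ
    · exact χ.contDiffAt.smul (hf.contDiffAt (hU.mem_nhds (hχt hy)))
    · have : (fun y ↦ χ y • f y) =ᶠ[𝓝 y] fun _ ↦ 0 := by
        filter_upwards [(isClosed_tsupport χ).isOpen_compl.mem_nhds hy] with w hw
        rw [image_eq_zero_of_notMem_tsupport hw, zero_smul]
      exact contDiffAt_const.congr_of_eventuallyEq this
  obtain ⟨L, hL⟩ := hg.continuous.bounded_above_of_compact_support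
    (χ.hasCompactSupport.smul_right (f' := f))
  refine ⟨_, L, r / 2, by positivity, fun y hy ↦ hrt ?_, hg, hL, fun y hy ↦ ?_⟩
  · exact Metric.closedBall_subset_closedBall (by linarith) (Metric.ball_subset_closedBall hy)
  · rw [χ.one_of_mem_closedBall (Metric.ball_subset_closedBall hy), one_smul]

section Flow

variable {M : Type*} [TopologicalSpace M] [ChartedSpace (EuclideanSpace ℝ (Fin 2)) M]

/-- Smoothness of a vector field, as a section of the tangent bundle. -/
def IsSmoothField [IsManifold (𝓡 2) ∞ M] (X : ∀ x : M, TangentSpace (𝓡 2) x) : Prop :=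
  ContMDiff (𝓡 2) (𝓡 2).tangent ∞ (fun x ↦ (⟨x, X x⟩ : TangentBundle (𝓡 2) M))

variable [IsManifold (𝓡 2) ∞ M] {X : ∀ x : M, TangentSpace (𝓡 2) x}

lemma contDiffOn_chart_field (hX : IsSmoothField X) (x₀ : M) :
    ContDiffOn ℝ ∞ (fun y ↦ tangentCoordChange (𝓡 2) ((extChartAt (𝓡 2) x₀).symm y) x₀
      ((extChartAt (𝓡 2) x₀).symm y) (X ((extChartAt (𝓡 2) x₀).symm y)))
      (extChartAt (𝓡 2) x₀).target := by
  have h1 := (trivializationAt (EuclideanSpace ℝ (Fin 2)) (TangentSpace (𝓡 2))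
    x₀).contMDiffOn_section_baseSet_iff (IB := 𝓡 2) (n := ∞) (s := X)
  have h2 := h1.1 (hX.contMDiffOn)
  have h3 : ContMDiffOn (𝓡 2) (𝓡 2) ∞ (extChartAt (𝓡 2) x₀).symm (extChartAt (𝓡 2) x₀).target :=
    contMDiffOn_extChartAt_symm x₀
  have h4 := h2.comp h3 (fun y hy ↦ by
    have := (extChartAt (𝓡 2) x₀).map_target hy
    simpa [extChartAt_source] using this)
  exact contMDiffOn_iff_contDiffOn.1 h4

theorem exists_contMDiffAt_localFlow (hX : IsSmoothField X) (x₀ : M) :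
    ∃ φ : M × ℝ → M, ∀ᶠ z in 𝓝 (x₀, (0 : ℝ)),
      ContMDiffAt ((𝓡 2).prod 𝓘(ℝ, ℝ)) (𝓡 2) ∞ φ z ∧ φ (z.1, 0) = z.1 ∧
      HasMFDerivAt 𝓘(ℝ, ℝ) (𝓡 2) (fun t ↦ φ (z.1, t)) z.2
        ((1 : ℝ →L[ℝ] ℝ).smulRight (X (φ z))) := by
  set e := extChartAt (𝓡 2) x₀ with he
  have hopen : IsOpen e.target := isOpen_extChartAt_target x₀
  set f : EuclideanSpace ℝ (Fin 2) → EuclideanSpace ℝ (Fin 2) := fun y ↦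
    tangentCoordChange (𝓡 2) (e.symm y) x₀ (e.symm y) (X (e.symm y)) with hf
  have hfs : ContDiffOn ℝ ∞ f e.target := contDiffOn_chart_field hX x₀
  obtain ⟨g, L, r, hr, hrt, hg, hL, hgf⟩ :=
    exists_contDiff_bounded_eqOn_ball hfs hopen (mem_extChartAt_target (I := 𝓡 2) x₀)
  obtain ⟨φ, hφ⟩ := exists_contDiffAt_localFlow hg hL (e x₀)
  have hφ0 := hφ.self_of_nhds
  have hball : ∀ᶠ z in 𝓝 (e x₀, (0 : ℝ)), φ z ∈ Metric.ball (e x₀) r := by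
    refine hφ0.1.continuousAt.eventually (Metric.isOpen_ball.mem_nhds ?_)
    rw [hφ0.2.1]
    exact Metric.mem_ball_self hr
  have hc : ContinuousAt (fun z : M × ℝ ↦ (e z.1, z.2)) (x₀, 0) :=
    ((continuousAt_extChartAt (I := 𝓡 2) x₀).comp continuousAt_fst).prodMk continuousAt_snd
  have hsrc : ∀ᶠ z : M × ℝ in 𝓝 (x₀, 0), z.1 ∈ e.source :=
    continuousAt_fst.eventually (extChartAt_source_mem_nhds (I := 𝓡 2) x₀)
  refine ⟨fun z ↦ e.symm (φ (e z.1, z.2)), ?_⟩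
  filter_upwards [hc.eventually hφ, hc.eventually hball, hsrc] with z ⟨h1, h2, h3⟩ hb hs
  have hbt : φ (e z.1, z.2) ∈ e.target :=
    hrt hb
  refine ⟨?_, ?_, ?_⟩
  · have k1 : ContMDiffAt (𝓡 2) (𝓡 2) ∞ e.symm (φ (e z.1, z.2)) :=
      (contMDiffOn_extChartAt_symm x₀).contMDiffAt (hopen.mem_nhds hbt)
    have k2 : ContMDiffAt ((𝓡 2).prod 𝓘(ℝ, ℝ)) 𝓘(ℝ, EuclideanSpace ℝ (Fin 2) × ℝ) ∞
        (fun z : M × ℝ ↦ (e z.1, z.2)) z := by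
      have : ContMDiffAt (𝓡 2) (𝓡 2) ∞ e z.1 :=
        contMDiffAt_extChartAt' (by simpa [he, extChartAt_source] using hs)
      exact (this.comp z contMDiffAt_fst).prodMk_space contMDiffAt_snd
    exact k1.comp z ((h1.contMDiffAt).comp z k2)
  · simp only [h2]
    exact e.left_inv hs
  · rw [hgf _ hb] at h3
    let xₜ : M := e.symm (φ (e z.1, z.2))
    have hft1 : xₜ ∈ e.source := e.map_target hbt
    have hft2 : xₜ ∈ (extChartAt (𝓡 2) xₜ).source := mem_extChartAt_source xₜ
    have key : ∀ w : EuclideanSpace ℝ (Fin 2), tangentCoordChange (𝓡 2) x₀ xₜ xₜ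
        (tangentCoordChange (𝓡 2) xₜ x₀ xₜ w) = w := fun w ↦ by
      rw [tangentCoordChange_comp (x := x₀) ⟨⟨hft2, hft1⟩, hft2⟩, tangentCoordChange_self hft2]
    have hd : HasDerivAt ((extChartAt (𝓡 2) xₜ ∘ e.symm) ∘ fun t ↦ φ (e z.1, t)) (X xₜ) z.2 := by
      have h4 := hasFDerivWithinAt_tangentCoordChange (I := 𝓡 2) ⟨hft1, hft2⟩
      rw [e.right_inv hbt] at h4
      have h5 := (h4.hasFDerivAt (by simp)).comp_hasDerivAt _ h3
      exact h5.congr_deriv (key (X xₜ))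
    have hcont : ContinuousAt (fun t ↦ e.symm (φ (e z.1, t))) z.2 :=
      (continuousAt_extChartAt_symm'' hbt).comp (f := fun t ↦ φ (e z.1, t)) h3.continuousAt
    exact ⟨hcont, hd.hasFDerivAt.hasFDerivWithinAt⟩

/-- `ψ` is the (complete) flow of the vector field `X`. -/
structure IsFlow (X : ∀ x : M, TangentSpace (𝓡 2) x) (ψ : ℝ → M → M) : Prop where
  zero : ∀ x, ψ 0 x = x
  curve : ∀ x, IsMIntegralCurve (I := 𝓡 2) (fun t ↦ ψ t x) X

lemma IsSmoothField.contMDiff_one (hX : IsSmoothField X) :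
    ContMDiff (𝓡 2) (𝓡 2).tangent 1 (fun x ↦ (⟨x, X x⟩ : TangentBundle (𝓡 2) M)) :=
  ContMDiff.of_le hX (by simp)

section Unique

variable [T2Space M] {ψ : ℝ → M → M}

lemma IsFlow.eq_of_isMIntegralCurve (hψ : IsFlow X ψ) (hX : IsSmoothField X) {γ : ℝ → M}
    (hγ : IsMIntegralCurve (I := 𝓡 2) γ X) (t : ℝ) : γ t = ψ t (γ 0) :=
  congrFun (isMIntegralCurve_Ioo_eq_of_contMDiff_boundaryless (t₀ := 0) hX.contMDiff_one hγ
    (hψ.curve (γ 0)) (hψ.zero _).symm) t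

lemma IsFlow.add (hψ : IsFlow X ψ) (hX : IsSmoothField X) (s t : ℝ) (x : M) :
    ψ (s + t) x = ψ s (ψ t x) := by
  have := hψ.eq_of_isMIntegralCurve hX ((hψ.curve x).comp_add t) s
  simpa using this

lemma IsFlow.neg_cancel (hψ : IsFlow X ψ) (hX : IsSmoothField X) (t : ℝ) (x : M) :
    ψ (-t) (ψ t x) = x := by
  rw [← hψ.add hX, neg_add_cancel, hψ.zero]

lemma IsFlow.cancel_neg (hψ : IsFlow X ψ) (hX : IsSmoothField X) (t : ℝ) (x : M) :
    ψ t (ψ (-t) x) = x := by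
  rw [← hψ.add hX, add_neg_cancel, hψ.zero]

variable [CompactSpace M]

omit [T2Space M] in
/-- On a compact surface, the local flows of a smooth field exist for a common time. -/
lemma exists_uniform_localFlow (hX : IsSmoothField X) :
    ∃ ε > 0, ∀ x : M, ∃ φ : M × ℝ → M, ∀ᶠ y in 𝓝 x, ∀ t ∈ Ioo (-ε) ε,
      ContMDiffAt ((𝓡 2).prod 𝓘(ℝ, ℝ)) (𝓡 2) ∞ φ (y, t) ∧ φ (y, 0) = y ∧
      HasMFDerivAt 𝓘(ℝ, ℝ) (𝓡 2) (fun t ↦ φ (y, t)) t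
        ((1 : ℝ →L[ℝ] ℝ).smulRight (X (φ (y, t)))) := by
  let P : Set M → Prop := fun s ↦ ∃ ε > 0, ∀ x ∈ s, ∃ φ : M × ℝ → M,
    ∀ᶠ y in 𝓝 x, ∀ t ∈ Ioo (-ε) ε,
      ContMDiffAt ((𝓡 2).prod 𝓘(ℝ, ℝ)) (𝓡 2) ∞ φ (y, t) ∧ φ (y, 0) = y ∧
      HasMFDerivAt 𝓘(ℝ, ℝ) (𝓡 2) (fun t ↦ φ (y, t)) t
        ((1 : ℝ →L[ℝ] ℝ).smulRight (X (φ (y, t))))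
  suffices P univ by
    obtain ⟨ε, hε, h⟩ := this
    exact ⟨ε, hε, fun x ↦ h x (mem_univ x)⟩
  refine isCompact_univ.induction_on (p := P) ⟨1, one_pos, by simp⟩ ?_ ?_ ?_
  · rintro s t hst ⟨ε, hε, h⟩
    exact ⟨ε, hε, fun x hx ↦ h x (hst hx)⟩
  · rintro s t ⟨ε, hε, h⟩ ⟨ε', hε', h'⟩
    refine ⟨min ε ε', lt_min hε hε', fun x hx ↦ ?_⟩
    rcases hx with hx | hx
    · obtain ⟨φ, hφ⟩ := h x hx
      exact ⟨φ, hφ.mono fun y hy t ht ↦ hy t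
        (Ioo_subset_Ioo (neg_le_neg (min_le_left _ _)) (min_le_left _ _) ht)⟩
    · obtain ⟨φ, hφ⟩ := h' x hx
      exact ⟨φ, hφ.mono fun y hy t ht ↦ hy t
        (Ioo_subset_Ioo (neg_le_neg (min_le_right _ _)) (min_le_right _ _) ht)⟩
  · intro x _
    obtain ⟨φ, hφ⟩ := exists_contMDiffAt_localFlow hX x
    rw [nhds_prod_eq] at hφ
    obtain ⟨pa, ha, pb, hb, hab⟩ := eventually_prod_iff.1 hφ
    obtain ⟨ε, hε, hεb⟩ := Metric.eventually_nhds_iff_ball.1 hb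
    refine ⟨{y | ∀ᶠ z in 𝓝 y, pa z}, mem_nhdsWithin_of_mem_nhds ha.eventually_nhds, ε, hε,
      fun y hy ↦ ⟨φ, hy.mono fun z hz t ht ↦ hab hz (hεb t ?_)⟩⟩
    rwa [Real.ball_eq_Ioo, zero_sub, zero_add]

/-- A smooth vector field on a closed surface has a complete flow. -/
theorem IsSmoothField.exists_isFlow (hX : IsSmoothField X) : ∃ ψ, IsFlow X ψ := by
  obtain ⟨ε, hε, h⟩ := exists_uniform_localFlow hX
  have := exists_isMIntegralCurve_of_isMIntegralCurveOn hX.contMDiff_one hε fun x ↦ by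
    obtain ⟨φ, hφ⟩ := h x
    have hx := hφ.self_of_nhds
    exact ⟨fun t ↦ φ (x, t), (hx 0 ⟨by linarith, hε⟩).2.1,
      fun t ht ↦ (hx t ht).2.2.hasMFDerivWithinAt⟩
  choose γ hγ0 hγ using this
  exact ⟨fun t x ↦ γ x t, hγ0, hγ⟩

/-- The flow of a smooth vector field on a closed surface is jointly smooth in time and space. -/
theorem IsFlow.contMDiff (hψ : IsFlow X ψ) (hX : IsSmoothField X) :
    ContMDiff (𝓘(ℝ, ℝ).prod (𝓡 2)) (𝓡 2) ∞ fun z : ℝ × M ↦ ψ z.1 z.2 := by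
  obtain ⟨ε, hε, h⟩ := exists_uniform_localFlow hX
  have step : ∀ n : ℕ, ∀ z : ℝ × M, |z.1| < 2 ^ n * ε →
      ContMDiffAt (𝓘(ℝ, ℝ).prod (𝓡 2)) (𝓡 2) ∞ (fun z : ℝ × M ↦ ψ z.1 z.2) z := by
    intro n
    induction n with
    | zero =>
      rintro ⟨t, x⟩ ht
      rw [pow_zero, one_mul, abs_lt] at ht
      obtain ⟨φ, hφ⟩ := h x
      have heq : (fun z : ℝ × M ↦ ψ z.1 z.2) =ᶠ[𝓝 (t, x)] fun z ↦ φ (z.2, z.1) := by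
        rw [nhds_prod_eq]
        have ht' : ∀ᶠ t in 𝓝 t, t ∈ Ioo (-ε) ε := Ioo_mem_nhds ht.1 ht.2
        filter_upwards [ht'.prod_inl (𝓝 x), hφ.prod_inr (𝓝 t)] with z h1 h2
        refine isMIntegralCurveOn_Ioo_eqOn_of_contMDiff_boundaryless (t₀ := 0)
          (γ := fun t ↦ ψ t z.2) (γ' := fun t ↦ φ (z.2, t)) ⟨by linarith, hε⟩
          hX.contMDiff_one ((hψ.curve z.2).isMIntegralCurveOn _)
          (fun t ht ↦ (h2 t ht).2.2.hasMFDerivWithinAt) ?_ h1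
        rw [hψ.zero, (h2 0 ⟨by linarith, hε⟩).2.1]
      have hs := (hφ.self_of_nhds t ht).1
      refine ContMDiffAt.congr_of_eventuallyEq ?_ heq
      exact ContMDiffAt.comp (t, x) hs (contMDiffAt_snd.prodMk contMDiffAt_fst)
    | succ n ih =>
      rintro ⟨t, x⟩ ht
      have ht' : |t / 2| < 2 ^ n * ε := by
        rw [abs_div, abs_two]; rw [pow_succ] at ht; simp only at ht; linarith
      have heq : (fun z : ℝ × M ↦ ψ z.1 z.2) = fun z ↦ ψ (z.1 / 2) (ψ (z.1 / 2) z.2) := by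
        ext z
        rw [← hψ.add hX, add_halves]
      rw [heq]
      have h0 : ContMDiffAt (𝓘(ℝ, ℝ).prod (𝓡 2)) 𝓘(ℝ, ℝ) ∞ (fun z : ℝ × M ↦ z.1 / 2) (t, x) :=
        ((contDiff_id.div_const 2).contMDiff (𝕜 := ℝ)).contMDiffAt.comp (t, x) contMDiffAt_fst
      have h1 : ContMDiffAt (𝓘(ℝ, ℝ).prod (𝓡 2)) (𝓘(ℝ, ℝ).prod (𝓡 2)) ∞
          (fun z : ℝ × M ↦ (z.1 / 2, z.2)) (t, x) := h0.prodMk contMDiffAt_snd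
      have h2 : ContMDiffAt (𝓘(ℝ, ℝ).prod (𝓡 2)) (𝓡 2) ∞
          (fun z : ℝ × M ↦ ψ (z.1 / 2) z.2) (t, x) :=
        ContMDiffAt.comp (t, x) (ih (t / 2, x) ht') h1
      have h3 : ContMDiffAt (𝓘(ℝ, ℝ).prod (𝓡 2)) (𝓘(ℝ, ℝ).prod (𝓡 2)) ∞
          (fun z : ℝ × M ↦ (z.1 / 2, ψ (z.1 / 2) z.2)) (t, x) := h0.prodMk h2
      exact ContMDiffAt.comp (t, x) (ih (t / 2, ψ (t / 2) x) ht') h3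
  intro z
  obtain ⟨n, hn⟩ := pow_unbounded_of_one_lt (|z.1| / ε) one_lt_two
  exact step n z (by rwa [div_lt_iff₀ hε] at hn)

lemma IsFlow.continuous (hψ : IsFlow X ψ) (hX : IsSmoothField X) :
    Continuous fun z : ℝ × M ↦ ψ z.1 z.2 := (hψ.contMDiff hX).continuous

lemma IsFlow.contMDiff_comp (hψ : IsFlow X ψ) (hX : IsSmoothField X) {E N : Type*}
    [NormedAddCommGroup E] [NormedSpace ℝ E] [TopologicalSpace N] [ChartedSpace E N]
    {τ : N → ℝ} {g : N → M} (hτ : ContMDiff 𝓘(ℝ, E) 𝓘(ℝ, ℝ) ∞ τ)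
    (hg : ContMDiff 𝓘(ℝ, E) (𝓡 2) ∞ g) :
    ContMDiff 𝓘(ℝ, E) (𝓡 2) ∞ fun z ↦ ψ (τ z) (g z) :=
  (hψ.contMDiff hX).comp (hτ.prodMk hg)

end Unique

end Flow

/-! ### Smoothness of vector fields and forms along maps -/

section BundleSmoothness

open Bundle

section General

variable {E : Type*} [NormedAddCommGroup E] [NormedSpace ℝ E] {G : Type*} [TopologicalSpace G]
  {I : ModelWithCorners ℝ E G} {N : Type*} [TopologicalSpace N] [ChartedSpace G N]
  [IsManifold I ∞ N]
  {E' : Type*} [NormedAddCommGroup E'] [NormedSpace ℝ E'] {G' : Type*} [TopologicalSpace G']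
  {I' : ModelWithCorners ℝ E' G'} {N' : Type*} [TopologicalSpace N'] [ChartedSpace G' N']
  [IsManifold I' ∞ N']

lemma contMDiffAt_mfderiv_apply {f : N → N'} {x₀ : N} (hf : ContMDiffAt I I' ∞ f x₀)
    {V : ∀ x : N, TangentSpace I x}
    (hV : ContMDiffAt I I.tangent ∞ (fun x ↦ (⟨x, V x⟩ : TangentBundle I N)) x₀) :
    ContMDiffAt I I'.tangent ∞
      (fun x ↦ (⟨f x, mfderiv I I' f x (V x)⟩ : TangentBundle I' N')) x₀ := by
  have h1 : ContMDiffAt I 𝓘(ℝ, E →L[ℝ] E') ∞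
      (inTangentCoordinates I I' id f (mfderiv I I' f) x₀) x₀ :=
    ContMDiffAt.mfderiv_const (m := ∞) (n := ∞) hf (by simp)
  exact ContMDiffAt.clm_apply_of_inCoordinates (E₁ := (TangentSpace I : N → Type _))
    (E₂ := (TangentSpace I' : N' → Type _)) (b₁ := id) (b₂ := f) h1 hV hf

lemma contMDiff_const_field (w : E) :
    ContMDiff 𝓘(ℝ, E) 𝓘(ℝ, E).tangent ∞ (fun x ↦ (⟨x, w⟩ : TangentBundle 𝓘(ℝ, E) E)) := by
  intro x
  rw [contMDiffAt_totalSpace]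
  refine ⟨contMDiffAt_id, ?_⟩
  simpa using contMDiffAt_const

/-- The derivative of a real function along a field is smooth. -/
lemma contMDiffAt_mfderiv_real {f : N → ℝ} {x₀ : N} (hf : ContMDiffAt I 𝓘(ℝ, ℝ) ∞ f x₀)
    {V : ∀ x : N, TangentSpace I x}
    (hV : ContMDiffAt I I.tangent ∞ (fun x ↦ (⟨x, V x⟩ : TangentBundle I N)) x₀) :
    ContMDiffAt I 𝓘(ℝ, ℝ) ∞ (fun x ↦ (mfderiv I 𝓘(ℝ, ℝ) f x (V x) : ℝ)) x₀ := by
  have := contMDiffAt_mfderiv_apply hf hV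
  rw [contMDiffAt_totalSpace] at this
  simpa using this.2

end General

variable {M : Type*} [TopologicalSpace M] [ChartedSpace (EuclideanSpace ℝ (Fin 2)) M]
  [IsManifold (𝓡 2) ∞ M]
  {E : Type*} [NormedAddCommGroup E] [NormedSpace ℝ E] {G : Type*} [TopologicalSpace G]
  {I : ModelWithCorners ℝ E G} {N : Type*} [TopologicalSpace N] [ChartedSpace G N]

lemma IsAreaForm.contMDiffAt_apply {σ : BilinField M} (hσ : IsAreaForm σ) {f : N → M}
    {V W : ∀ z : N, TangentSpace (𝓡 2) (f z)} {z₀ : N}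
    (hV : ContMDiffAt I (𝓡 2).tangent ∞ (fun z ↦ (⟨f z, V z⟩ : TangentBundle (𝓡 2) M)) z₀)
    (hW : ContMDiffAt I (𝓡 2).tangent ∞ (fun z ↦ (⟨f z, W z⟩ : TangentBundle (𝓡 2) M)) z₀) :
    ContMDiffAt I 𝓘(ℝ, ℝ) ∞ (fun z ↦ σ (f z) (V z) (W z)) z₀ := by
  have hf : ContMDiffAt I (𝓡 2) ∞ f z₀ := (contMDiffAt_totalSpace.1 hV).1
  have : ContMDiffAt I ((𝓡 2).prod 𝓘(ℝ)) ∞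
      (fun z ↦ TotalSpace.mk' ℝ (E := Bundle.Trivial M ℝ) (f z) (σ (f z) (V z) (W z))) z₀ := by
    apply ContMDiffAt.clm_bundle_apply₂ (F₁ := EuclideanSpace ℝ (Fin 2))
      (F₂ := EuclideanSpace ℝ (Fin 2))
    · exact ContMDiffAt.comp z₀ (hσ.smooth (f z₀)) hf
    · exact hV
    · exact hW
  exact (contMDiffAt_totalSpace.1 this).2

lemma IsSmoothPath.contMDiffAt_apply {J : ℝ → EndField M} (hJ : IsSmoothPath J) {f : N → M}
    {τ : N → ℝ} {V : ∀ z : N, TangentSpace (𝓡 2) (f z)} {z₀ : N}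
    (hτ : ContMDiffAt I 𝓘(ℝ, ℝ) ∞ τ z₀)
    (hV : ContMDiffAt I (𝓡 2).tangent ∞ (fun z ↦ (⟨f z, V z⟩ : TangentBundle (𝓡 2) M)) z₀) :
    ContMDiffAt I (𝓡 2).tangent ∞
      (fun z ↦ (⟨f z, J (τ z) (f z) (V z)⟩ : TangentBundle (𝓡 2) M)) z₀ := by
  have hf : ContMDiffAt I (𝓡 2) ∞ f z₀ := (contMDiffAt_totalSpace.1 hV).1
  refine ContMDiffAt.clm_bundle_apply (F₁ := EuclideanSpace ℝ (Fin 2)) ?_ hV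
  have h1 : ContMDiffAt I (𝓘(ℝ, ℝ).prod (𝓡 2)) ∞ (fun z ↦ (τ z, f z)) z₀ := hτ.prodMk hf
  exact ContMDiffAt.comp z₀ (hJ (τ z₀, f z₀)) h1

lemma contMDiffAt_smul_field {f : N → M} {a : N → ℝ}
    {V : ∀ z : N, TangentSpace (𝓡 2) (f z)} {z₀ : N}
    (ha : ContMDiffAt I 𝓘(ℝ, ℝ) ∞ a z₀)
    (hV : ContMDiffAt I (𝓡 2).tangent ∞ (fun z ↦ (⟨f z, V z⟩ : TangentBundle (𝓡 2) M)) z₀) :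
    ContMDiffAt I (𝓡 2).tangent ∞
      (fun z ↦ (⟨f z, a z • V z⟩ : TangentBundle (𝓡 2) M)) z₀ := by
  rw [contMDiffAt_totalSpace] at hV ⊢
  refine ⟨hV.1, (ha.smul hV.2).congr_of_eventuallyEq ?_⟩
  have := hV.1.continuousAt.eventually ((trivializationAt (EuclideanSpace ℝ (Fin 2))
    (TangentSpace (𝓡 2)) (f z₀)).open_baseSet.mem_nhds (mem_baseSet_trivializationAt _ _ _))
  filter_upwards [this] with z hz
  exact ((trivializationAt (EuclideanSpace ℝ (Fin 2)) (TangentSpace (𝓡 2)) (f z₀)).linear ℝ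
    hz).map_smul (a z) (V z)

lemma contMDiffAt_add_field {f : N → M}
    {V W : ∀ z : N, TangentSpace (𝓡 2) (f z)} {z₀ : N}
    (hV : ContMDiffAt I (𝓡 2).tangent ∞ (fun z ↦ (⟨f z, V z⟩ : TangentBundle (𝓡 2) M)) z₀)
    (hW : ContMDiffAt I (𝓡 2).tangent ∞ (fun z ↦ (⟨f z, W z⟩ : TangentBundle (𝓡 2) M)) z₀) :
    ContMDiffAt I (𝓡 2).tangent ∞
      (fun z ↦ (⟨f z, V z + W z⟩ : TangentBundle (𝓡 2) M)) z₀ := by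
  rw [contMDiffAt_totalSpace] at hV hW ⊢
  refine ⟨hV.1, (hV.2.add hW.2).congr_of_eventuallyEq ?_⟩
  have := hV.1.continuousAt.eventually ((trivializationAt (EuclideanSpace ℝ (Fin 2))
    (TangentSpace (𝓡 2)) (f z₀)).open_baseSet.mem_nhds (mem_baseSet_trivializationAt _ _ _))
  filter_upwards [this] with z hz
  exact ((trivializationAt (EuclideanSpace ℝ (Fin 2)) (TangentSpace (𝓡 2)) (f z₀)).linear ℝ
    hz).map_add (V z) (W z)

lemma IsAreaForm.swap {σ : BilinField M} (hσ : IsAreaForm σ) (x : M)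
    (v w : TangentSpace (𝓡 2) x) : σ x v w = -σ x w v := by
  have h := hσ.alternating x (v + w)
  simp only [map_add, add_apply, hσ.alternating] at h
  linarith

/-- Every point has a neighbourhood with a smooth frame. -/
lemma exists_local_frame (x₀ : M) : ∃ (e : Fin 2 → ∀ x : M, TangentSpace (𝓡 2) x),
    (∀ i, ContMDiffAt (𝓡 2) (𝓡 2).tangent ∞ (fun x ↦ (⟨x, e i x⟩ : TangentBundle (𝓡 2) M)) x₀) ∧
    ∀ᶠ x in 𝓝 x₀, e 0 x ≠ 0 ∧ ∀ v : TangentSpace (𝓡 2) x, ∃ a b : ℝ,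
      v = a • e 0 x + b • e 1 x := by
  let T := trivializationAt (EuclideanSpace ℝ (Fin 2)) (TangentSpace (𝓡 2)) x₀
  have hx₀ : x₀ ∈ T.baseSet := mem_baseSet_trivializationAt _ _ _
  let bs := EuclideanSpace.basisFun (Fin 2) ℝ
  refine ⟨fun i x ↦ T.symm x (bs i), fun i ↦ ?_, ?_⟩
  · have h1 := T.contMDiffOn_section_baseSet_iff (IB := 𝓡 2) (n := ∞)
      (s := fun x ↦ T.symm x (bs i))
    refine (h1.2 ?_).contMDiffAt (T.open_baseSet.mem_nhds hx₀)
    refine contMDiffOn_const (c := bs i) |>.congr fun x hx ↦ ?_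
    rw [T.apply_mk_symm hx]
  · filter_upwards [T.open_baseSet.mem_nhds hx₀] with x hx
    let L := T.continuousLinearEquivAt ℝ x hx
    have hL : ∀ w, T.symm x w = L.symm w := fun w ↦ rfl
    refine ⟨?_, fun v ↦ ⟨bs.repr (L v) 0, bs.repr (L v) 1, ?_⟩⟩
    · rw [hL]
      exact fun h ↦ bs.orthonormal.ne_zero 0 (by simpa using h)
    · rw [hL, hL, ← L.symm.map_smul, ← L.symm.map_smul, ← L.symm.map_add]
      rw [ContinuousLinearEquiv.eq_symm_apply]
      conv_lhs => rw [← bs.sum_repr (L v)]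
      rw [Fin.sum_univ_two]

/-- A field is determined by its contraction with an area form: the field `X` with `σ(X, ·) = β`
is smooth when `β` is. -/
lemma IsAreaForm.isSmoothField {σ : BilinField M} (hσ : IsAreaForm σ)
    {X : ∀ x : M, TangentSpace (𝓡 2) x}
    (hX : ∀ (x₀ : M) (V : ∀ x : M, TangentSpace (𝓡 2) x),
      ContMDiffAt (𝓡 2) (𝓡 2).tangent ∞ (fun x ↦ (⟨x, V x⟩ : TangentBundle (𝓡 2) M)) x₀ →
      ContMDiffAt (𝓡 2) 𝓘(ℝ, ℝ) ∞ (fun x ↦ σ x (X x) (V x)) x₀) :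
    IsSmoothField X := by
  intro x₀
  obtain ⟨e, he, hspan⟩ := exists_local_frame x₀
  have ha := hσ.contMDiffAt_apply (he 0) (he 1)
  have hne : ∀ᶠ x in 𝓝 x₀, σ x (e 0 x) (e 1 x) ≠ 0 := by
    filter_upwards [hspan] with x ⟨h0, hx⟩ h
    obtain ⟨w, hw⟩ := hσ.nondegenerate x _ h0
    obtain ⟨a, b, rfl⟩ := hx w
    simp [hσ.alternating, h] at hw
  have h0 : ContMDiffAt (𝓡 2) 𝓘(ℝ, ℝ) ∞
      (fun x ↦ σ x (X x) (e 1 x) / σ x (e 0 x) (e 1 x)) x₀ :=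
    (hX x₀ _ (he 1)).div₀ ha hne.self_of_nhds
  have h1 : ContMDiffAt (𝓡 2) 𝓘(ℝ, ℝ) ∞
      (fun x ↦ -(σ x (X x) (e 0 x) / σ x (e 0 x) (e 1 x))) x₀ :=
    ((hX x₀ _ (he 0)).div₀ ha hne.self_of_nhds).neg
  refine (contMDiffAt_add_field (contMDiffAt_smul_field h0 (he 0))
    (contMDiffAt_smul_field h1 (he 1))).congr_of_eventuallyEq ?_
  filter_upwards [hspan, hne] with x ⟨_, hx⟩ hn
  obtain ⟨a, b, hab⟩ := hx (X x)
  have e0 : σ x (X x) (e 0 x) = - b * σ x (e 0 x) (e 1 x) := by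
    rw [hab]; simp [hσ.alternating, hσ.swap x (e 1 x) (e 0 x)]
  have e1 : σ x (X x) (e 1 x) = a * σ x (e 0 x) (e 1 x) := by
    rw [hab]; simp [hσ.alternating]
  rw [e0, e1, mul_div_cancel_right₀ _ hn, mul_div_cancel_right₀ _ hn, neg_neg, ← hab]

/-- Hamiltonian vector fields are smooth. -/
lemma IsAreaForm.isSmoothField_hamiltonian {σ : BilinField M} (hσ : IsAreaForm σ) {H : M → ℝ}
    (hH : ContMDiff (𝓡 2) 𝓘(ℝ, ℝ) ∞ H) {X : ∀ x : M, TangentSpace (𝓡 2) x}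
    (hX : ∀ (x : M) (v : TangentSpace (𝓡 2) x), mfderiv (𝓡 2) 𝓘(ℝ, ℝ) H x v = σ x (X x) v) :
    IsSmoothField X :=
  hσ.isSmoothField fun x₀ V hV ↦ (contMDiffAt_mfderiv_real (hH x₀) hV).congr_of_eventuallyEq
    (Eventually.of_forall fun x ↦ (hX x (V x)).symm)

/-- Every smooth function has a Hamiltonian vector field. -/
lemma IsAreaForm.exists_hamiltonianField {σ : BilinField M} (hσ : IsAreaForm σ) (H : M → ℝ) :
    ∃ X : ∀ x : M, TangentSpace (𝓡 2) x,
      ∀ (x : M) (v : TangentSpace (𝓡 2) x), mfderiv (𝓡 2) 𝓘(ℝ, ℝ) H x v = σ x (X x) v := by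
  have : ∀ x : M, ∃ X : TangentSpace (𝓡 2) x, ∀ v : TangentSpace (𝓡 2) x,
      mfderiv (𝓡 2) 𝓘(ℝ, ℝ) H x v = σ x X v := by
    intro x
    let A : EuclideanSpace ℝ (Fin 2) →ₗ[ℝ] Module.Dual ℝ (EuclideanSpace ℝ (Fin 2)) :=
      { toFun := fun v ↦ (σ x v : EuclideanSpace ℝ (Fin 2) →L[ℝ] ℝ).toLinearMap
        map_add' := fun v w ↦ LinearMap.ext fun z ↦
          congrArg (fun l : TangentSpace (𝓡 2) x →L[ℝ] ℝ ↦ l z) ((σ x).map_add v w)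
        map_smul' := fun c v ↦ LinearMap.ext fun z ↦
          congrArg (fun l : TangentSpace (𝓡 2) x →L[ℝ] ℝ ↦ l z) ((σ x).map_smul c v) }
    have hA : Function.Injective A := by
      rw [← LinearMap.ker_eq_bot, LinearMap.ker_eq_bot']
      intro v hv
      by_contra hne
      obtain ⟨w, hw⟩ := hσ.nondegenerate x v hne
      exact hw (congrArg (fun l ↦ l w) hv)
    have hsurj := (LinearMap.injective_iff_surjective_of_finrank_eq_finrank
      (Subspace.dual_finrank_eq (K := ℝ) (V := EuclideanSpace ℝ (Fin 2))).symm).1 hA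
    obtain ⟨X, hX⟩ := hsurj (mfderiv (𝓡 2) 𝓘(ℝ, ℝ) H x :
      EuclideanSpace ℝ (Fin 2) →L[ℝ] ℝ).toLinearMap
    exact ⟨X, fun v ↦ (congrArg (fun l ↦ l v) hX).symm⟩
  choose X hX using this
  exact ⟨X, hX⟩

lemma contMDiff_partial {v : ℝ × ℝ → M} (hv : ContMDiff 𝓘(ℝ, ℝ × ℝ) (𝓡 2) ∞ v) (w : ℝ × ℝ) :
    ContMDiff 𝓘(ℝ, ℝ × ℝ) (𝓡 2).tangent ∞
      (fun z ↦ (⟨v z, mfderiv 𝓘(ℝ, ℝ × ℝ) (𝓡 2) v z w⟩ : TangentBundle (𝓡 2) M)) :=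
  fun z ↦ contMDiffAt_mfderiv_apply (hv z) (contMDiff_const_field w z)

/-- The pull-back of `σ` by `v`, as a density: `v^*σ = -(areaDensity σ v) ds ∧ dt`. -/
def areaDensity (σ : BilinField M) (v : ℝ × ℝ → M) (z : ℝ × ℝ) : ℝ :=
  σ (v z) (partialT v z) (partialS v z)

lemma IsAreaForm.contDiff_areaDensity {σ : BilinField M} (hσ : IsAreaForm σ) {v : ℝ × ℝ → M}
    (hv : ContMDiff 𝓘(ℝ, ℝ × ℝ) (𝓡 2) ∞ v) : ContDiff ℝ ∞ (areaDensity σ v) := by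
  rw [← contMDiff_iff_contDiff]
  exact fun z ↦ hσ.contMDiffAt_apply (contMDiff_partial hv _ z) (contMDiff_partial hv _ z)

omit [IsManifold (𝓡 2) ∞ M] in
lemma partialT_eq {v : ℝ × ℝ → M} {s t : ℝ} (hv : MDifferentiableAt 𝓘(ℝ, ℝ × ℝ) (𝓡 2) v (s, t)) :
    partialT v (s, t) = mfderiv 𝓘(ℝ, ℝ) (𝓡 2) (fun t ↦ v (s, t)) t (1 : ℝ) := by
  have h1 : HasMFDerivAt 𝓘(ℝ, ℝ) 𝓘(ℝ, ℝ × ℝ) (fun t : ℝ ↦ ((s, t) : ℝ × ℝ)) t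
      (ContinuousLinearMap.inr ℝ ℝ ℝ) := (hasFDerivAt_prodMk_right s t).hasMFDerivAt
  have h2 := (HasMFDerivAt.comp t hv.hasMFDerivAt h1).mfderiv
  change _ = mfderiv 𝓘(ℝ, ℝ) (𝓡 2) (v ∘ fun t ↦ (s, t)) t (1 : ℝ)
  rw [h2]
  rfl

omit [IsManifold (𝓡 2) ∞ M] in
lemma partialS_eq {v : ℝ × ℝ → M} {s t : ℝ} (hv : MDifferentiableAt 𝓘(ℝ, ℝ × ℝ) (𝓡 2) v (s, t)) :
    partialS v (s, t) = mfderiv 𝓘(ℝ, ℝ) (𝓡 2) (fun s ↦ v (s, t)) s (1 : ℝ) := by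
  have h1 : HasMFDerivAt 𝓘(ℝ, ℝ) 𝓘(ℝ, ℝ × ℝ) (fun s : ℝ ↦ ((s, t) : ℝ × ℝ)) s
      (ContinuousLinearMap.inl ℝ ℝ ℝ) := (hasFDerivAt_prodMk_left s t).hasMFDerivAt
  have h2 := (HasMFDerivAt.comp s hv.hasMFDerivAt h1).mfderiv
  change _ = mfderiv 𝓘(ℝ, ℝ) (𝓡 2) (v ∘ fun s ↦ (s, t)) s (1 : ℝ)
  rw [h2]
  rfl

lemma actionForm_eq_integral_areaDensity (σ : BilinField M) {v : ℝ × ℝ → M}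
    (hv : ContMDiff 𝓘(ℝ, ℝ × ℝ) (𝓡 2) ∞ v) (s : ℝ) :
    actionForm σ (fun t ↦ v (s, t)) (fun t ↦ partialS v (s, t)) =
      ∫ t in (0 : ℝ)..1, areaDensity σ v (s, t) := by
  refine intervalIntegral.integral_congr fun t _ ↦ ?_
  simp only [areaDensity]
  rw [partialT_eq (hv.mdifferentiableAt (by simp))]

/-- Adding a nonnegative multiple of an area form gives an area form. -/
lemma IsAreaForm.one_add_smul {σ : BilinField M} (hσ : IsAreaForm σ) {g : M → ℝ}
    (hg : ContMDiff (𝓡 2) 𝓘(ℝ, ℝ) ∞ g) (hg0 : ∀ x, 0 ≤ g x) :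
    IsAreaForm (fun x ↦ (1 + g x) • σ x : BilinField M) where
  smooth := ContMDiff.smul_section (contMDiff_const.add hg) hσ.smooth
  alternating x v := by simp [hσ.alternating]
  nondegenerate x v hv := by
    obtain ⟨w, hw⟩ := hσ.nondegenerate x v hv
    refine ⟨w, ?_⟩
    have : 1 + g x ≠ 0 := by linarith [hg0 x]
    simpa using ⟨this, hw⟩

/-- Comparing the vanishing periods for `σ` and for `(1 + g)σ`: the `g`-weighted area swept out
by a loop of twisted loops is zero. -/
theorem HypH4.integral_weight_eq_zero {m : ℕ} {σ : BilinField M} {Φ : M → M}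
    {κ : Fin m → ℝ × ℝ → M} (h4 : HypH4 σ Φ κ) (hσ : IsAreaForm σ) (hΦ : IsInvariantForm Φ σ)
    {g : M → ℝ} (hg : ContMDiff (𝓡 2) 𝓘(ℝ, ℝ) ∞ g) (hg0 : ∀ x, 0 ≤ g x)
    (hgΦ : ∀ x, g (Φ x) = g x) (hgκ : ∀ x ∉ collarSet κ, g x = 0)
    {v : ℝ × ℝ → M} (hv : ContMDiff 𝓘(ℝ, ℝ × ℝ) (𝓡 2) ∞ v) (hper : ∀ s t, v (s + 1, t) = v (s, t))
    (htw : ∀ s t, v (s, t) = Φ (v (s, t + 1))) :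
    ∫ s in (0 : ℝ)..1, ∫ t in (0 : ℝ)..1, g (v (s, t)) * areaDensity σ v (s, t) = 0 := by
  have hloop : ∀ s, (fun t ↦ v (s, t)) ∈ twistedLoops Φ := fun s ↦
    ⟨hv.comp ((contDiff_prodMk_right s).contMDiff), htw s⟩
  have e1 := h4 σ hσ hΦ (fun _ _ ↦ rfl) v hv hper hloop
  have e2 := h4 _ (hσ.one_add_smul hg hg0) (fun x a b ↦ by simp [hgΦ, hΦ x a b])
    (fun x hx ↦ by simp [hgκ x hx]) v hv hper hloop
  simp only [actionForm_eq_integral_areaDensity _ hv] at e1 e2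
  have hD : Continuous (areaDensity σ v) := (hσ.contDiff_areaDensity hv).continuous
  have hgv : Continuous fun z ↦ g (v z) * areaDensity σ v z :=
    (hg.continuous.comp hv.continuous).mul hD
  have e3 : ∀ s t, areaDensity (fun x ↦ (1 + g x) • σ x : BilinField M) v (s, t) =
      areaDensity σ v (s, t) + g (v (s, t)) * areaDensity σ v (s, t) := fun s t ↦ by
    simp only [areaDensity, smul_apply, smul_eq_mul]; ring
  have hs : ∀ {k : ℝ × ℝ → ℝ}, Continuous k → ∀ s : ℝ, Continuous fun t ↦ k (s, t) :=
    fun hk s ↦ by fun_prop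
  have hi : ∀ {k : ℝ × ℝ → ℝ}, Continuous k → Continuous fun s ↦ ∫ t in (0 : ℝ)..1, k (s, t) :=
    fun {k} hk ↦ intervalIntegral.continuous_parametric_intervalIntegral_of_continuous'
      (f := fun s t ↦ k (s, t)) (by fun_prop) 0 1
  have e4 : ∀ s, ∫ t in (0 : ℝ)..1, areaDensity (fun x ↦ (1 + g x) • σ x : BilinField M) v (s, t) =
      (∫ t in (0 : ℝ)..1, areaDensity σ v (s, t)) +
        ∫ t in (0 : ℝ)..1, g (v (s, t)) * areaDensity σ v (s, t) := fun s ↦ by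
    simp only [e3]
    exact intervalIntegral.integral_add ((hs hD s).intervalIntegrable _ _)
      ((hs hgv s).intervalIntegrable _ _)
  simp only [e4] at e2
  rw [intervalIntegral.integral_add ((hi hD).intervalIntegrable _ _)
    ((hi hgv).intervalIntegrable _ _), e1, zero_add] at e2
  exact e2

end BundleSmoothness

/-! ### Local coordinates -/

section LocalInverse

variable {M : Type*} [TopologicalSpace M] [ChartedSpace (EuclideanSpace ℝ (Fin 2)) M]
  [IsManifold (𝓡 2) ∞ M]

omit [IsManifold (𝓡 2) ∞ M] in
/-- The inverse function theorem for maps from the plane to a surface. -/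
theorem exists_local_inverse {k : ℝ × ℝ → M} {z : ℝ × ℝ}
    (hk : ContMDiffAt 𝓘(ℝ, ℝ × ℝ) (𝓡 2) ∞ k z)
    (hinj : Function.Injective (mfderiv 𝓘(ℝ, ℝ × ℝ) (𝓡 2) k z)) :
    ∃ inv : M → ℝ × ℝ, inv (k z) = z ∧ ContMDiffAt (𝓡 2) 𝓘(ℝ, ℝ × ℝ) ∞ inv (k z) ∧
      (∀ᶠ x in 𝓝 (k z), k (inv x) = x) ∧ ∀ᶠ w in 𝓝 z, inv (k w) = w := by
  set e := extChartAt (𝓡 2) (k z) with he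
  let L : ℝ × ℝ →L[ℝ] EuclideanSpace ℝ (Fin 2) := mfderiv 𝓘(ℝ, ℝ × ℝ) (𝓡 2) k z
  have hF : ContDiffAt ℝ ∞ (e ∘ k) z := by
    rw [← contMDiffAt_iff_contDiffAt]
    exact (contMDiffAt_extChartAt (I := 𝓡 2) (x := k z)).comp z hk
  have hFL : HasFDerivAt (e ∘ k) L z := by
    have h := (hk.mdifferentiableAt (by simp)).hasMFDerivAt.2
    rw [ModelWithCorners.range_eq_univ] at h
    exact hasFDerivWithinAt_univ.1 h
  have hdim : Module.finrank ℝ (ℝ × ℝ) = Module.finrank ℝ (EuclideanSpace ℝ (Fin 2)) := by simp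
  let A : (ℝ × ℝ) ≃L[ℝ] EuclideanSpace ℝ (Fin 2) :=
    (LinearEquiv.ofInjectiveOfFinrankEq L.toLinearMap hinj hdim).toContinuousLinearEquiv
  have hFA : HasFDerivAt (e ∘ k) (A : ℝ × ℝ →L[ℝ] EuclideanSpace ℝ (Fin 2)) z :=
    hFL.congr_fderiv (by ext <;> rfl)
  let g := hF.localInverse hFA (by simp)
  have hg : ContDiffAt ℝ ∞ g (e (k z)) := hF.to_localInverse hFA (by simp)
  have hst := hF.hasStrictFDerivAt' hFA (by simp)
  have hleft : ∀ᶠ w in 𝓝 z, g (e (k w)) = w := hst.eventually_left_inverse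
  have hright : ∀ᶠ y in 𝓝 (e (k z)), e (k (g y)) = y := hst.eventually_right_inverse
  have hgz : g (e (k z)) = z := hF.localInverse_apply_image hFA (by simp)
  have hec : ContinuousAt e (k z) := continuousAt_extChartAt (k z)
  have hsrc : e.source ∈ 𝓝 (k z) := extChartAt_source_mem_nhds (k z)
  refine ⟨fun x ↦ g (e x), hgz, ?_, ?_, hleft⟩
  · exact ContMDiffAt.comp (k z) hg.contMDiffAt (contMDiffAt_extChartAt (I := 𝓡 2) (x := k z))
  · have h1 : ∀ᶠ x in 𝓝 (k z), k (g (e x)) ∈ e.source := by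
      have hc : ContinuousAt (fun x ↦ k (g (e x))) (k z) := by
        refine ContinuousAt.comp (g := k) ?_ (ContinuousAt.comp (g := g) hg.continuousAt hec)
        simpa only [Function.comp, hgz] using hk.continuousAt
      refine hc.eventually (p := fun y ↦ y ∈ e.source) ?_
      change e.source ∈ 𝓝 (k (g (e (k z))))
      rw [hgz]
      exact hsrc
    filter_upwards [h1, hsrc, hec.eventually hright] with x h1 h2 h3
    exact e.injOn h1 h2 h3

end LocalInverse

/-! ### The collar -/

section Collar

variable {M : Type*} [TopologicalSpace M] [ChartedSpace (EuclideanSpace ℝ (Fin 2)) M]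
  {m : ℕ} {S : Set M} {κ : Fin m → ℝ × ℝ → M}

/-- The interior `(0,1) × ℝ` of the strip. -/
def openStrip : Set (ℝ × ℝ) := Ioo 0 1 ×ˢ univ

lemma isOpen_openStrip : IsOpen openStrip := isOpen_Ioo.prod isOpen_univ

lemma openStrip_subset_strip : openStrip ⊆ strip := prod_mono_left Ioo_subset_Icc_self

lemma strip_mem_nhds {z : ℝ × ℝ} (hz : z ∈ openStrip) : strip ∈ 𝓝 z :=
  mem_of_superset (isOpen_openStrip.mem_nhds hz) openStrip_subset_strip

lemma stripDeriv_eq {k : ℝ × ℝ → M} {z : ℝ × ℝ} (hz : z ∈ openStrip) :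
    stripDeriv k z = mfderiv 𝓘(ℝ, ℝ × ℝ) (𝓡 2) k z :=
  mfderivWithin_of_mem_nhds (strip_mem_nhds hz)

namespace IsCollar

lemma contMDiffAt (hκ : IsCollar S κ) (i : Fin m) {z : ℝ × ℝ} (hz : z ∈ openStrip) :
    ContMDiffAt 𝓘(ℝ, ℝ × ℝ) (𝓡 2) ∞ (κ i) z := (hκ.smooth i).contMDiffAt (strip_mem_nhds hz)

lemma mfderiv_injective (hκ : IsCollar S κ) (i : Fin m) {z : ℝ × ℝ} (hz : z ∈ openStrip) :
    Function.Injective (mfderiv 𝓘(ℝ, ℝ × ℝ) (𝓡 2) (κ i) z) := by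
  rw [← stripDeriv_eq hz]
  exact hκ.immersion i z (openStrip_subset_strip hz)

lemma add_int (hκ : IsCollar S κ) (i : Fin m) {q : ℝ} (hq : q ∈ Icc (0 : ℝ) 1) (p : ℝ) (n : ℤ) :
    κ i (q, p + n) = κ i (q, p) :=
  ((hκ.eq_iff i (q, p) ⟨hq, trivial⟩ (q, p + n) ⟨hq, trivial⟩).2 ⟨rfl, n, rfl⟩).symm

/-- Every point of a subcylinder is represented in a given fundamental domain. -/
lemma image_eq (hκ : IsCollar S κ) (i : Fin m) {Q : Set ℝ} (hQ : Q ⊆ Icc 0 1) (p₀ : ℝ) :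
    κ i '' (Q ×ˢ univ) = κ i '' (Q ×ˢ Icc p₀ (p₀ + 1)) := by
  refine Subset.antisymm ?_ (image_mono (prod_mono_right (subset_univ _)))
  rintro _ ⟨⟨q, p⟩, ⟨hq, -⟩, rfl⟩
  refine ⟨(q, toIcoMod one_pos p₀ p), ⟨hq, ?_⟩, ?_⟩
  · exact Ico_subset_Icc_self (toIcoMod_mem_Ico one_pos p₀ p)
  · have := hκ.add_int i (hQ hq) (toIcoMod one_pos p₀ p) (toIcoDiv one_pos p₀ p)
    rw [← this]
    congr 2
    have := toIcoMod_add_toIcoDiv_zsmul one_pos p₀ p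
    simpa using this

lemma isCompact_image (hκ : IsCollar S κ) (i : Fin m) {Q : Set ℝ} (hQ : Q ⊆ Icc 0 1)
    (hc : IsCompact Q) : IsCompact (κ i '' (Q ×ˢ univ)) := by
  rw [hκ.image_eq i hQ 0]
  refine (hc.prod isCompact_Icc).image_of_continuousOn ((hκ.smooth i).continuousOn.mono ?_)
  exact prod_mono hQ (subset_univ _)

lemma fst_eq (hκ : IsCollar S κ) {i j : Fin m} {z w : ℝ × ℝ} (hz : z ∈ strip) (hw : w ∈ strip)
    (h : κ i z = κ j w) : i = j ∧ z.1 = w.1 := by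
  have hij : i = j := by
    by_contra hne
    exact disjoint_left.1 (hκ.disjoint i j hne) ⟨z, hz, rfl⟩ ⟨w, hw, h.symm⟩
  subst hij
  exact ⟨rfl, ((hκ.eq_iff i z hz w hw).1 h).1⟩

lemma notMem_image (hκ : IsCollar S κ) {i j : Fin m} {z : ℝ × ℝ} (hz : z ∈ strip) {Q : Set ℝ}
    (hQ : Q ⊆ Icc 0 1) (hzQ : z.1 ∉ Q) : κ i z ∉ κ j '' (Q ×ˢ univ) := by
  rintro ⟨w, hw, h⟩
  exact hzQ ((hκ.fst_eq ⟨hQ hw.1, trivial⟩ hz h).2 ▸ hw.1)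

variable [IsManifold (𝓡 2) ∞ M]

lemma exists_inverse (hκ : IsCollar S κ) (i : Fin m) {z : ℝ × ℝ} (hz : z ∈ openStrip) :
    ∃ inv : M → ℝ × ℝ, inv (κ i z) = z ∧ ContMDiffAt (𝓡 2) 𝓘(ℝ, ℝ × ℝ) ∞ inv (κ i z) ∧
      (∀ᶠ x in 𝓝 (κ i z), κ i (inv x) = x) ∧ ∀ᶠ w in 𝓝 z, inv (κ i w) = w :=
  exists_local_inverse (hκ.contMDiffAt i hz) (hκ.mfderiv_injective i hz)

lemma isOpen_image (hκ : IsCollar S κ) (i : Fin m) {V : Set (ℝ × ℝ)} (hV : IsOpen V)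
    (hVs : V ⊆ openStrip) : IsOpen (κ i '' V) := by
  rw [isOpen_iff_mem_nhds]
  rintro _ ⟨z, hz, rfl⟩
  obtain ⟨inv, h1, h2, h3, -⟩ := hκ.exists_inverse i (hVs hz)
  have : ∀ᶠ x in 𝓝 (κ i z), inv x ∈ V :=
    h2.continuousAt.eventually (p := fun w ↦ w ∈ V) (by rw [h1]; exact hV.mem_nhds hz)
  filter_upwards [h3, this] with x hx hx'
  exact ⟨inv x, hx', hx⟩

open Classical in
/-- The function on the surface which is `F(q,p)` in the collar coordinates of the `i`-th
component, and zero outside of the (interior of the) collar. -/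
def pushForward (κ : Fin m → ℝ × ℝ → M) (i : Fin m) (F : ℝ × ℝ → ℝ) (x : M) : ℝ :=
  if h : ∃ z ∈ openStrip, κ i z = x then F h.choose else 0

omit [IsManifold (𝓡 2) ∞ M] in
lemma pushForward_apply (hκ : IsCollar S κ) (i : Fin m) {F : ℝ × ℝ → ℝ}
    (hF : ∀ q p : ℝ, ∀ n : ℤ, F (q, p + n) = F (q, p)) {z : ℝ × ℝ} (hz : z ∈ openStrip) :
    pushForward κ i F (κ i z) = F z := by
  have h : ∃ w ∈ openStrip, κ i w = κ i z := ⟨z, hz, rfl⟩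
  rw [pushForward, dif_pos h]
  obtain ⟨h1, h2⟩ := h.choose_spec
  obtain ⟨h3, n, h4⟩ := (hκ.eq_iff i _ (openStrip_subset_strip h1) z
    (openStrip_subset_strip hz)).1 h2
  generalize h.choose = w at *
  obtain ⟨q, p⟩ := z
  obtain ⟨q', p'⟩ := w
  simp only at h3 h4
  subst h3 h4
  exact (hF _ _ _).symm

omit [TopologicalSpace M] [ChartedSpace (EuclideanSpace ℝ (Fin 2)) M] [IsManifold (𝓡 2) ∞ M] in
lemma pushForward_of_notMem (i : Fin m) {F : ℝ × ℝ → ℝ} {x : M}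
    (hx : x ∉ κ i '' openStrip) : pushForward κ i F x = 0 :=
  dif_neg fun ⟨z, hz, h⟩ ↦ hx ⟨z, hz, h⟩

lemma pushForward_eq_zero (hκ : IsCollar S κ) (i : Fin m) {F : ℝ × ℝ → ℝ}
    (hF : ∀ q p : ℝ, ∀ n : ℤ, F (q, p + n) = F (q, p)) {Q : Set ℝ}
    (hFQ : ∀ z : ℝ × ℝ, z.1 ∉ Q → F z = 0) {x : M} (hx : x ∉ κ i '' (Q ×ˢ univ)) :
    pushForward κ i F x = 0 := by
  by_cases h : x ∈ κ i '' openStrip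
  · obtain ⟨z, hz, rfl⟩ := h
    rw [hκ.pushForward_apply i hF hz]
    exact hFQ z fun hzQ ↦ hx ⟨z, ⟨hzQ, trivial⟩, rfl⟩
  · exact pushForward_of_notMem i h

lemma contMDiff_pushForward [T2Space M] (hκ : IsCollar S κ) (i : Fin m) {F : ℝ × ℝ → ℝ}
    (hF : ∀ q p : ℝ, ∀ n : ℤ, F (q, p + n) = F (q, p)) (hFs : ContDiffOn ℝ ∞ F openStrip)
    {a b : ℝ} (ha : 0 < a) (hb : b < 1) (hFQ : ∀ z : ℝ × ℝ, z.1 ∉ Icc a b → F z = 0) :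
    ContMDiff (𝓡 2) 𝓘(ℝ, ℝ) ∞ (pushForward κ i F) := by
  have hQ : Icc a b ⊆ Icc 0 1 := Icc_subset_Icc ha.le hb.le
  intro x
  by_cases hx : x ∈ κ i '' openStrip
  · obtain ⟨z, hz, rfl⟩ := hx
    obtain ⟨inv, h1, h2, h3, -⟩ := hκ.exists_inverse i hz
    have h4 : ContMDiffAt (𝓡 2) 𝓘(ℝ, ℝ) ∞ (fun x ↦ F (inv x)) (κ i z) := by
      refine ContMDiffAt.comp (κ i z) (g := F) ?_ h2
      rw [h1]
      exact (hFs.contDiffAt (isOpen_openStrip.mem_nhds hz)).contMDiffAt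
    refine h4.congr_of_eventuallyEq ?_
    have : ∀ᶠ x in 𝓝 (κ i z), inv x ∈ openStrip :=
      h2.continuousAt.eventually (p := fun w ↦ w ∈ openStrip)
        (by rw [h1]; exact isOpen_openStrip.mem_nhds hz)
    filter_upwards [h3, this] with x hx hx'
    conv_lhs => rw [← hx]
    exact hκ.pushForward_apply i hF hx'
  · have hcl : IsClosed (κ i '' (Icc a b ×ˢ univ)) :=
      (hκ.isCompact_image i hQ isCompact_Icc).isClosed
    have hx' : x ∉ κ i '' (Icc a b ×ˢ univ) := fun ⟨z, hz, h⟩ ↦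
      hx ⟨z, ⟨⟨ha.trans_le hz.1.1, hz.1.2.trans_lt hb⟩, trivial⟩, h⟩
    refine contMDiffAt_const (c := (0 : ℝ)) |>.congr_of_eventuallyEq ?_
    filter_upwards [hcl.isOpen_compl.mem_nhds hx'] with y hy
    exact hκ.pushForward_eq_zero i hF hFQ hy

end IsCollar

end Collar

/-! ### The topology of the collar -/

section CollarTopology

variable {M : Type*} [TopologicalSpace M] [T2Space M]
  [ChartedSpace (EuclideanSpace ℝ (Fin 2)) M] [IsManifold (𝓡 2) ∞ M]
  {m : ℕ} {S : Set M} {κ : Fin m → ℝ × ℝ → M}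

lemma IsCompactSubsurface.isClosed (hS : IsCompactSubsurface S) : IsClosed S := hS.1.isClosed

lemma IsCompactSubsurface.mem_interior (hS : IsCompactSubsurface S) {x : M} (hx : x ∈ S)
    (hxf : x ∉ frontier S) : x ∈ interior S := by
  rw [hS.isClosed.frontier_eq] at hxf
  by_contra h
  exact hxf ⟨hx, h⟩

/-- The part of `S` where `q < a` or which is not in the collar. -/
def core (S : Set M) (κ : Fin m → ℝ × ℝ → M) (a : ℝ) : Set M := S \ ⋃ j, κ j '' (Icc a 1 ×ˢ univ)

namespace IsCollar

omit [IsManifold (𝓡 2) ∞ M] in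
lemma isClosed_image (hκ : IsCollar S κ) (i : Fin m) : IsClosed (κ i '' strip) :=
  (hκ.isCompact_image i le_rfl isCompact_Icc).isClosed

omit [T2Space M] [IsManifold (𝓡 2) ∞ M] in
lemma mem_frontier_iff (hκ : IsCollar S κ) {i : Fin m} {z : ℝ × ℝ} (hz : z ∈ strip) :
    κ i z ∈ frontier S ↔ z.1 = 1 := by
  rw [hκ.boundary]
  constructor
  · intro h
    obtain ⟨j, w, hw, hwz⟩ := mem_iUnion.1 h
    have hw1 : w.1 = 1 := hw.1
    have := (hκ.fst_eq (i := j) (j := i) ⟨by rw [hw1]; simp, trivial⟩ hz hwz).2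
    rw [← this, hw1]
  · exact fun h ↦ mem_iUnion.2 ⟨i, z, ⟨h, trivial⟩, rfl⟩

lemma isOpen_core (hκ : IsCollar S κ) (hS : IsCompactSubsurface S) {a : ℝ} (ha : 0 ≤ a)
    (ha1 : a ≤ 1) : IsOpen (core S κ a) := by
  have hcl : IsClosed (⋃ j, κ j '' (Icc a 1 ×ˢ univ)) := isClosed_iUnion_of_finite fun j ↦
    (hκ.isCompact_image j (Icc_subset_Icc_left ha) isCompact_Icc).isClosed
  have : core S κ a = interior S \ ⋃ j, κ j '' (Icc a 1 ×ˢ univ) := by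
    refine Subset.antisymm (fun x hx ↦ ⟨hS.mem_interior hx.1 fun hf ↦ hx.2 ?_, hx.2⟩)
      (sdiff_subset_sdiff_left interior_subset)
    rw [hκ.boundary] at hf
    obtain ⟨j, z, hz, hzx⟩ := mem_iUnion.1 hf
    have hz1 : z.1 = 1 := hz.1
    exact mem_iUnion.2 ⟨j, z, ⟨by rw [hz1]; exact ⟨ha1, le_rfl⟩, trivial⟩, hzx⟩
  rw [this]
  exact isOpen_interior.sdiff hcl

omit [T2Space M] [IsManifold (𝓡 2) ∞ M] in
lemma mem_core_iff (hκ : IsCollar S κ) {i : Fin m} {z : ℝ × ℝ} (hz : z ∈ strip) {a : ℝ}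
    (ha : 0 ≤ a) : κ i z ∈ core S κ a ↔ z.1 < a := by
  constructor
  · intro h
    by_contra hza
    exact h.2 (mem_iUnion.2 ⟨i, z, ⟨⟨not_lt.1 hza, hz.1.2⟩, trivial⟩, rfl⟩)
  · intro h
    refine ⟨hκ.subset i ⟨z, hz, rfl⟩, fun h' ↦ ?_⟩
    obtain ⟨j, hj⟩ := mem_iUnion.1 h'
    exact hκ.notMem_image hz (Icc_subset_Icc_left ha) (fun h'' ↦ not_le.2 h h''.1) hj

/-- Near the boundary of `S`, all points of `S` are in the collar: in a half disc at a boundary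
point, the part of the collar away from the boundary is open and closed. -/
lemma image_mem_nhdsWithin_boundary (hκ : IsCollar S κ) (hS : IsCompactSubsurface S) (i : Fin m)
    (p : ℝ) : κ i '' (Ioc 0 1 ×ˢ univ) ∈ 𝓝[S] (κ i (1, p)) := by
  have hmem : ((1 : ℝ), p) ∈ strip := ⟨by simp, trivial⟩
  set x := κ i (1, p) with hx
  obtain ⟨c, -, hxc, hcS⟩ := hS.2 x ((hκ.mem_frontier_iff hmem).2 rfl)
  -- the points of the chart on the boundary line are boundary points
  have hline : ∀ y ∈ c.source, c y 0 = 0 → y ∈ frontier S := by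
    intro y hy h0
    rw [hS.isClosed.frontier_eq]
    refine ⟨(hcS y hy).2 h0.ge, fun hint ↦ ?_⟩
    have hline : Tendsto (fun ε : ℝ ↦ c y - ε • EuclideanSpace.single (0 : Fin 2) (1 : ℝ)) (𝓝 0)
        (𝓝 (c y)) := by
      have : Continuous fun ε : ℝ ↦ c y - ε • EuclideanSpace.single (0 : Fin 2) (1 : ℝ) := by
        fun_prop
      simpa using this.tendsto 0
    have h1 : ∀ᶠ w in 𝓝 (c y), c.symm w ∈ interior S := by
      refine (c.symm.continuousAt (c.map_source hy)).eventually (p := fun y ↦ y ∈ interior S) ?_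
      rw [c.left_inv hy]
      exact isOpen_interior.mem_nhds hint
    have h2 : ∀ᶠ w in 𝓝 (c y), w ∈ c.target := c.open_target.mem_nhds (c.map_source hy)
    obtain ⟨ε, ⟨h3, h4⟩, hε⟩ := (((hline.eventually (h1.and h2)).filter_mono
      nhdsWithin_le_nhds).and self_mem_nhdsWithin : ∀ᶠ ε in 𝓝[>] (0 : ℝ), _ ∧ ε ∈ Ioi 0).exists
    have h5 := (hcS _ (c.map_target h4)).1 (interior_subset h3)
    rw [c.right_inv h4] at h5
    have : (0 : ℝ) < ε := hε
    simp [h0] at h5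
    linarith
  -- the part of the collar that a small half disc at the boundary point has to avoid
  let K : Set M := (⋃ j ∈ {j | j ≠ i}, κ j '' strip) ∪ κ i '' ({0} ×ˢ univ)
  have hK : IsClosed K := by
    refine IsClosed.union ?_ ?_
    · exact (toFinite _).isClosed_biUnion fun j _ ↦ hκ.isClosed_image j
    · exact (hκ.isCompact_image i (by simp) isCompact_singleton).isClosed
  have hxK : x ∉ K := by
    rintro (h | h)
    · simp only [mem_iUnion] at h
      obtain ⟨j, hj, w, hw, hwx⟩ := h
      exact hj (hκ.fst_eq hw hmem hwx).1
    · exact hκ.notMem_image hmem (by simp) (by simp) h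
  obtain ⟨r, hr, hball⟩ : ∃ r > 0, Metric.ball (c x) r ⊆ c.target ∩ c.symm ⁻¹' Kᶜ := by
    refine Metric.mem_nhds_iff.1 (inter_mem (c.open_target.mem_nhds (c.map_source hxc)) ?_)
    refine (c.symm.continuousAt (c.map_source hxc)).preimage_mem_nhds ?_
    rw [c.left_inv hxc]
    exact hK.isOpen_compl.mem_nhds hxK
  let HB : Set (EuclideanSpace ℝ (Fin 2)) := Metric.ball (c x) r ∩ {w | 0 < w 0}
  have hHB : IsPreconnected (c.symm '' HB) := by
    have hconv : Convex ℝ HB := (convex_ball _ _).inter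
      (convex_halfSpace_gt (f := fun w : EuclideanSpace ℝ (Fin 2) ↦ w 0)
        ⟨fun _ _ ↦ rfl, fun _ _ ↦ rfl⟩ 0)
    exact hconv.isPreconnected.image _ (c.symm.continuousOn.mono fun w hw ↦ (hball hw.1).1)
  have hHBS : ∀ w ∈ HB, c.symm w ∈ interior S := by
    intro w hw
    have hwt := (hball hw.1).1
    refine mem_interior_iff_mem_nhds.2 ?_
    have h1 : ∀ᶠ y in 𝓝 (c.symm w), 0 < c y 0 := by
      have hc : ContinuousAt (fun y ↦ c y 0) (c.symm w) :=
        (EuclideanSpace.proj (0 : Fin 2) :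
          EuclideanSpace ℝ (Fin 2) →L[ℝ] ℝ).continuous.continuousAt.comp
          (c.continuousAt (c.map_target hwt))
      refine hc.eventually (lt_mem_nhds ?_)
      beta_reduce
      rw [c.right_inv hwt]
      exact hw.2
    filter_upwards [h1, c.open_source.mem_nhds (c.map_target hwt)] with y h1 h2
    exact (hcS y h2).2 h1.le
  -- inside the half disc, being in the open collar and being off the collar are open conditions
  have hsub : c.symm '' HB ⊆ κ i '' openStrip := by
    refine hHB.subset_left_of_subset_union (v := (κ i '' strip)ᶜ)
      (hκ.isOpen_image i isOpen_openStrip le_rfl) (hκ.isClosed_image i).isOpen_compl ?_ ?_ ?_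
    · exact disjoint_compl_right.mono_left (image_mono openStrip_subset_strip)
    · rintro _ ⟨w, hw, rfl⟩
      by_cases h : c.symm w ∈ κ i '' strip
      · obtain ⟨z, hz, hzw⟩ := h
        refine Or.inl
          ⟨z, ⟨⟨hz.1.1.lt_of_ne fun h0 ↦ ?_, hz.1.2.lt_of_ne fun h1 ↦ ?_⟩, trivial⟩, hzw⟩
        · exact (hball hw.1).2 (Or.inr ⟨z, ⟨h0.symm, trivial⟩, hzw⟩)
        · have := (hκ.mem_frontier_iff (i := i) hz).2 h1
          rw [hzw, hS.isClosed.frontier_eq] at this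
          exact this.2 (hHBS w hw)
      · exact Or.inr h
    · -- points of the collar close to the boundary point
      have hc : Tendsto (fun q : ℝ ↦ κ i (q, p)) (𝓝[<] 1) (𝓝 x) := by
        have h1 := (hκ.smooth i).continuousOn (1, p) hmem
        refine h1.tendsto.comp (tendsto_nhdsWithin_iff.2 ⟨?_, ?_⟩)
        · exact ((by fun_prop : Continuous fun q : ℝ ↦ (q, p)).tendsto 1).mono_left
            nhdsWithin_le_nhds
        · filter_upwards [Ioo_mem_nhdsLT (zero_lt_one' ℝ)] with q hq
          exact ⟨⟨hq.1.le, hq.2.le⟩, trivial⟩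
      have h1 : ∀ᶠ y in 𝓝 x, y ∈ c.source ∧ c y ∈ Metric.ball (c x) r :=
        (c.open_source.mem_nhds hxc |> fun h ↦ Filter.Eventually.and h
          ((c.continuousAt hxc).eventually (Metric.ball_mem_nhds _ hr)))
      obtain ⟨q, ⟨h2, h3⟩, hq⟩ := ((hc.eventually h1).and
        (Ioo_mem_nhdsLT (zero_lt_one' ℝ))).exists
      have hz : (q, p) ∈ openStrip := ⟨hq, trivial⟩
      have hz' := openStrip_subset_strip hz
      refine ⟨κ i (q, p), ⟨c (κ i (q, p)), ⟨h3, ?_⟩, c.left_inv h2⟩, (q, p), hz, rfl⟩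
      refine ((hcS _ h2).1 (hκ.subset i ⟨_, hz', rfl⟩)).lt_of_ne fun h0 ↦ ?_
      exact hq.2.ne ((hκ.mem_frontier_iff hz').1 (hline _ h2 h0.symm))
  have h1 : ∀ᶠ y in 𝓝[S] x, y ∈ S := self_mem_nhdsWithin
  have h2 : ∀ᶠ y in 𝓝 x, y ∈ c.source := c.open_source.mem_nhds hxc
  have h3 : ∀ᶠ y in 𝓝 x, c y ∈ Metric.ball (c x) r :=
    (c.continuousAt hxc).eventually (Metric.ball_mem_nhds _ hr)
  filter_upwards [h1, nhdsWithin_le_nhds h2, nhdsWithin_le_nhds h3] with y h1 h2 h3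
  rcases ((hcS y h2).1 h1).eq_or_lt with h0 | h0
  · have hf := hline y h2 h0.symm
    rw [hκ.boundary] at hf
    obtain ⟨j, z, hz, hzy⟩ := mem_iUnion.1 hf
    have hz1 : z.1 = 1 := hz.1
    have hji : j = i := by
      by_contra hji
      have := (hball h3).2
      simp only [mem_preimage, c.left_inv h2] at this
      refine this (Or.inl ?_)
      simp only [mem_iUnion]
      exact ⟨j, hji, z, ⟨by rw [hz1]; simp, trivial⟩, hzy⟩
    subst hji
    exact ⟨z, ⟨by rw [hz1]; simp, trivial⟩, hzy⟩
  · obtain ⟨z, hz, hzy⟩ := hsub ⟨c y, ⟨h3, h0⟩, c.left_inv h2⟩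
    exact ⟨z, ⟨⟨hz.1.1, hz.1.2.le⟩, trivial⟩, hzy⟩

/-- The complement in `S` of the half-open collars `q > 0` is closed. -/
lemma isClosed_diff_collar (hκ : IsCollar S κ) (hS : IsCompactSubsurface S) :
    IsClosed (S \ ⋃ j, κ j '' (Ioc 0 1 ×ˢ univ)) := by
  rw [← isOpen_compl_iff, isOpen_iff_mem_nhds]
  intro x hx
  by_cases hxS : x ∈ S
  · have : x ∈ ⋃ j, κ j '' (Ioc 0 1 ×ˢ univ) := by
      by_contra h
      exact hx ⟨hxS, h⟩
    obtain ⟨j, z, hz, rfl⟩ := mem_iUnion.1 this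
    have key : κ j '' (Ioc 0 1 ×ˢ univ) ∈ 𝓝[S] (κ j z) := by
      rcases hz.1.2.eq_or_lt with h1 | h1
      · obtain ⟨q, p⟩ := z
        simp only at h1
        subst h1
        exact hκ.image_mem_nhdsWithin_boundary hS j p
      · have hz' : z ∈ openStrip := ⟨⟨hz.1.1, h1⟩, trivial⟩
        refine nhdsWithin_le_nhds (mem_of_superset
          ((hκ.isOpen_image j isOpen_openStrip le_rfl).mem_nhds ⟨z, hz', rfl⟩) (image_mono ?_))
        exact prod_mono_left Ioo_subset_Ioc_self
    rw [mem_nhdsWithin_iff_eventually] at key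
    filter_upwards [key] with y hy h
    exact h.2 (mem_iUnion.2 ⟨j, hy h.1⟩)
  · filter_upwards [hS.isClosed.isOpen_compl.mem_nhds hxS] with y hy h
    exact hy h.1

omit [IsManifold (𝓡 2) ∞ M] in
lemma continuousOn_image_strip (hκ : IsCollar S κ) (i : Fin m) {f : M → M}
    (hf : ContinuousOn (fun z ↦ f (κ i z)) strip) : ContinuousOn f (κ i '' strip) := by
  rw [continuousOn_iff_isClosed]
  intro t ht
  have hQ : Icc (0 : ℝ) 1 ×ˢ Icc (0 : ℝ) (0 + 1) ⊆ strip := prod_mono_right (subset_univ _)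
  obtain ⟨u, hu, hut⟩ := continuousOn_iff_isClosed.1 (hf.mono hQ) t ht
  have hcomp : IsCompact (κ i '' (u ∩ Icc (0 : ℝ) 1 ×ˢ Icc (0 : ℝ) (0 + 1))) :=
    ((isCompact_Icc.prod isCompact_Icc).inter_left hu).image_of_continuousOn
      ((hκ.smooth i).continuousOn.mono (inter_subset_right.trans hQ))
  refine ⟨_, hcomp.isClosed, ?_⟩
  rw [← hut, inter_eq_left.2 (image_mono (inter_subset_right.trans hQ) : _ ⊆ κ i '' strip)]
  have := hκ.image_eq i (Q := Icc 0 1) le_rfl 0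
  change κ i '' strip = _ at this
  rw [this]
  ext x
  constructor
  · rintro ⟨hx, z, hz, rfl⟩
    exact ⟨z, ⟨hx, hz⟩, rfl⟩
  · rintro ⟨z, ⟨hx, hz⟩, rfl⟩
    exact ⟨hx, z, hz, rfl⟩

open Classical in
/-- The retraction of `S` to a smaller core, pushing the collar into itself. -/
def collarRetract (κ : Fin m → ℝ × ℝ → M) (a : ℝ) (x : M) : M :=
  if h : ∃ w : Fin m × (ℝ × ℝ), w.2 ∈ strip ∧ κ w.1 w.2 = x then
    κ h.choose.1 (min h.choose.2.1 a, h.choose.2.2) else x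

omit [T2Space M] [IsManifold (𝓡 2) ∞ M] in
lemma collarRetract_apply (hκ : IsCollar S κ) {a : ℝ} (ha : 0 ≤ a) (i : Fin m) {z : ℝ × ℝ}
    (hz : z ∈ strip) : collarRetract κ a (κ i z) = κ i (min z.1 a, z.2) := by
  have h : ∃ w : Fin m × (ℝ × ℝ), w.2 ∈ strip ∧ κ w.1 w.2 = κ i z := ⟨(i, z), hz, rfl⟩
  rw [collarRetract, dif_pos h]
  obtain ⟨h1, h2⟩ := h.choose_spec
  generalize h.choose = w at *
  obtain ⟨j, w⟩ := w
  simp only at h1 h2 ⊢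
  obtain rfl := (hκ.fst_eq h1 hz h2).1
  obtain ⟨h3, n, h4⟩ := (hκ.eq_iff _ w h1 z hz).1 h2
  have h5 : ∀ {q : ℝ}, q ∈ Icc (0 : ℝ) 1 → min q a ∈ Icc (0 : ℝ) 1 := fun h ↦
    ⟨le_min h.1 ha, (min_le_left _ _).trans h.2⟩
  exact (hκ.eq_iff _ _ ⟨h5 h1.1, trivial⟩ _ ⟨h5 hz.1, trivial⟩).2 ⟨by rw [h3], n, h4⟩

lemma continuousOn_collarRetract (hκ : IsCollar S κ) (hS : IsCompactSubsurface S) {a : ℝ}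
    (ha : 0 ≤ a) : ContinuousOn (collarRetract κ a) S := by
  have h1 : ContinuousOn (collarRetract κ a) (⋃ j, κ j '' strip) := by
    refine (locallyFinite_of_finite _).continuousOn_iUnion (fun j ↦ hκ.isClosed_image j)
      fun j ↦ hκ.continuousOn_image_strip j ?_
    have : ContinuousOn (fun z : ℝ × ℝ ↦ κ j (min z.1 a, z.2)) strip :=
      (hκ.smooth j).continuousOn.comp (f := fun z : ℝ × ℝ ↦ (min z.1 a, z.2)) (by fun_prop)
        fun z hz ↦ ⟨⟨le_min hz.1.1 ha, (min_le_left _ _).trans hz.1.2⟩, trivial⟩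
    exact this.congr fun z hz ↦ hκ.collarRetract_apply ha j hz
  have h2 : ContinuousOn (collarRetract κ a) (S \ ⋃ j, κ j '' (Ioc 0 1 ×ˢ univ)) := by
    refine continuousOn_id.congr fun x hx ↦ ?_
    by_cases h : ∃ w : Fin m × (ℝ × ℝ), w.2 ∈ strip ∧ κ w.1 w.2 = x
    · obtain ⟨⟨j, z⟩, hz, rfl⟩ := h
      have hz0 : z.1 = 0 := by
        by_contra hne
        exact hx.2 (mem_iUnion.2 ⟨j, z, ⟨⟨hz.1.1.lt_of_ne' hne, hz.1.2⟩, trivial⟩, rfl⟩)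
      simp only
      rw [hκ.collarRetract_apply ha j hz, hz0, min_eq_left ha, ← hz0]
      rfl
    · rw [collarRetract, dif_neg h]; rfl
  refine (h1.union_of_isClosed h2 (isClosed_iUnion_of_finite fun j ↦ hκ.isClosed_image j)
    (hκ.isClosed_diff_collar hS)).mono fun x hx ↦ ?_
  by_cases h : x ∈ ⋃ j, κ j '' (Ioc 0 1 ×ˢ univ)
  · obtain ⟨j, hj⟩ := mem_iUnion.1 h
    exact Or.inl (mem_iUnion.2 ⟨j, image_mono (prod_mono_left Ioc_subset_Icc_self) hj⟩)
  · exact Or.inr ⟨hx, h⟩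

/-- Two points of a component of `S` outside of the collar are in one component of the core. -/
theorem exists_preconnected_core (hκ : IsCollar S κ) (hS : IsCompactSubsurface S) {x y : M}
    (hx : x ∉ collarSet κ) (hy : y ∉ collarSet κ) (hxS : x ∈ S)
    (hxy : y ∈ connectedComponentIn S x) {a : ℝ} (ha : 0 < a) :
    ∃ C ⊆ core S κ a, IsPreconnected C ∧ x ∈ C ∧ y ∈ C := by
  have hfix : ∀ x ∉ collarSet κ, collarRetract κ (a / 2) x = x := by
    intro x hx
    rw [collarRetract, dif_neg]
    rintro ⟨⟨j, z⟩, hz, rfl⟩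
    exact hx (mem_iUnion.2 ⟨j, z, hz, rfl⟩)
  refine ⟨collarRetract κ (a / 2) '' connectedComponentIn S x, ?_, ?_, ⟨x, ?_, hfix x hx⟩,
    ⟨y, hxy, hfix y hy⟩⟩
  · rintro _ ⟨w, hw, rfl⟩
    have hwS := connectedComponentIn_subset _ _ hw
    by_cases h : w ∈ collarSet κ
    · obtain ⟨j, z, hz, rfl⟩ := mem_iUnion.1 h
      have hz' : (min z.1 (a / 2), z.2) ∈ strip :=
        ⟨⟨le_min hz.1.1 (by positivity), (min_le_left _ _).trans hz.1.2⟩, trivial⟩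
      rw [hκ.collarRetract_apply (by positivity) j hz, hκ.mem_core_iff hz' ha.le]
      exact (min_le_right _ _).trans_lt (by linarith)
    · rw [hfix w h]
      refine ⟨hwS, fun h' ↦ h ?_⟩
      obtain ⟨j, hj⟩ := mem_iUnion.1 h'
      exact mem_iUnion.2 ⟨j, image_mono (prod_mono_left (Icc_subset_Icc_left ha.le)) hj⟩
  · exact isPreconnected_connectedComponentIn.image _
      ((hκ.continuousOn_collarRetract hS (by positivity)).mono (connectedComponentIn_subset _ _))
  · exact mem_connectedComponentIn hxS

end IsCollar

end CollarTopology

/-! ### Paths of twisted loops and the weighted area they sweep out -/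

section Sweep

/-- A smooth step, `0` for `s ≤ 1/3` and `1` for `s ≥ 2/3`. -/
def smoothStep (s : ℝ) : ℝ := Real.smoothTransition (3 * s - 1)

lemma contDiff_smoothStep : ContDiff ℝ ∞ smoothStep :=
  Real.smoothTransition.contDiff.comp ((contDiff_const.mul contDiff_id).sub contDiff_const)

lemma smoothStep_of_le {s : ℝ} (hs : s ≤ 1 / 3) : smoothStep s = 0 :=
  Real.smoothTransition.zero_of_nonpos (by linarith)

lemma smoothStep_of_ge {s : ℝ} (hs : 2 / 3 ≤ s) : smoothStep s = 1 :=
  Real.smoothTransition.one_of_one_le (by linarith)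

lemma smoothStep_mem_Icc (s : ℝ) : smoothStep s ∈ Icc (0 : ℝ) 1 :=
  ⟨Real.smoothTransition.nonneg _, Real.smoothTransition.le_one _⟩

variable {M : Type*} [TopologicalSpace M] [ChartedSpace (EuclideanSpace ℝ (Fin 2)) M]

lemma contMDiff_comp_prod {v : ℝ × ℝ → M} (hv : ContMDiff 𝓘(ℝ, ℝ × ℝ) (𝓡 2) ∞ v) {f : ℝ × ℝ → ℝ × ℝ}
    (hf : ContDiff ℝ ∞ f) : ContMDiff 𝓘(ℝ, ℝ × ℝ) (𝓡 2) ∞ fun z ↦ v (f z) :=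
  hv.comp hf.contMDiff

/-- The concatenation (with flattened ends) of two paths of curves. -/
def concat (v₁ v₂ : ℝ × ℝ → M) (z : ℝ × ℝ) : M :=
  if z.1 ≤ 1 / 2 then v₁ (smoothStep (2 * z.1), z.2) else v₂ (smoothStep (2 * z.1 - 1), z.2)

omit [TopologicalSpace M] [ChartedSpace (EuclideanSpace ℝ (Fin 2)) M] in
lemma concat_eq_left {v₁ v₂ : ℝ × ℝ → M} (h : ∀ t, v₁ (1, t) = v₂ (0, t)) {z : ℝ × ℝ}
    (hz : z.1 < 2 / 3) : concat v₁ v₂ z = v₁ (smoothStep (2 * z.1), z.2) := by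
  rw [concat]
  split_ifs with hz'
  · rfl
  · rw [smoothStep_of_ge (s := 2 * z.1) (by linarith),
      smoothStep_of_le (s := 2 * z.1 - 1) (by linarith), h]

omit [TopologicalSpace M] [ChartedSpace (EuclideanSpace ℝ (Fin 2)) M] in
lemma concat_eq_right {v₁ v₂ : ℝ × ℝ → M} (h : ∀ t, v₁ (1, t) = v₂ (0, t)) {z : ℝ × ℝ}
    (hz : 1 / 3 < z.1) : concat v₁ v₂ z = v₂ (smoothStep (2 * z.1 - 1), z.2) := by
  rw [concat]
  split_ifs with hz'
  · rw [smoothStep_of_ge (s := 2 * z.1) (by linarith),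
      smoothStep_of_le (s := 2 * z.1 - 1) (by linarith), h]
  · rfl

lemma contMDiff_concat {v₁ v₂ : ℝ × ℝ → M} (h : ∀ t, v₁ (1, t) = v₂ (0, t))
    (h₁ : ContMDiff 𝓘(ℝ, ℝ × ℝ) (𝓡 2) ∞ v₁) (h₂ : ContMDiff 𝓘(ℝ, ℝ × ℝ) (𝓡 2) ∞ v₂) :
    ContMDiff 𝓘(ℝ, ℝ × ℝ) (𝓡 2) ∞ (concat v₁ v₂) := by
  intro z
  rcases lt_or_ge z.1 (2 / 3) with hz | hz
  · have : ContMDiff 𝓘(ℝ, ℝ × ℝ) (𝓡 2) ∞ fun z : ℝ × ℝ ↦ v₁ (smoothStep (2 * z.1), z.2) :=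
      contMDiff_comp_prod h₁ (f := fun z : ℝ × ℝ ↦ (smoothStep (2 * z.1), z.2))
        ((contDiff_smoothStep.comp (contDiff_const.mul contDiff_fst)).prodMk contDiff_snd)
    refine (this z).congr_of_eventuallyEq ?_
    filter_upwards [continuous_fst.continuousAt.eventually (gt_mem_nhds hz)] with w hw
    exact concat_eq_left h hw
  · have : ContMDiff 𝓘(ℝ, ℝ × ℝ) (𝓡 2) ∞ fun z : ℝ × ℝ ↦ v₂ (smoothStep (2 * z.1 - 1), z.2) :=
      contMDiff_comp_prod h₂ (f := fun z : ℝ × ℝ ↦ (smoothStep (2 * z.1 - 1), z.2))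
        ((contDiff_smoothStep.comp ((contDiff_const.mul contDiff_fst).sub
          contDiff_const)).prodMk contDiff_snd)
    refine (this z).congr_of_eventuallyEq ?_
    have hz' : 1 / 3 < z.1 := by linarith
    filter_upwards [continuous_fst.continuousAt.eventually (lt_mem_nhds hz')] with w hw
    exact concat_eq_right h hw

/-- A family of curves which is twisted by `T` over a neighbourhood of the ends of the unit
interval is the restriction of a family of `T`-twisted curves. -/
theorem exists_twisted_extension (T : M ≃ₘ^∞⟮𝓡 2, 𝓡 2⟯ M) {y : ℝ × ℝ → M} {ε : ℝ} (hε : 0 < ε)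
    (hy : ∀ z : ℝ × ℝ, z.2 ∈ Ioo (-ε) (1 + ε) → ContMDiffAt 𝓘(ℝ, ℝ × ℝ) (𝓡 2) ∞ y z)
    (htw : ∀ s, ∀ t ∈ Ioo (-ε) ε, y (s, t) = T (y (s, t + 1))) :
    ∃ v : ℝ × ℝ → M, ContMDiff 𝓘(ℝ, ℝ × ℝ) (𝓡 2) ∞ v ∧ (∀ s t, v (s, t) = T (v (s, t + 1))) ∧
      ∀ s, ∀ t ∈ Icc (0 : ℝ) 1, v (s, t) = y (s, t) := by
  let P : Equiv.Perm M := T.toEquiv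
  have hP : ∀ x, P x = T x := fun x ↦ rfl
  have hPs : ∀ x, P⁻¹ x = T.symm x := fun x ↦ rfl
  have hpow : ∀ n : ℕ, ContMDiff (𝓡 2) (𝓡 2) ∞ (fun x ↦ (P ^ n) x) := by
    intro n
    induction n with
    | zero => exact contMDiff_id
    | succ n ih =>
      have : (fun x ↦ (P ^ (n + 1)) x) = fun x ↦ (P ^ n) (T x) := by
        ext x; rw [pow_succ]; rfl
      rw [this]
      exact ih.comp T.contMDiff
  have hpow' : ∀ n : ℕ, ContMDiff (𝓡 2) (𝓡 2) ∞ (fun x ↦ (P⁻¹ ^ n) x) := by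
    intro n
    induction n with
    | zero => exact contMDiff_id
    | succ n ih =>
      have : (fun x ↦ (P⁻¹ ^ (n + 1)) x) = fun x ↦ (P⁻¹ ^ n) (T.symm x) := by
        ext x; rw [pow_succ]; rfl
      rw [this]
      exact ih.comp T.symm.contMDiff
  have hzpow : ∀ n : ℤ, ContMDiff (𝓡 2) (𝓡 2) ∞ (fun x ↦ (P ^ n) x) := by
    intro n
    rcases n.eq_nat_or_neg with ⟨k, rfl | rfl⟩
    · simpa only [zpow_natCast] using hpow k
    · simpa only [zpow_neg, zpow_natCast, ← inv_pow] using hpow' k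
  -- the extension is forced: `v(s, t) = T^{-n} y(s, t - n)` for `n ≤ t < n + 1`
  let v : ℝ × ℝ → M := fun z ↦ (P ^ (-⌊z.2⌋)) (y (z.1, Int.fract z.2))
  have hvt : ∀ s t, v (s, t) = T (v (s, t + 1)) := by
    intro s t
    simp only [v, Int.floor_add_one, Int.fract_add_one]
    rw [← hP, ← Equiv.Perm.mul_apply, ← zpow_one_add]
    congr 2
    ring_nf
  refine ⟨v, ?_, hvt, ?_⟩
  · rintro ⟨s, t⟩
    -- near `(s, t)`, on both sides of an integer `t`, the branch for `n = ⌊t⌋` agrees with `v`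
    have h1 : ContMDiffAt 𝓘(ℝ, ℝ × ℝ) (𝓡 2) ∞
        (fun z : ℝ × ℝ ↦ (P ^ (-⌊t⌋)) (y (z.1, z.2 - ⌊t⌋))) (s, t) := by
      refine ContMDiffAt.comp (s, t) (hzpow _ _) ?_
      refine ContMDiffAt.comp (s, t) (f := fun z : ℝ × ℝ ↦ (z.1, z.2 - (⌊t⌋ : ℝ)))
        (hy _ ⟨?_, ?_⟩) ?_
      · have := Int.floor_le t
        simp only; linarith
      · have := Int.lt_floor_add_one t
        simp only; linarith
      · exact (contDiff_fst.prodMk (contDiff_snd.sub contDiff_const)).contMDiff.contMDiffAt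
    refine h1.congr_of_eventuallyEq ?_
    have h2 : ∀ᶠ z : ℝ × ℝ in 𝓝 (s, t), z.2 ∈ Ioo ((⌊t⌋ : ℝ) - min ε 1) (⌊t⌋ + 1) := by
      refine continuous_snd.continuousAt.eventually (Ioo_mem_nhds ?_ (Int.lt_floor_add_one t))
      have := Int.floor_le t
      have : 0 < min ε 1 := lt_min hε one_pos
      simp only; linarith
    filter_upwards [h2] with z ⟨hz1, hz2⟩
    rcases le_or_gt (⌊t⌋ : ℝ) z.2 with h | h
    · have : ⌊z.2⌋ = ⌊t⌋ := Int.floor_eq_iff.2 ⟨h, hz2⟩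
      simp only [v, Int.fract, this]
    · have h4 : min ε 1 ≤ 1 := min_le_right _ _
      have h5 : min ε 1 ≤ ε := min_le_left _ _
      have : ⌊z.2⌋ = ⌊t⌋ - 1 := Int.floor_eq_iff.2
        ⟨by push_cast; linarith, by push_cast; linarith⟩
      simp only [v, Int.fract, this]
      have h3 := htw z.1 (z.2 - ⌊t⌋) ⟨by linarith, by linarith⟩
      rw [h3, ← hP, ← Equiv.Perm.mul_apply, ← zpow_add_one]
      congr 2
      · ring_nf
      · push_cast; ring_nf
  · intro s t ht
    rcases ht.2.eq_or_lt with rfl | h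
    · have h1 := hvt s 0
      rw [zero_add] at h1
      have h2 := htw s 0 ⟨by linarith, hε⟩
      rw [zero_add] at h2
      have h3 : v (s, 0) = y (s, 0) := by
        have : v (s, 0) = (P ^ (-⌊(0 : ℝ)⌋)) (y (s, Int.fract (0 : ℝ))) := rfl
        rw [this, Int.floor_zero, Int.fract_zero, neg_zero, zpow_zero, Equiv.Perm.one_apply]
      rw [h1, h2] at h3
      exact T.injective h3
    · have : ⌊t⌋ = 0 := Int.floor_eq_zero_iff.2 ⟨ht.1, h⟩
      have h1 : v (s, t) = (P ^ (-⌊t⌋)) (y (s, t - ⌊t⌋)) := rfl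
      rw [h1, this, neg_zero, zpow_zero, Equiv.Perm.one_apply, Int.cast_zero, sub_zero]

variable [IsManifold (𝓡 2) ∞ M]

/-- Points of a preconnected subset of an open set are joined by a smooth path in the open set. -/
theorem exists_smooth_path {C O : Set M} (hO : IsOpen O) (hC : IsPreconnected C) (hCO : C ⊆ O)
    {x y : M} (hx : x ∈ C) (hy : y ∈ C) :
    ∃ γ : ℝ → M, ContMDiff 𝓘(ℝ, ℝ) (𝓡 2) ∞ γ ∧ γ 0 = x ∧ γ 1 = y ∧ ∀ s, γ s ∈ O := by
  let P : M → M → Prop := fun x y ↦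
    ∃ γ : ℝ → M, ContMDiff 𝓘(ℝ, ℝ) (𝓡 2) ∞ γ ∧ γ 0 = x ∧ γ 1 = y ∧ ∀ s, γ s ∈ O
  refine hC.induction₂ P ?_ ?_ ?_ hx hy
  · intro x hx
    set e := extChartAt (𝓡 2) x with he
    have htgt : e.target ∈ 𝓝 (e x) := (isOpen_extChartAt_target x).mem_nhds
      (mem_extChartAt_target x)
    obtain ⟨r, hr, hball⟩ : ∃ r > 0, Metric.ball (e x) r ⊆ e.target ∩ e.symm ⁻¹' O := by
      refine Metric.mem_nhds_iff.1 (inter_mem htgt ?_)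
      refine (continuousAt_extChartAt_symm (I := 𝓡 2) x).preimage_mem_nhds ?_
      rw [extChartAt_to_inv]
      exact hO.mem_nhds (hCO hx)
    have h1 : ∀ᶠ y in 𝓝 x, y ∈ e.source := extChartAt_source_mem_nhds x
    have h2 : ∀ᶠ y in 𝓝 x, e y ∈ Metric.ball (e x) r :=
      (continuousAt_extChartAt (I := 𝓡 2) x).eventually (Metric.ball_mem_nhds _ hr)
    filter_upwards [nhdsWithin_le_nhds h1, nhdsWithin_le_nhds h2] with y h1 h2
    have hmem : ∀ s, e x + smoothStep s • (e y - e x) ∈ Metric.ball (e x) r := fun s ↦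
      (convex_ball (e x) r).add_smul_sub_mem (Metric.mem_ball_self hr) h2 (smoothStep_mem_Icc s)
    refine ⟨fun s ↦ e.symm (e x + smoothStep s • (e y - e x)), fun s ↦ ?_, ?_, ?_, fun s ↦
      (hball (hmem s)).2⟩
    · have h3 : ContMDiffAt 𝓘(ℝ, EuclideanSpace ℝ (Fin 2)) (𝓡 2) ∞ e.symm
          (e x + smoothStep s • (e y - e x)) :=
        (contMDiffOn_extChartAt_symm x).contMDiffAt
          ((isOpen_extChartAt_target x).mem_nhds (hball (hmem s)).1)
      refine ContMDiffAt.comp s h3 ?_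
      exact (contDiff_const.add (contDiff_smoothStep.smul contDiff_const)).contMDiff.contMDiffAt
    · simp only [smoothStep_of_le (show (0 : ℝ) ≤ 1 / 3 by norm_num), zero_smul, add_zero]
      exact extChartAt_to_inv x
    · simp only [smoothStep_of_ge (show (2 / 3 : ℝ) ≤ 1 by norm_num), one_smul,
        add_sub_cancel]
      exact e.left_inv h1
  · rintro x y z - - - ⟨γ₁, h1, rfl, rfl, h1O⟩ ⟨γ₂, h2, h20, rfl, h2O⟩
    -- paths are concatenated as families of constant curves
    let v₁ : ℝ × ℝ → M := fun z ↦ γ₁ z.1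
    let v₂ : ℝ × ℝ → M := fun z ↦ γ₂ z.1
    have h : ∀ t, v₁ (1, t) = v₂ (0, t) := fun t ↦ h20.symm
    have hs := contMDiff_concat h (h1.comp contDiff_fst.contMDiff) (h2.comp contDiff_fst.contMDiff)
    refine ⟨fun s ↦ concat v₁ v₂ (s, 0), ?_, ?_, ?_, fun s ↦ ?_⟩
    · exact hs.comp (contDiff_prodMk_left (𝕜 := ℝ) (0 : ℝ)).contMDiff
    · simp only
      rw [concat_eq_left h (by norm_num), mul_zero, smoothStep_of_le (by norm_num)]
    · simp only
      rw [concat_eq_right h (by norm_num), smoothStep_of_ge (by norm_num)]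
    · simp only [concat]
      split_ifs
      exacts [h1O _, h2O _]
  · rintro x y - - ⟨γ, h, h0, h1, hO⟩
    refine ⟨fun s ↦ γ (1 - s), ?_, by simpa using h1, by simpa using h0, fun s ↦ hO _⟩
    exact h.comp (contDiff_const.sub contDiff_id).contMDiff

end Sweep

section SweptArea

variable {M : Type*} [TopologicalSpace M] [ChartedSpace (EuclideanSpace ℝ (Fin 2)) M]
  {σ : BilinField M} {g : M → ℝ} {Φ : M → M} {v : ℝ × ℝ → M}

/-- The rate at which the path `s ↦ v(s, ·)` sweeps out `g`-weighted area. -/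
def sweepRate (σ : BilinField M) (g : M → ℝ) (v : ℝ × ℝ → M) (s : ℝ) : ℝ :=
  ∫ t in (0 : ℝ)..1, g (v (s, t)) * areaDensity σ v (s, t)

/-- Some smooth path of `Φ`-twisted curves from `y₀` to `y₁` sweeps out the `g`-weighted
area `c`. -/
def SweepsArea (Φ : M → M) (σ : BilinField M) (g : M → ℝ) (y₀ y₁ : ℝ → M) (c : ℝ) : Prop :=
  ∃ v : ℝ × ℝ → M, ContMDiff 𝓘(ℝ, ℝ × ℝ) (𝓡 2) ∞ v ∧ (∀ s t, v (s, t) = Φ (v (s, t + 1))) ∧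
    (∀ t, v (0, t) = y₀ t) ∧ (∀ t, v (1, t) = y₁ t) ∧ ∫ s in (0 : ℝ)..1, sweepRate σ g v s = c

lemma areaDensity_congr {v w : ℝ × ℝ → M} {z : ℝ × ℝ} (h : v =ᶠ[𝓝 z] w) :
    areaDensity σ v z = areaDensity σ w z := by
  have h1 := h.mfderiv_eq (I := 𝓘(ℝ, ℝ × ℝ)) (I' := 𝓡 2)
  have h2 := h.self_of_nhds
  simp only [areaDensity, partialT, partialS]
  generalize mfderiv 𝓘(ℝ, ℝ × ℝ) (𝓡 2) v z = A at *
  generalize mfderiv 𝓘(ℝ, ℝ × ℝ) (𝓡 2) w z = B at *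
  generalize v z = x at *
  subst h2
  rw [h1]

lemma sweepRate_congr {v w : ℝ × ℝ → M} {s : ℝ} (h : ∀ t, v =ᶠ[𝓝 (s, t)] w) :
    sweepRate σ g v s = sweepRate σ g w s := by
  refine intervalIntegral.integral_congr fun t _ ↦ ?_
  rw [areaDensity_congr (h t), (h t).self_of_nhds]

lemma areaDensity_reparam (hv : ContMDiff 𝓘(ℝ, ℝ × ℝ) (𝓡 2) ∞ v) {θ : ℝ → ℝ}
    (hθ : Differentiable ℝ θ) (s t : ℝ) :
    areaDensity σ (fun z : ℝ × ℝ ↦ v (θ z.1, z.2)) (s, t) =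
      deriv θ s * areaDensity σ v (θ s, t) := by
  have h1 : HasFDerivAt (fun z : ℝ × ℝ ↦ ((θ z.1, z.2) : ℝ × ℝ))
      ((deriv θ s • ContinuousLinearMap.fst ℝ ℝ ℝ).prod (ContinuousLinearMap.snd ℝ ℝ ℝ)) (s, t) :=
    ((hθ s).hasDerivAt.comp_hasFDerivAt (s, t) hasFDerivAt_fst).prodMk hasFDerivAt_snd
  have h2 := (HasMFDerivAt.comp (s, t) (hv.mdifferentiableAt (x := (θ s, t)) (by simp)).hasMFDerivAt
    h1.hasMFDerivAt).mfderiv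
  have e1 : partialT (fun z : ℝ × ℝ ↦ v (θ z.1, z.2)) (s, t) = partialT v (θ s, t) := by
    change mfderiv 𝓘(ℝ, ℝ × ℝ) (𝓡 2) (v ∘ fun z : ℝ × ℝ ↦ (θ z.1, z.2)) (s, t) (0, 1) = _
    rw [h2]
    change mfderiv 𝓘(ℝ, ℝ × ℝ) (𝓡 2) v (θ s, t) (deriv θ s * 0, 1) = _
    rw [mul_zero]; rfl
  have e2 : partialS (fun z : ℝ × ℝ ↦ v (θ z.1, z.2)) (s, t) =
      deriv θ s • partialS v (θ s, t) := by
    change mfderiv 𝓘(ℝ, ℝ × ℝ) (𝓡 2) (v ∘ fun z : ℝ × ℝ ↦ (θ z.1, z.2)) (s, t) (1, 0) = _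
    rw [h2]
    change mfderiv 𝓘(ℝ, ℝ × ℝ) (𝓡 2) v (θ s, t) (deriv θ s * 1, 0) = _
    have : ((deriv θ s * 1, 0) : ℝ × ℝ) = deriv θ s • ((1, 0) : ℝ × ℝ) := by simp
    rw [this]
    exact (mfderiv 𝓘(ℝ, ℝ × ℝ) (𝓡 2) v (θ s, t)).map_smul _ _
  simp only [areaDensity]
  rw [e1, e2, ContinuousLinearMap.map_smul, smul_eq_mul]

lemma sweepRate_reparam (hv : ContMDiff 𝓘(ℝ, ℝ × ℝ) (𝓡 2) ∞ v) {θ : ℝ → ℝ}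
    (hθ : Differentiable ℝ θ) (s : ℝ) :
    sweepRate σ g (fun z : ℝ × ℝ ↦ v (θ z.1, z.2)) s = deriv θ s * sweepRate σ g v (θ s) := by
  simp only [sweepRate, areaDensity_reparam hv hθ]
  rw [← intervalIntegral.integral_const_mul]
  congr 1
  ext t
  ring

variable [IsManifold (𝓡 2) ∞ M]

lemma continuous_sweepRate (hσ : IsAreaForm σ) (hg : Continuous g)
    (hv : ContMDiff 𝓘(ℝ, ℝ × ℝ) (𝓡 2) ∞ v) : Continuous (sweepRate σ g v) := by
  have h : Continuous fun z ↦ g (v z) * areaDensity σ v z :=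
    (hg.comp hv.continuous).mul (hσ.contDiff_areaDensity hv).continuous
  exact intervalIntegral.continuous_parametric_intervalIntegral_of_continuous'
    (f := fun s t ↦ g (v (s, t)) * areaDensity σ v (s, t)) (by fun_prop) 0 1

lemma integral_sweepRate_reparam (hσ : IsAreaForm σ) (hg : Continuous g)
    (hv : ContMDiff 𝓘(ℝ, ℝ × ℝ) (𝓡 2) ∞ v) {θ : ℝ → ℝ} (hθ : ContDiff ℝ ∞ θ) (a b : ℝ) :
    ∫ s in a..b, sweepRate σ g (fun z : ℝ × ℝ ↦ v (θ z.1, z.2)) s =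
      ∫ s in θ a..θ b, sweepRate σ g v s := by
  have hd : Differentiable ℝ θ := hθ.differentiable (by simp)
  rw [← intervalIntegral.integral_comp_mul_deriv (f' := deriv θ) (fun x _ ↦ (hd x).hasDerivAt)
    (hθ.continuous_deriv (by simp)).continuousOn (continuous_sweepRate hσ hg hv)]
  refine intervalIntegral.integral_congr fun s _ ↦ ?_
  simp only [sweepRate_reparam hv hd, Function.comp]
  ring

lemma SweepsArea.of_segment (hσ : IsAreaForm σ) (hg : Continuous g)
    (hv : ContMDiff 𝓘(ℝ, ℝ × ℝ) (𝓡 2) ∞ v) (htw : ∀ s t, v (s, t) = Φ (v (s, t + 1))) (a b : ℝ) :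
    SweepsArea Φ σ g (fun t ↦ v (a, t)) (fun t ↦ v (b, t)) (∫ s in a..b, sweepRate σ g v s) := by
  have hθ : ContDiff ℝ ∞ fun s : ℝ ↦ a + (b - a) * s := by fun_prop
  refine ⟨fun z ↦ v (a + (b - a) * z.1, z.2), ?_, fun s t ↦ htw _ t, by simp, by simp, ?_⟩
  · exact contMDiff_comp_prod hv (f := fun z : ℝ × ℝ ↦ (a + (b - a) * z.1, z.2)) (by fun_prop)
  · rw [integral_sweepRate_reparam hσ hg hv hθ]
    simp

lemma SweepsArea.symm (hσ : IsAreaForm σ) (hg : Continuous g) {y₀ y₁ : ℝ → M} {c : ℝ}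
    (h : SweepsArea Φ σ g y₀ y₁ c) : SweepsArea Φ σ g y₁ y₀ (-c) := by
  obtain ⟨v, hv, htw, h0, h1, hc⟩ := h
  have := SweepsArea.of_segment hσ hg hv htw 1 0
  rwa [intervalIntegral.integral_symm, hc, funext h0, funext h1] at this

lemma SweepsArea.trans (hσ : IsAreaForm σ) (hg : Continuous g) {y₀ y₁ y₂ : ℝ → M} {c d : ℝ}
    (h : SweepsArea Φ σ g y₀ y₁ c) (h' : SweepsArea Φ σ g y₁ y₂ d) :
    SweepsArea Φ σ g y₀ y₂ (c + d) := by
  obtain ⟨v, hv, htw, h0, h1, rfl⟩ := h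
  obtain ⟨w, hw, hwtw, hw0, hw1, rfl⟩ := h'
  have hvw : ∀ t, v (1, t) = w (0, t) := fun t ↦ (h1 t).trans (hw0 t).symm
  have hc := contMDiff_concat hvw hv hw
  have hcont := continuous_sweepRate hσ hg hc
  refine ⟨concat v w, hc, fun s t ↦ ?_, fun t ↦ ?_, fun t ↦ ?_, ?_⟩
  · simp only [concat]
    split_ifs
    exacts [htw _ _, hwtw _ _]
  · rw [concat_eq_left hvw (by norm_num), mul_zero, smoothStep_of_le (by norm_num), h0]
  · rw [concat_eq_right hvw (by norm_num), smoothStep_of_ge (by norm_num), hw1]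
  · rw [← intervalIntegral.integral_add_adjacent_intervals (b := 1 / 2)
      (hcont.intervalIntegrable _ _) (hcont.intervalIntegrable _ _)]
    congr 1
    · have hθ : ContDiff ℝ ∞ fun s : ℝ ↦ smoothStep (2 * s) :=
        contDiff_smoothStep.comp (contDiff_const.mul contDiff_id)
      have := integral_sweepRate_reparam (σ := σ) (g := g) hσ hg hv hθ 0 (1 / 2)
      rw [mul_zero, smoothStep_of_le (by norm_num), smoothStep_of_ge (by norm_num)] at this
      rw [← this]
      refine intervalIntegral.integral_congr fun s hs ↦ sweepRate_congr fun t ↦ ?_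
      rw [uIcc_of_le (by norm_num)] at hs
      have hs' : s < 2 / 3 := by linarith [hs.2]
      filter_upwards [continuous_fst.continuousAt.eventually (gt_mem_nhds hs')] with z hz
      exact concat_eq_left hvw hz
    · have hθ : ContDiff ℝ ∞ fun s : ℝ ↦ smoothStep (2 * s - 1) :=
        contDiff_smoothStep.comp ((contDiff_const.mul contDiff_id).sub contDiff_const)
      have := integral_sweepRate_reparam (σ := σ) (g := g) hσ hg hw hθ (1 / 2) 1
      rw [smoothStep_of_le (by norm_num), smoothStep_of_ge (by norm_num)] at this
      rw [← this]
      refine intervalIntegral.integral_congr fun s hs ↦ sweepRate_congr fun t ↦ ?_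
      rw [uIcc_of_le (by norm_num)] at hs
      have hs' : 1 / 3 < s := by linarith [hs.1]
      filter_upwards [continuous_fst.continuousAt.eventually (lt_mem_nhds hs')] with z hz
      exact concat_eq_right hvw hz

/-- A closed path of twisted loops sweeps out zero weighted area: after flattening its ends, it
extends periodically. -/
theorem SweepsArea.eq_zero {m : ℕ} {κ : Fin m → ℝ × ℝ → M} (h4 : HypH4 σ Φ κ)
    (hσ : IsAreaForm σ) (hΦ : IsInvariantForm Φ σ)
    (hg : ContMDiff (𝓡 2) 𝓘(ℝ, ℝ) ∞ g) (hg0 : ∀ x, 0 ≤ g x)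
    (hgΦ : ∀ x, g (Φ x) = g x) (hgκ : ∀ x ∉ collarSet κ, g x = 0) {y : ℝ → M} {c : ℝ}
    (h : SweepsArea Φ σ g y y c) : c = 0 := by
  obtain ⟨v, hv, htw, h0, h1, rfl⟩ := h
  let w : ℝ × ℝ → M := fun z ↦ v (smoothStep z.2, z.1)
  have hw : ContMDiff 𝓘(ℝ, ℝ × ℝ) (𝓡 2) ∞ w :=
    contMDiff_comp_prod hv (f := fun z : ℝ × ℝ ↦ (smoothStep z.2, z.1))
      ((contDiff_smoothStep.comp contDiff_snd).prodMk contDiff_fst)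
  obtain ⟨x, hx, hper, hxw⟩ := exists_twisted_extension (Diffeomorph.refl (𝓡 2) M ∞)
    (y := w) (ε := 1 / 3) (by norm_num) (fun z _ ↦ hw z) (fun s t ht ↦ by
      simp only [Diffeomorph.coe_refl, id, w]
      rw [smoothStep_of_le ht.2.le, smoothStep_of_ge (by linarith [ht.1]), h0, h1])
  let x' : ℝ × ℝ → M := fun z ↦ x (z.2, z.1)
  have hx' : ContMDiff 𝓘(ℝ, ℝ × ℝ) (𝓡 2) ∞ x' :=
    contMDiff_comp_prod hx (f := fun z : ℝ × ℝ ↦ (z.2, z.1)) (contDiff_snd.prodMk contDiff_fst)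
  have hper' : ∀ s t, x' (s + 1, t) = x' (s, t) := fun s t ↦ (hper t s).symm
  have hxv : ∀ s ∈ Icc (0 : ℝ) 1, ∀ t, x' (s, t) = v (smoothStep s, t) := fun s hs t ↦ hxw t s hs
  have htw' : ∀ s t, x' (s, t) = Φ (x' (s, t + 1)) := by
    intro s t
    have hn : ∀ n : ℤ, ∀ s t, x' (s + n, t) = x' (s, t) := by
      intro n s t
      have : Function.Periodic (fun s ↦ x' (s, t)) 1 := fun s ↦ hper' s t
      simpa using this.int_mul n s
    have hfr := Int.fract_add_floor s
    rw [← hfr, hn, hn, hxv _ ⟨Int.fract_nonneg s, (Int.fract_lt_one s).le⟩,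
      hxv _ ⟨Int.fract_nonneg s, (Int.fract_lt_one s).le⟩]
    exact htw _ _
  have key := h4.integral_weight_eq_zero hσ hΦ hg hg0 hgΦ hgκ hx' hper' htw'
  refine Eq.trans ?_ key
  have := integral_sweepRate_reparam (σ := σ) (g := g) hσ hg.continuous hv contDiff_smoothStep 0 1
  rw [smoothStep_of_le (by norm_num), smoothStep_of_ge (by norm_num)] at this
  rw [← this]
  have hint : ∀ s ∈ Ioo (0 : ℝ) 1, sweepRate σ g (fun z : ℝ × ℝ ↦ v (smoothStep z.1, z.2)) s =
      ∫ t in (0 : ℝ)..1, g (x' (s, t)) * areaDensity σ x' (s, t) := by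
    intro s hs
    refine sweepRate_congr (w := x') fun t ↦ ?_
    filter_upwards [continuous_fst.continuousAt.eventually (Icc_mem_nhds hs.1 hs.2)] with z hz
    exact (hxv z.1 hz z.2).symm
  rw [intervalIntegral.integral_of_le zero_le_one, intervalIntegral.integral_of_le zero_le_one,
    integral_Ioc_eq_integral_Ioo, integral_Ioc_eq_integral_Ioo]
  exact setIntegral_congr_fun measurableSet_Ioo hint

end SweptArea

/-! ### Contracting short twisted loops near a fixed point -/

section Cap

variable {M : Type*} [TopologicalSpace M] [ChartedSpace (EuclideanSpace ℝ (Fin 2)) M]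

variable [T2Space M] [CompactSpace M] [IsManifold (𝓡 2) ∞ M] {X : ∀ x : M, TangentSpace (𝓡 2) x}
  {ψ : ℝ → M → M} {Φ : M ≃ₘ^∞⟮𝓡 2, 𝓡 2⟯ M} {S : Set M} {σ : BilinField M} {g : M → ℝ}

omit [CompactSpace M] in
lemma flow_neg_one_mem (hX : IsSmoothField X) (hψ : IsFlow X ψ) (hΦS : Φ '' S = S)
    (hΦψ : ∀ x ∈ S, Φ x = ψ 1 x) {x : M} (hx : x ∈ S) : ψ (-1) x ∈ S ∧ Φ (ψ (-1) x) = x := by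
  obtain ⟨x', hx', rfl⟩ := hΦS.symm ▸ hx
  rw [hΦψ x' hx', hψ.neg_cancel hX]
  exact ⟨hx', hΦψ x' hx'⟩

lemma forall_of_periodic {P : ℝ → Prop} (hP : ∀ t, P (t + 1) ↔ P t)
    (h : ∀ t ∈ Icc (0 : ℝ) 1, P t) (t : ℝ) : P t := by
  have h1 : Function.Periodic P 1 := fun t ↦ propext (hP t)
  have h2 := h1.int_mul ⌊t⌋ (Int.fract t)
  rw [mul_one, Int.fract_add_floor] at h2
  rw [h2]
  exact h _ ⟨Int.fract_nonneg t, (Int.fract_lt_one t).le⟩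

omit [T2Space M] [CompactSpace M] [IsManifold (𝓡 2) ∞ M] in
/-- Twisted curves are determined by their restriction to the unit interval. -/
lemma twisted_ext {y z : ℝ → M} (hy : ∀ t, y t = Φ (y (t + 1))) (hz : ∀ t, z t = Φ (z (t + 1)))
    (h : ∀ t ∈ Icc (0 : ℝ) 1, y t = z t) : y = z := by
  ext t
  refine forall_of_periodic (P := fun t ↦ y t = z t) (fun t ↦ ?_) h t
  rw [hy t, hz t]
  exact Φ.injective.eq_iff.symm

omit [T2Space M] [CompactSpace M] [IsManifold (𝓡 2) ∞ M] in
lemma twisted_mem (hΦS : Φ '' S = S) {y : ℝ → M} (hy : ∀ t, y t = Φ (y (t + 1)))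
    (h : ∀ t ∈ Icc (0 : ℝ) 1, y t ∈ S) (t : ℝ) : y t ∈ S := by
  refine forall_of_periodic (P := fun t ↦ y t ∈ S) (fun t ↦ ?_) h t
  rw [hy t]
  constructor
  · exact fun h ↦ hΦS ▸ mem_image_of_mem Φ h
  · intro h
    obtain ⟨x, hx, hxy⟩ := hΦS.symm ▸ h
    rwa [← Φ.injective hxy]

/-- If the flow fixes `x₀`, points near `x₀` stay near `x₀` for bounded time. -/
lemma exists_nhds_flow_mem (hX : IsSmoothField X) (hψ : IsFlow X ψ) {x₀ : M}
    (hx₀ : ∀ t, ψ t x₀ = x₀) {W : Set M} (hW : W ∈ 𝓝 x₀) :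
    ∀ᶠ x in 𝓝 x₀, ∀ t ∈ Icc (-1 : ℝ) 1, ψ t x ∈ W := by
  refine isCompact_Icc.eventually_forall_of_forall_eventually fun t _ ↦ ?_
  have h : ContinuousAt (fun z : M × ℝ ↦ ψ z.2 z.1) (x₀, t) :=
    ((hψ.continuous hX).comp continuous_swap).continuousAt
  refine h.eventually (p := fun y ↦ y ∈ W) ?_
  simp only [hx₀]
  exact hW

/-- Twisted loops close to a fixed point of the flow can be contracted to the fixed point. -/
theorem exists_nhds_sweepsArea_zero (hX : IsSmoothField X) (hψ : IsFlow X ψ) (hΦS : Φ '' S = S)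
    (hΦψ : ∀ x ∈ S, Φ x = ψ 1 x) {x₀ : M} (hx₀ : ∀ t, ψ t x₀ = x₀) (hS : S ∈ 𝓝 x₀)
    (hg : ∀ᶠ x in 𝓝 x₀, g x = 0) :
    ∃ B ∈ 𝓝 x₀, ∀ y : ℝ → M, ContMDiff 𝓘(ℝ, ℝ) (𝓡 2) ∞ y → (∀ t, y t = Φ (y (t + 1))) →
      (∀ t ∈ Icc (0 : ℝ) 1, y t ∈ B) → SweepsArea Φ σ g y (fun _ ↦ x₀) 0 := by
  have hW1 := exists_nhds_flow_mem hX hψ hx₀ (inter_mem hS hg)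
  set e := extChartAt (𝓡 2) x₀ with he
  have hopen : IsOpen e.target := isOpen_extChartAt_target x₀
  obtain ⟨r, hr, hball⟩ : ∃ r > 0, Metric.ball (e x₀) r ⊆
      e.target ∩ e.symm ⁻¹' {x | ∀ t ∈ Icc (-1 : ℝ) 1, ψ t x ∈ S ∩ {x | g x = 0}} := by
    refine Metric.mem_nhds_iff.1 (inter_mem (hopen.mem_nhds (mem_extChartAt_target x₀)) ?_)
    refine (continuousAt_extChartAt_symm (I := 𝓡 2) x₀).preimage_mem_nhds ?_
    rw [extChartAt_to_inv]
    exact hW1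
  have hB1 : e.source ∩ e ⁻¹' Metric.ball (e x₀) r ∈ 𝓝 x₀ :=
    inter_mem (extChartAt_source_mem_nhds x₀) ((continuousAt_extChartAt (I := 𝓡 2)
      x₀).preimage_mem_nhds (Metric.ball_mem_nhds _ hr))
  refine ⟨_, inter_mem hS (exists_nhds_flow_mem hX hψ hx₀ hB1), fun y hy htw hyB ↦ ?_⟩
  have hyS : ∀ t, y t ∈ S := twisted_mem hΦS htw fun t ht ↦ (hyB t ht).1
  -- straightened by the flow, the twisted curve becomes a periodic one
  have hper : ∀ t, ψ (t + 1) (y (t + 1)) = ψ t (y t) := by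
    intro t
    rw [hψ.add hX, ← hΦψ _ (hyS _), ← htw]
  have hmem : ∀ t, ψ t (y t) ∈ e.source ∩ e ⁻¹' Metric.ball (e x₀) r := by
    intro t
    have h1 : Function.Periodic (fun t ↦ ψ t (y t)) 1 := hper
    have h2 : ψ t (y t) = ψ (Int.fract t) (y (Int.fract t)) := by
      have := h1.int_mul ⌊t⌋ (Int.fract t)
      simpa [Int.fract_add_floor] using this
    rw [h2]
    have h3 := (Int.fract_lt_one t).le
    have h4 := Int.fract_nonneg t
    exact (hyB _ ⟨h4, h3⟩).2 _ ⟨by linarith, h3⟩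
  -- the periodic curve is contracted to `x₀` in a chart
  let c : ℝ × ℝ → EuclideanSpace ℝ (Fin 2) := fun z ↦
    e x₀ + (1 - smoothStep z.1) • (e (ψ z.2 (y z.2)) - e x₀)
  have hc : ∀ z, c z ∈ Metric.ball (e x₀) r := fun z ↦ by
    have h1 := smoothStep_mem_Icc z.1
    exact (convex_ball (e x₀) r).add_smul_sub_mem (Metric.mem_ball_self hr) (hmem z.2).2
      ⟨by linarith [h1.2], by linarith [h1.1]⟩
  have hcs : ContDiff ℝ ∞ c := by
    have h1 : ContDiff ℝ ∞ fun t ↦ e (ψ t (y t)) := by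
      rw [← contMDiff_iff_contDiff]
      intro t
      refine ContMDiffAt.comp t (contMDiffAt_extChartAt' ?_)
        (hψ.contMDiff_comp hX contMDiff_id hy t)
      simpa [he, extChartAt_source] using (hmem t).1
    exact contDiff_const.add ((contDiff_const.sub (contDiff_smoothStep.comp contDiff_fst)).smul
      ((h1.comp contDiff_snd).sub contDiff_const))
  let Z : ℝ × ℝ → M := fun z ↦ e.symm (c z)
  have hZ : ContMDiff 𝓘(ℝ, ℝ × ℝ) (𝓡 2) ∞ Z := fun z ↦
    ContMDiffAt.comp z ((contMDiffOn_extChartAt_symm (I := 𝓡 2) (n := ∞) x₀).contMDiffAt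
      (hopen.mem_nhds (hball (hc z)).1)) hcs.contMDiff.contMDiffAt
  have hZper : ∀ s t, Z (s, t + 1) = Z (s, t) := fun s t ↦ by simp only [Z, c, hper]
  have hmemSg : ∀ s, ∀ t ∈ Icc (0 : ℝ) 1, ψ (-t) (Z (s, t)) ∈ S ∩ {x | g x = 0} := fun s t ht ↦
    (hball (hc (s, t))).2 (-t) ⟨by linarith [ht.2], by linarith [ht.1]⟩
  have hstep : ∀ s t, ψ (-(t + 1)) (Z (s, t + 1)) = ψ (-1) (ψ (-t) (Z (s, t))) := by
    intro s t
    rw [hZper, ← hψ.add hX]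
    congr 1
    ring
  have hS' : ∀ s t, ψ (-t) (Z (s, t)) ∈ S := by
    intro s
    refine forall_of_periodic (P := fun t ↦ ψ (-t) (Z (s, t)) ∈ S) (fun t ↦ ?_)
      fun t ht ↦ (hmemSg s t ht).1
    rw [hstep]
    refine ⟨fun h ↦ ?_, fun h ↦ (flow_neg_one_mem hX hψ hΦS hΦψ h).1⟩
    have h1 : Φ (ψ (-1) (ψ (-t) (Z (s, t)))) ∈ S := hΦS ▸ mem_image_of_mem Φ h
    rwa [hΦψ _ h, hψ.cancel_neg hX] at h1
  refine ⟨fun z ↦ ψ (-z.2) (Z z), ?_, fun s t ↦ ?_, fun t ↦ ?_, fun t ↦ ?_, ?_⟩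
  · exact hψ.contMDiff_comp hX contDiff_snd.neg.contMDiff hZ
  · simp only [hstep]
    exact (flow_neg_one_mem hX hψ hΦS hΦψ (hS' s t)).2.symm
  · have : Z (0, t) = ψ t (y t) := by
      simp only [Z, c, smoothStep_of_le (show (0 : ℝ) ≤ 1 / 3 by norm_num), sub_zero, one_smul,
        add_sub_cancel]
      exact e.left_inv (hmem t).1
    simp only [this]
    exact hψ.neg_cancel hX t _
  · have : Z (1, t) = x₀ := by
      simp only [Z, c, smoothStep_of_ge (show (2 / 3 : ℝ) ≤ 1 by norm_num), sub_self, zero_smul,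
        add_zero]
      exact extChartAt_to_inv x₀
    simp only [this, hx₀]
  · have : ∀ s, sweepRate σ g (fun z ↦ ψ (-z.2) (Z z)) s = 0 := by
      intro s
      rw [sweepRate, intervalIntegral.integral_congr (g := fun _ ↦ 0),
        intervalIntegral.integral_zero]
      intro t ht
      rw [uIcc_of_le zero_le_one] at ht
      have := (hmemSg s t ht).2
      simp only [mem_ofPred_eq] at this
      simp only [this, zero_mul]
    simp only [this, intervalIntegral.integral_zero]

end Cap

section FlowPath

variable {M : Type*} [TopologicalSpace M] [ChartedSpace (EuclideanSpace ℝ (Fin 2)) M]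
  [T2Space M] [CompactSpace M] [IsManifold (𝓡 2) ∞ M] {X : ∀ x : M, TangentSpace (𝓡 2) x}
  {ψ : ℝ → M → M} {Φ : M ≃ₘ^∞⟮𝓡 2, 𝓡 2⟯ M} {S : Set M} {σ : BilinField M} {g : M → ℝ}

/-- The square `(s,t) ↦ ψ_{-χ(t)} γ(s)` swept out by the backward flow of a path, where `χ` is a
smooth step function. -/
def flowSquare (ψ : ℝ → M → M) (γ : ℝ → M) (z : ℝ × ℝ) : M := ψ (-smoothStep z.2) (γ z.1)

lemma contMDiff_flowSquare (hX : IsSmoothField X) (hψ : IsFlow X ψ) {γ : ℝ → M}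
    (hγ : ContMDiff 𝓘(ℝ, ℝ) (𝓡 2) ∞ γ) :
    ContMDiff 𝓘(ℝ, ℝ × ℝ) (𝓡 2) ∞ (flowSquare ψ γ) :=
  hψ.contMDiff_comp hX (contDiff_smoothStep.comp contDiff_snd).neg.contMDiff
    (hγ.comp contDiff_fst.contMDiff)

/-- A path in `S` between fixed points gives a path between the constant twisted loops. -/
theorem sweepsArea_flowSquare (hX : IsSmoothField X) (hψ : IsFlow X ψ) (hΦS : Φ '' S = S)
    (hΦψ : ∀ x ∈ S, Φ x = ψ 1 x) {γ : ℝ → M} (hγ : ContMDiff 𝓘(ℝ, ℝ) (𝓡 2) ∞ γ)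
    (hγS : ∀ s, γ s ∈ S) (h0 : ∀ t, ψ t (γ 0) = γ 0) (h1 : ∀ t, ψ t (γ 1) = γ 1) :
    SweepsArea Φ σ g (fun _ ↦ γ 0) (fun _ ↦ γ 1)
      (∫ s in (0 : ℝ)..1, sweepRate σ g (flowSquare ψ γ) s) := by
  have hs := contMDiff_flowSquare hX hψ hγ
  obtain ⟨v, hv, htw, hvy⟩ := exists_twisted_extension Φ (y := flowSquare ψ γ) (ε := 1 / 3)
    (by norm_num) (fun z _ ↦ hs z) (fun s t ht ↦ by
      simp only [flowSquare]
      rw [smoothStep_of_le ht.2.le, smoothStep_of_ge (by linarith [ht.1]), neg_zero, hψ.zero]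
      exact (flow_neg_one_mem hX hψ hΦS hΦψ (hγS s)).2.symm)
  -- at a fixed point of the flow, the constant curve is the only twisted extension
  have hfix : ∀ s, (∀ t, ψ t (γ s) = γ s) → ∀ t, v (s, t) = γ s := by
    intro s hs
    refine congrFun (twisted_ext (htw s) (fun t ↦ ?_) fun t ht ↦ ?_)
    · rw [hΦψ _ (hγS s), hs]
    · rw [hvy s t ht, flowSquare, hs]
  refine ⟨v, hv, htw, hfix 0 h0, hfix 1 h1, ?_⟩
  refine intervalIntegral.integral_congr fun s _ ↦ ?_
  simp only [sweepRate]
  rw [intervalIntegral.integral_of_le zero_le_one, intervalIntegral.integral_of_le zero_le_one,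
    integral_Ioc_eq_integral_Ioo, integral_Ioc_eq_integral_Ioo]
  refine setIntegral_congr_fun measurableSet_Ioo fun t ht ↦ ?_
  have heq : v =ᶠ[𝓝 (s, t)] flowSquare ψ γ := by
    filter_upwards [continuous_snd.continuousAt.eventually (Icc_mem_nhds ht.1 ht.2)] with z hz
    exact hvy z.1 z.2 hz
  rw [areaDensity_congr heq, heq.self_of_nhds]

end FlowPath

/-! ### Uniform convergence along a sequence for orbits of finite energy -/

section Energy

variable {M : Type*} [TopologicalSpace M] [ChartedSpace (EuclideanSpace ℝ (Fin 2)) M]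
  [T2Space M] [CompactSpace M] [IsManifold (𝓡 2) ∞ M] {σ : BilinField M} {J : ℝ → EndField M}

omit [T2Space M] [CompactSpace M] in
/-- The Cauchy–Schwarz inequality for the metric `σ(·, j·)`. -/
lemma IsCompatible.sq_le {j : EndField M} (hσ : IsAreaForm σ) (hj : IsCompatible σ j) (x : M)
    (v w : TangentSpace (𝓡 2) x) : (σ x v w) ^ 2 ≤ σ x v (j x v) * σ x w (j x w) := by
  by_cases hv : v = 0
  · subst hv; simp
  have h1 := hj.pos x v hv
  set a := σ x v (j x v) with ha
  set b := σ x v w with hb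
  have hjw : σ x (j x w) (j x (j x w)) = σ x w (j x w) := hj.invariant x _ _
  -- the square of the distance of `j w` to the line spanned by `v` is nonnegative
  have hnn : 0 ≤ σ x (a • j x w + b • v) (j x (a • j x w + b • v)) := by
    by_cases h : a • j x w + b • v = 0
    · rw [h]; simp
    · exact (hj.pos x _ h).le
  have e1 : σ x (j x w) (j x v) = -b := by rw [hj.invariant, hσ.swap]
  have e2 : σ x v (j x (j x w)) = -b := by rw [hj.sq, map_neg]
  have : σ x (a • j x w + b • v) (j x (a • j x w + b • v)) =
      a * (a * σ x w (j x w) - b ^ 2) := by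
    simp only [map_add, add_apply, map_smul, smul_apply,
      smul_eq_mul, hjw, e1, e2, ← ha]
    ring
  rw [this] at hnn
  have := nonneg_of_mul_nonneg_right hnn h1
  linarith

omit [T2Space M] [CompactSpace M] in
lemma continuous_metric (hσ : IsAreaForm σ) (hJ : IsSmoothPath J)
    {X : ∀ x : M, TangentSpace (𝓡 2) x} (hX : IsSmoothField X) :
    Continuous fun z : ℝ × M ↦ σ z.2 (X z.2) (J z.1 z.2 (X z.2)) := by
  have hV : ContMDiff (𝓘(ℝ, ℝ).prod (𝓡 2)) (𝓡 2).tangent ∞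
      (fun z : ℝ × M ↦ (⟨z.2, X z.2⟩ : TangentBundle (𝓡 2) M)) := hX.comp contMDiff_snd
  have : ContMDiff (𝓘(ℝ, ℝ).prod (𝓡 2)) 𝓘(ℝ, ℝ) ∞
      fun z : ℝ × M ↦ σ z.2 (X z.2) (J z.1 z.2 (X z.2)) := fun z ↦
    hσ.contMDiffAt_apply (hV z) (hJ.contMDiffAt_apply (contMDiffAt_fst) (hV z))
  exact this.continuous

/-- The energy density `σ(∂_t u, J_t ∂_t u)` of a map `u` of `(s,t)`. -/
def energyDensity (σ : BilinField M) (J : ℝ → EndField M) (u : ℝ × ℝ → M) (z : ℝ × ℝ) : ℝ :=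
  σ (u z) (partialT u z) (J z.2 (u z) (partialT u z))

omit [T2Space M] [CompactSpace M] in
lemma continuous_energyDensity (hσ : IsAreaForm σ) (hJ : IsSmoothPath J) {u : ℝ × ℝ → M}
    (hu : ContMDiff 𝓘(ℝ, ℝ × ℝ) (𝓡 2) ∞ u) : Continuous (energyDensity σ J u) := by
  have : ContMDiff 𝓘(ℝ, ℝ × ℝ) 𝓘(ℝ, ℝ) ∞ (energyDensity σ J u) := fun z ↦
    hσ.contMDiffAt_apply (contMDiff_partial hu _ z)
      (hJ.contMDiffAt_apply contDiff_snd.contMDiff.contMDiffAt (contMDiff_partial hu _ z))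
  exact this.continuous

omit [T2Space M] [CompactSpace M] [IsManifold (𝓡 2) ∞ M] in
lemma energyDensity_nonneg (hc : ∀ t, IsCompatible σ (J t)) (u : ℝ × ℝ → M) (z : ℝ × ℝ) :
    0 ≤ energyDensity σ J u z := by
  by_cases h : partialT u z = 0
  · simp [energyDensity, h]
  · exact ((hc z.2).pos _ _ h).le

/-- A finite energy map has slices of arbitrarily small energy. -/
lemma frequently_energy_lt (hσ : IsAreaForm σ) (hJ : IsSmoothPath J)
    (hc : ∀ t, IsCompatible σ (J t)) {u : ℝ × ℝ → M} (hu : ContMDiff 𝓘(ℝ, ℝ × ℝ) (𝓡 2) ∞ u)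
    (hE : ∫⁻ s : ℝ, ∫⁻ t in Icc (0 : ℝ) 1, ENNReal.ofReal (energyDensity σ J u (s, t)) < ⊤)
    {l : Filter ℝ} (hl : ∀ A ∈ l, volume A = ⊤) {ε : ℝ} (hε : 0 < ε) :
    ∃ᶠ s in l, ∫ t in (0 : ℝ)..1, energyDensity σ J u (s, t) < ε := by
  intro hcon
  have hcon' : ∀ᶠ s in l, ε ≤ ∫ t in (0 : ℝ)..1, energyDensity σ J u (s, t) :=
    hcon.mono fun s hs ↦ not_lt.1 hs
  have hcont := continuous_energyDensity hσ hJ hu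
  have hF : Continuous fun s ↦ ∫ t in (0 : ℝ)..1, energyDensity σ J u (s, t) :=
    intervalIntegral.continuous_parametric_intervalIntegral_of_continuous'
      (f := fun s t ↦ energyDensity σ J u (s, t)) (by fun_prop) 0 1
  set A := {s | ε ≤ ∫ t in (0 : ℝ)..1, energyDensity σ J u (s, t)} with hA
  have hAm : MeasurableSet A := (isClosed_le continuous_const hF).measurableSet
  have h1 : ∀ s, ∫⁻ t in Icc (0 : ℝ) 1, ENNReal.ofReal (energyDensity σ J u (s, t)) =
      ENNReal.ofReal (∫ t in (0 : ℝ)..1, energyDensity σ J u (s, t)) := by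
    intro s
    have hs : Continuous fun t ↦ energyDensity σ J u (s, t) := by fun_prop
    rw [intervalIntegral.integral_of_le zero_le_one, ← integral_Icc_eq_integral_Ioc,
      ofReal_integral_eq_lintegral_ofReal (hs.integrableOn_Icc)
        (Eventually.of_forall fun t ↦ energyDensity_nonneg hc u _)]
  simp only [h1] at hE
  refine hE.ne (top_le_iff.1 ?_)
  calc (⊤ : ENNReal) = ENNReal.ofReal ε * volume A := by
        rw [hl A hcon', ENNReal.mul_top (by simpa using hε)]
    _ = ∫⁻ _ in A, ENNReal.ofReal ε := by rw [setLIntegral_const]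
    _ ≤ ∫⁻ s in A, ENNReal.ofReal (∫ t in (0 : ℝ)..1, energyDensity σ J u (s, t)) :=
        setLIntegral_mono' hAm fun s hs ↦ ENNReal.ofReal_le_ofReal hs
    _ ≤ _ := setLIntegral_le_lintegral _ _

lemma hasDerivAt_of_hasMFDerivAt {h : ℝ → ℝ} {t : ℝ} {L : ℝ →L[ℝ] ℝ}
    (hL : HasMFDerivAt 𝓘(ℝ, ℝ) 𝓘(ℝ, ℝ) h t L) : HasDerivAt h (L 1) t := by
  have h1 : HasFDerivAt h L t := hasMFDerivAt_iff_hasFDerivAt.1 hL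
  exact h1.hasDerivAt

omit [T2Space M] [CompactSpace M] [IsManifold (𝓡 2) ∞ M] in
lemma hasDerivAt_comp_curve {f : M → ℝ} {c : ℝ → M} {t : ℝ}
    {L : ℝ →L[ℝ] TangentSpace (𝓡 2) (c t)} (hf : MDifferentiableAt (𝓡 2) 𝓘(ℝ, ℝ) f (c t))
    (hc : HasMFDerivAt 𝓘(ℝ, ℝ) (𝓡 2) c t L) :
    HasDerivAt (fun t ↦ f (c t)) (mfderiv (𝓡 2) 𝓘(ℝ, ℝ) f (c t) (L 1)) t :=
  hasDerivAt_of_hasMFDerivAt (HasMFDerivAt.comp t hf.hasMFDerivAt hc)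

/-- Along a filter of slices with small energy, a map which converges pointwise at `t = 0`
is close to its limit uniformly for `t ∈ [0,1]`. -/
theorem frequently_forall_mem (hσ : IsAreaForm σ) (hJ : IsSmoothPath J)
    (hc : ∀ t, IsCompatible σ (J t)) {u : ℝ × ℝ → M} (hu : ContMDiff 𝓘(ℝ, ℝ × ℝ) (𝓡 2) ∞ u)
    (hE : ∫⁻ s : ℝ, ∫⁻ t in Icc (0 : ℝ) 1, ENNReal.ofReal (energyDensity σ J u (s, t)) < ⊤)
    {l : Filter ℝ} (hl : ∀ A ∈ l, volume A = ⊤) {x₀ : M}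
    (hlim : Tendsto (fun s ↦ u (s, 0)) l (𝓝 x₀)) {U : Set M} (hU : U ∈ 𝓝 x₀) :
    ∃ᶠ s in l, ∀ t ∈ Icc (0 : ℝ) 1, u (s, t) ∈ U := by
  -- a bump function replaces the distance; its gradient with respect to the metrics is bounded, and
  -- is written as a Hamiltonian field
  obtain ⟨f, hfU⟩ : ∃ f : SmoothBumpFunction (𝓡 2) x₀, tsupport f ⊆ U := by
    obtain ⟨f, -, hf⟩ := (SmoothBumpFunction.nhds_basis_tsupport (I := 𝓡 2) x₀).mem_iff.1 hU
    exact ⟨f, hf⟩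
  have hf : ContMDiff (𝓡 2) 𝓘(ℝ, ℝ) ∞ f := f.contMDiff
  obtain ⟨X, hX⟩ := hσ.exists_hamiltonianField f
  have hXs := hσ.isSmoothField_hamiltonian hf hX
  obtain ⟨C, hC⟩ : ∃ C, ∀ t ∈ Icc (0 : ℝ) 1, ∀ x, σ x (X x) (J t x (X x)) ≤ C := by
    obtain ⟨C, hC⟩ := ((isCompact_Icc (a := (0 : ℝ)) (b := 1)).prod
      (isCompact_univ (X := M))).bddAbove_image (continuous_metric hσ hJ hXs).continuousOn
    exact ⟨C, fun t ht x ↦ hC ⟨(t, x), ⟨ht, trivial⟩, rfl⟩⟩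
  have hf0 : ∀ᶠ s in l, 3 / 4 < f (u (s, 0)) := by
    have := (f.continuous.tendsto x₀).comp hlim
    rw [f.eq_one] at this
    exact this.eventually (lt_mem_nhds (by norm_num))
  have hcpos : 0 < |C| + 1 := by positivity
  refine ((frequently_energy_lt hσ hJ hc hu hE hl (ε := 1 / (4 * (|C| + 1)))
    (by positivity)).and_eventually hf0).mono fun s ⟨hs, hfs⟩ t ht ↦ ?_
  refine hfU (subset_tsupport _ ?_)
  -- along the slice, `f` varies by less than its value at `t = 0`
  let a : ℝ → ℝ := fun t ↦ mfderiv (𝓡 2) 𝓘(ℝ, ℝ) f (u (s, t)) (partialT u (s, t))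
  have hder : ∀ t, HasDerivAt (fun t ↦ f (u (s, t))) (a t) t := by
    intro t
    have h1 : MDifferentiableAt 𝓘(ℝ, ℝ) (𝓡 2) (fun t ↦ u (s, t)) t :=
      (hu.comp (contDiff_prodMk_right s).contMDiff).mdifferentiableAt (by simp)
    refine (hasDerivAt_comp_curve (hf.mdifferentiableAt (x := u (s, t)) (by simp))
      h1.hasMFDerivAt).congr_deriv ?_
    simp only [a]
    rw [partialT_eq (hu.mdifferentiableAt (by simp))]
    rfl
  have hac : Continuous a := by
    have : ContDiff ℝ ∞ fun t ↦ f (u (s, t)) := by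
      rw [← contMDiff_iff_contDiff]
      exact hf.comp (hu.comp (contDiff_prodMk_right s).contMDiff)
    have h2 : a = deriv fun t ↦ f (u (s, t)) := funext fun t ↦ (hder t).deriv.symm
    rw [h2]
    exact this.continuous_deriv (by simp)
  have hab : ∀ t ∈ Icc (0 : ℝ) 1, |a t| ≤ 1 / 4 + (|C| + 1) * energyDensity σ J u (s, t) := by
    intro t ht
    have h1 : a t ^ 2 ≤ C * energyDensity σ J u (s, t) := by
      simp only [a, hX]
      refine ((hc t).sq_le hσ _ _ _).trans ?_
      exact mul_le_mul_of_nonneg_right (hC t ht _) (energyDensity_nonneg hc u (s, t))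
    have h2 : C * energyDensity σ J u (s, t) ≤ (|C| + 1) * energyDensity σ J u (s, t) :=
      mul_le_mul_of_nonneg_right (by linarith [le_abs_self C]) (energyDensity_nonneg hc u (s, t))
    rw [← sq_abs] at h1
    nlinarith [sq_nonneg (|a t| - 1 / 2)]
  have hce : Continuous fun t ↦ energyDensity σ J u (s, t) := by
    have := continuous_energyDensity hσ hJ hu
    fun_prop
  have hint : ∫ r in (0 : ℝ)..t, a r = f (u (s, t)) - f (u (s, 0)) :=
    intervalIntegral.integral_eq_sub_of_hasDerivAt (fun r _ ↦ hder r) (hac.intervalIntegrable _ _)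
  have hle : |∫ r in (0 : ℝ)..t, a r| ≤ 1 / 2 := by
    calc |∫ r in (0 : ℝ)..t, a r| ≤ ∫ r in (0 : ℝ)..t, |a r| :=
          intervalIntegral.abs_integral_le_integral_abs ht.1
      _ ≤ ∫ r in (0 : ℝ)..1, |a r| := by
          rw [← intervalIntegral.integral_add_adjacent_intervals (b := t) (c := 1)
            (hac.abs.intervalIntegrable _ _) (hac.abs.intervalIntegrable _ _)]
          have := intervalIntegral.integral_nonneg ht.2 (μ := volume) fun r _ ↦ abs_nonneg (a r)
          linarith
      _ ≤ ∫ r in (0 : ℝ)..1, (1 / 4 + (|C| + 1) * energyDensity σ J u (s, r)) :=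
          intervalIntegral.integral_mono_on zero_le_one (hac.abs.intervalIntegrable _ _)
            ((continuous_const.add (continuous_const.mul hce)).intervalIntegrable _ _) hab
      _ = 1 / 4 + (|C| + 1) * ∫ r in (0 : ℝ)..1, energyDensity σ J u (s, r) := by
          have hi : IntervalIntegrable
              (fun r ↦ (|C| + 1) * energyDensity σ J u (s, r)) volume 0 1 :=
            (continuous_const.mul hce).intervalIntegrable _ _
          rw [intervalIntegral.integral_add intervalIntegrable_const hi,
            intervalIntegral.integral_const_mul]
          simp
      _ ≤ 1 / 4 + (|C| + 1) * (1 / (4 * (|C| + 1))) := by gcongr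
      _ = 1 / 2 := by field_simp; norm_num
  rw [hint] at hle
  have := (abs_le.1 hle).1
  rw [Function.mem_support]
  intro h0
  linarith

end Energy

/-- Smooth dependence on parameters of an integral over the unit interval. -/
theorem contDiffOn_integral_unitInterval {E : Type*} [NormedAddCommGroup E] [NormedSpace ℝ E]
    {F : E × ℝ → ℝ} {s : Set E} (hs : IsOpen s) (hF : ContDiffOn ℝ ∞ F (s ×ˢ univ)) :
    ContDiffOn ℝ ∞ (fun x ↦ ∫ t in (0 : ℝ)..1, F (x, t)) s := by
  let χ : ContDiffBump (0 : ℝ) := ⟨1, 2, by norm_num, by norm_num⟩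
  have h := contDiffOn_convolution_right_with_param_comp (n := ⊤) (ContinuousLinearMap.lsmul ℝ ℝ)
    (contDiffOn_const (c := (0 : ℝ)) (s := s)) (f := indicator (Ioc (0 : ℝ) 1) 1)
    (g := fun x t ↦ χ t * F (x, -t)) (k := Metric.closedBall 0 2) (μ := volume) hs
    (isCompact_closedBall _ _) ?_ ?_ ?_
  · refine h.congr fun x _ ↦ ?_
    rw [convolution_def, intervalIntegral.integral_of_le zero_le_one,
      ← integral_indicator measurableSet_Ioc]
    refine integral_congr_ae (Eventually.of_forall fun t ↦ ?_)
    by_cases ht : t ∈ Ioc (0 : ℝ) 1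
    · have h1 : χ (0 - t) = 1 := χ.one_of_mem_closedBall (by
        rw [mem_closedBall_zero_iff, zero_sub, norm_neg, Real.norm_of_nonneg ht.1.le]
        exact ht.2)
      rw [zero_sub] at h1
      simp only [indicator_of_mem ht, h1, ContinuousLinearMap.lsmul_apply, Pi.one_apply, one_smul,
        one_mul, zero_sub, neg_neg]
    · simp [ht, indicator_of_notMem]
  · intro x t _ ht
    rw [← χ.tsupport_eq] at ht
    simp [image_eq_zero_of_notMem_tsupport ht]
  · exact (locallyIntegrable_const (1 : ℝ)).indicator measurableSet_Ioc
  · refine (χ.contDiff.comp contDiff_snd).contDiffOn.mul (hF.comp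
      (contDiff_fst.prodMk contDiff_snd.neg).contDiffOn fun z hz ↦ ⟨hz.1, trivial⟩)

theorem contMDiff_integral_unitInterval {M : Type*} [TopologicalSpace M]
    [ChartedSpace (EuclideanSpace ℝ (Fin 2)) M]
   [IsManifold (𝓡 2) ∞ M] {F : M → ℝ → ℝ}
    (hF : ∀ x₀ : M, ContDiffOn ℝ ∞
      (fun z : EuclideanSpace ℝ (Fin 2) × ℝ ↦ F ((extChartAt (𝓡 2) x₀).symm z.1) z.2)
      ((extChartAt (𝓡 2) x₀).target ×ˢ univ)) :
    ContMDiff (𝓡 2) 𝓘(ℝ, ℝ) ∞ fun x ↦ ∫ t in (0 : ℝ)..1, F x t := by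
  intro x₀
  have h := contDiffOn_integral_unitInterval (isOpen_extChartAt_target x₀) (hF x₀)
  have h1 : ContMDiffAt (𝓡 2) 𝓘(ℝ, ℝ) ∞
      ((fun e ↦ ∫ t in (0 : ℝ)..1, F ((extChartAt (𝓡 2) x₀).symm e) t) ∘
        extChartAt (𝓡 2) x₀) x₀ := by
    refine ContMDiffAt.comp x₀ (I' := 𝓘(ℝ, EuclideanSpace ℝ (Fin 2))) ?_ contMDiffAt_extChartAt
    exact (h.contDiffAt
      ((isOpen_extChartAt_target x₀).mem_nhds (mem_extChartAt_target x₀))).contMDiffAt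
  refine h1.congr_of_eventuallyEq ?_
  filter_upwards [extChartAt_source_mem_nhds (I := 𝓡 2) x₀] with x hx
  simp only [Function.comp]
  rw [(extChartAt (𝓡 2) x₀).left_inv hx]

/-- Stokes' theorem for `ρ dk` on a rectangle `[0,a] × [0,1]`. -/
theorem integral_wedge_eq {ρ k : ℝ × ℝ → ℝ} (hρ : ContDiff ℝ ∞ ρ) (hk : ContDiff ℝ ∞ k) (a b : ℝ) :
    (∫ s in (0 : ℝ)..a, ∫ t in (0 : ℝ)..b, (fderiv ℝ ρ (s, t) (0, 1) * fderiv ℝ k (s, t) (1, 0) -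
      fderiv ℝ ρ (s, t) (1, 0) * fderiv ℝ k (s, t) (0, 1))) =
    (∫ s in (0 : ℝ)..a, (ρ (s, b) * fderiv ℝ k (s, b) (1, 0) -
      ρ (s, 0) * fderiv ℝ k (s, 0) (1, 0))) -
    ∫ t in (0 : ℝ)..b, (ρ (a, t) * fderiv ℝ k (a, t) (0, 1) -
      ρ (0, t) * fderiv ℝ k (0, t) (0, 1)) := by
  have hdk : ContDiff ℝ ∞ (fderiv ℝ k) := hk.fderiv_right (by simp)
  have hdk' : ∀ w, ContDiff ℝ ∞ fun z ↦ fderiv ℝ k z w := fun w ↦ hdk.clm_apply contDiff_const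
  have hdρ' : ∀ w, ContDiff ℝ ∞ fun z ↦ fderiv ℝ ρ z w := fun w ↦
    (hρ.fderiv_right (m := ∞) (by simp)).clm_apply contDiff_const
  let P : ℝ × ℝ → ℝ := fun z ↦ ρ z * fderiv ℝ k z (1, 0)
  let Q : ℝ × ℝ → ℝ := fun z ↦ ρ z * fderiv ℝ k z (0, 1)
  have hP : ContDiff ℝ ∞ P := hρ.mul (hdk' _)
  have hQ : ContDiff ℝ ∞ Q := hρ.mul (hdk' _)
  have hd : ∀ w v z, fderiv ℝ (fun z ↦ ρ z * fderiv ℝ k z w) z v =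
      fderiv ℝ ρ z v * fderiv ℝ k z w + ρ z * fderiv ℝ (fderiv ℝ k) z v w := by
    intro w v z
    have h1 := (hdk.differentiable (by simp) z).hasFDerivAt.clm_apply (hasFDerivAt_const w z)
    rw [((hρ.differentiable (by simp) z).hasFDerivAt.fun_mul h1).fderiv]
    simp
    ring
  have hsymm : ∀ z v w, fderiv ℝ (fderiv ℝ k) z v w = fderiv ℝ (fderiv ℝ k) z w v := fun z v w ↦
    (hk.contDiffAt.isSymmSndFDerivAt
      (by
        rw [minSmoothness_of_isRCLikeNormedField]
        exact WithTop.coe_le_coe.2 (le_top : (2 : ℕ∞) ≤ ⊤))).eq v w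
  have hmain := integral2_divergence_prod_of_hasFDerivAt (fun z ↦ -Q z) P (fun z ↦ -fderiv ℝ Q z)
    (fderiv ℝ P) 0 0 a b hQ.continuous.neg.continuousOn hP.continuous.continuousOn
    (fun z _ ↦ (hQ.differentiable (by simp) z).hasFDerivAt.neg)
    (fun z _ ↦ (hP.differentiable (by simp) z).hasFDerivAt) ?_
  · have e1 : ∀ z, (-fderiv ℝ Q z) (1, 0) + fderiv ℝ P z (0, 1) =
        fderiv ℝ ρ z (0, 1) * fderiv ℝ k z (1, 0) - fderiv ℝ ρ z (1, 0) * fderiv ℝ k z (0, 1) := by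
      intro z
      simp only [P, Q, neg_apply, hd, hsymm z (1, 0) (0, 1)]
      ring
    simp only [e1] at hmain
    rw [hmain]
    have i1 : ∀ c, IntervalIntegrable (fun s ↦ P (s, c)) volume 0 a := fun c ↦
      (hP.continuous.comp (by fun_prop)).intervalIntegrable _ _
    have i2 : ∀ c, IntervalIntegrable (fun t ↦ Q (c, t)) volume 0 b := fun c ↦
      (hQ.continuous.comp (by fun_prop)).intervalIntegrable _ _
    rw [intervalIntegral.integral_sub (i1 b) (i1 0), intervalIntegral.integral_sub (i2 a) (i2 0),
      intervalIntegral.integral_neg, intervalIntegral.integral_neg]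
    ring
  · refine ContinuousOn.integrableOn_compact (isCompact_uIcc.prod isCompact_uIcc) ?_
    exact (((hQ.continuous_fderiv (by simp)).neg.clm_apply continuous_const).add
      ((hP.continuous_fderiv (by simp)).clm_apply continuous_const)).continuousOn

/-- Integration over the unit square of a 2-form of the shape which occurs for the square swept out
by a flow: `A dk` is closed and vanishes on the boundary, `α` depends on `s` only and `β` on `t`
only, and `ρ` vanishes on the boundary. -/
theorem integral_square_eq_zero {A ρ k : ℝ × ℝ → ℝ} {α β : ℝ → ℝ} {G : ℝ × ℝ → ℝ}
    (hA : ContDiff ℝ ∞ A) (hρ : ContDiff ℝ ∞ ρ) (hk : ContDiff ℝ ∞ k) (hβ : Continuous β)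
    (hAk : ∀ z, fderiv ℝ A z (0, 1) * fderiv ℝ k z (1, 0) =
      fderiv ℝ A z (1, 0) * fderiv ℝ k z (0, 1))
    (hA0 : ∀ s, A (s, 0) = 0 ∧ A (s, 1) = 0) (hA1 : ∀ t, A (0, t) = 0 ∧ A (1, t) = 0)
    (hρ0 : ∀ s, ρ (s, 0) = 0 ∧ ρ (s, 1) = 0) (hρ1 : ∀ t, ρ (0, t) = 0 ∧ ρ (1, t) = 0)
    (hG : ∀ s t, G (s, t) = A (s, t) * fderiv ℝ k (s, t) (0, 1) * α s +
      A (s, t) * fderiv ℝ k (s, t) (1, 0) * β t +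
      (fderiv ℝ ρ (s, t) (0, 1) * fderiv ℝ k (s, t) (1, 0) -
        fderiv ℝ ρ (s, t) (1, 0) * fderiv ℝ k (s, t) (0, 1))) :
    ∫ s in (0 : ℝ)..1, ∫ t in (0 : ℝ)..1, G (s, t) = 0 := by
  have hcont : ∀ {f : ℝ × ℝ → ℝ} (_ : ContDiff ℝ ∞ f) (w), Continuous fun z ↦ fderiv ℝ f z w :=
    fun hf w ↦ (hf.continuous_fderiv (by simp)).clm_apply continuous_const
  have cA := hA.continuous
  have ckt := hcont hk (0, 1)
  have cks := hcont hk (1, 0)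
  have cρt := hcont hρ (0, 1)
  have cρs := hcont hρ (1, 0)
  have hz : ∀ a b, (∫ s in (0 : ℝ)..a, ∫ t in (0 : ℝ)..b,
      (fderiv ℝ A (s, t) (0, 1) * fderiv ℝ k (s, t) (1, 0) -
      fderiv ℝ A (s, t) (1, 0) * fderiv ℝ k (s, t) (0, 1))) = 0 := by
    intro a b
    simp [hAk]
  -- the integrals of the closed form `A dk` along vertical and horizontal segments vanish
  have h1 : ∀ s, ∫ t in (0 : ℝ)..1, A (s, t) * fderiv ℝ k (s, t) (0, 1) = 0 := by
    intro s
    have := integral_wedge_eq hA hk s 1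
    rw [hz] at this
    simpa [hA0, hA1] using this
  have h2 : ∀ t, ∫ s in (0 : ℝ)..1, A (s, t) * fderiv ℝ k (s, t) (1, 0) = 0 := by
    intro t
    have := integral_wedge_eq hA hk 1 t
    rw [hz] at this
    simpa [hA0, hA1] using this.symm
  have h3 := integral_wedge_eq hρ hk 1 1
  simp only [hρ0, hρ1, zero_mul, sub_zero, intervalIntegral.integral_zero] at h3
  have h4 : ∫ s in (0 : ℝ)..1, ∫ t in (0 : ℝ)..1,
      A (s, t) * fderiv ℝ k (s, t) (1, 0) * β t = 0 := by
    simp only [intervalIntegral.integral_of_le zero_le_one] at h2 ⊢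
    rw [integral_integral_swap]
    · simp [integral_mul_const, h2]
    · rw [Measure.prod_restrict]
      have hc : Continuous (Function.uncurry fun s t ↦ A (s, t) * fderiv ℝ k (s, t) (1, 0) * β t) :=
        (cA.mul cks).mul (hβ.comp continuous_snd)
      exact (hc.continuousOn.integrableOn_compact (isCompact_Icc.prod isCompact_Icc)).mono_set
        (prod_mono Ioc_subset_Icc_self Ioc_subset_Icc_self)
  have h5 : ∀ s, ∫ t in (0 : ℝ)..1, G (s, t) =
      (∫ t in (0 : ℝ)..1, A (s, t) * fderiv ℝ k (s, t) (1, 0) * β t) +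
      ∫ t in (0 : ℝ)..1, (fderiv ℝ ρ (s, t) (0, 1) * fderiv ℝ k (s, t) (1, 0) -
        fderiv ℝ ρ (s, t) (1, 0) * fderiv ℝ k (s, t) (0, 1)) := by
    intro s
    have i1 : IntervalIntegrable (fun t ↦ A (s, t) * fderiv ℝ k (s, t) (0, 1) * α s) volume 0 1 :=
      Continuous.intervalIntegrable (by fun_prop) _ _
    have i2 : IntervalIntegrable (fun t ↦ A (s, t) * fderiv ℝ k (s, t) (1, 0) * β t) volume 0 1 :=
      Continuous.intervalIntegrable (by fun_prop) _ _
    have i3 : IntervalIntegrable (fun t ↦ fderiv ℝ ρ (s, t) (0, 1) * fderiv ℝ k (s, t) (1, 0) -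
        fderiv ℝ ρ (s, t) (1, 0) * fderiv ℝ k (s, t) (0, 1)) volume 0 1 :=
      Continuous.intervalIntegrable (by fun_prop) _ _
    simp only [hG]
    rw [intervalIntegral.integral_add (i1.add i2) i3, intervalIntegral.integral_add i1 i2,
      intervalIntegral.integral_mul_const, h1, zero_mul, zero_add]
  simp only [h5]
  have j1 : IntervalIntegrable (fun s ↦ ∫ t in (0 : ℝ)..1,
      A (s, t) * fderiv ℝ k (s, t) (1, 0) * β t) volume 0 1 :=
    (intervalIntegral.continuous_parametric_intervalIntegral_of_continuous'
      (f := fun s t ↦ A (s, t) * fderiv ℝ k (s, t) (1, 0) * β t)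
      (by fun_prop) 0 1).intervalIntegrable _ _
  have j2 : IntervalIntegrable (fun s ↦ ∫ t in (0 : ℝ)..1,
      (fderiv ℝ ρ (s, t) (0, 1) * fderiv ℝ k (s, t) (1, 0) -
        fderiv ℝ ρ (s, t) (1, 0) * fderiv ℝ k (s, t) (0, 1))) volume 0 1 :=
    (intervalIntegral.continuous_parametric_intervalIntegral_of_continuous'
      (f := fun s t ↦ fderiv ℝ ρ (s, t) (0, 1) * fderiv ℝ k (s, t) (1, 0) -
        fderiv ℝ ρ (s, t) (1, 0) * fderiv ℝ k (s, t) (0, 1))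
      (by fun_prop) 0 1).intervalIntegrable _ _
  rw [intervalIntegral.integral_add j1 j2, h3, h4]
  simp

/-! ### A flow-invariant field transverse to the Hamiltonian field -/

lemma alternating_expand (B : EuclideanSpace ℝ (Fin 2) →L[ℝ] EuclideanSpace ℝ (Fin 2) →L[ℝ] ℝ)
    (hB : ∀ v, B v v = 0) {X Y : EuclideanSpace ℝ (Fin 2)} (hXY : B X Y = 1)
    (v : EuclideanSpace ℝ (Fin 2)) : v = B v Y • X + B X v • Y := by
  let e := EuclideanSpace.basisFun (Fin 2) ℝ
  have hexp : ∀ v : EuclideanSpace ℝ (Fin 2), v = v 0 • e 0 + v 1 • e 1 := by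
    intro v
    ext i
    fin_cases i <;> simp [e]
  have hswap : B (e 1) (e 0) = -B (e 0) (e 1) := by
    have h := hB (e 0 + e 1)
    simp only [map_add, add_apply, hB] at h
    linarith
  have hform : ∀ v w : EuclideanSpace ℝ (Fin 2),
      B v w = B (e 0) (e 1) * (v 0 * w 1 - v 1 * w 0) := by
    intro v w
    conv_lhs => rw [hexp v, hexp w]
    simp only [map_add, map_smul, add_apply, smul_apply,
      hB, hswap, smul_eq_mul]
    ring
  rw [hform] at hXY
  ext i
  rw [hform v Y, hform X v]
  fin_cases i
  · simp
    linear_combination (-v 0) * hXY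
  · simp
    linear_combination (-v 1) * hXY

section Flow

variable {M : Type*} [TopologicalSpace M] [ChartedSpace (EuclideanSpace ℝ (Fin 2)) M]
  [T2Space M] [CompactSpace M] [IsManifold (𝓡 2) ∞ M] {X : ∀ x : M, TangentSpace (𝓡 2) x}
  {ψ : ℝ → M → M} {σ : BilinField M} {H : M → ℝ}

lemma IsFlow.contMDiff_time (hψ : IsFlow X ψ) (hX : IsSmoothField X) (t : ℝ) :
    ContMDiff (𝓡 2) (𝓡 2) ∞ (ψ t) :=
  (hψ.contMDiff hX).comp (contMDiff_const.prodMk contMDiff_id)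

lemma IsFlow.mdifferentiableAt_time (hψ : IsFlow X ψ) (hX : IsSmoothField X) (t : ℝ) (x : M) :
    MDifferentiableAt (𝓡 2) (𝓡 2) (ψ t) x :=
  (hψ.contMDiff_time hX t).mdifferentiableAt (by simp)

lemma IsFlow.mfderiv_field (hψ : IsFlow X ψ) (hX : IsSmoothField X) (t : ℝ) (x : M) :
    mfderiv (𝓡 2) (𝓡 2) (ψ t) x (X x) = X (ψ t x) := by
  have h1 : HasMFDerivAt 𝓘(ℝ, ℝ) (𝓡 2) (fun r ↦ ψ r x) 0
      ((1 : ℝ →L[ℝ] ℝ).smulRight (X (ψ 0 x))) := hψ.curve x 0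
  have h2 : HasMFDerivAt (𝓡 2) (𝓡 2) (ψ t) (ψ 0 x) (mfderiv (𝓡 2) (𝓡 2) (ψ t) (ψ 0 x)) :=
    (hψ.mdifferentiableAt_time hX t _).hasMFDerivAt
  have h3 := HasMFDerivAt.comp (0 : ℝ) h2 h1
  have h4 : ψ t ∘ (fun r ↦ ψ r x) = fun r ↦ ψ (r + t) x := by
    ext r
    rw [Function.comp, ← hψ.add hX, add_comm]
  rw [h4] at h3
  have h5 : HasMFDerivAt 𝓘(ℝ, ℝ) (𝓡 2) (fun r ↦ ψ (r + t) x) 0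
      ((1 : ℝ →L[ℝ] ℝ).smulRight (X (ψ (0 + t) x))) := ((hψ.curve x).comp_add t) 0
  have h6 := congrArg (fun L : ℝ →L[ℝ] EuclideanSpace ℝ (Fin 2) ↦ L 1) (hasMFDerivAt_unique h3 h5)
  have h7 : mfderiv (𝓡 2) (𝓡 2) (ψ t) (ψ 0 x) ((1 : ℝ) • X (ψ 0 x)) =
    ((1 : ℝ) • X (ψ (0 + t) x) : EuclideanSpace ℝ (Fin 2)) := h6
  rw [one_smul, hψ.zero, zero_add] at h7
  exact h7.trans (one_smul ℝ (X (ψ t x)))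

lemma IsFlow.mfderiv_add (hψ : IsFlow X ψ) (hX : IsSmoothField X) (s t : ℝ) (x : M)
    (v : TangentSpace (𝓡 2) x) :
    mfderiv (𝓡 2) (𝓡 2) (ψ (s + t)) x v =
      mfderiv (𝓡 2) (𝓡 2) (ψ s) (ψ t x) (mfderiv (𝓡 2) (𝓡 2) (ψ t) x v) := by
  have h1 : ψ (s + t) = ψ s ∘ ψ t := funext fun x ↦ hψ.add hX s t x
  rw [h1, mfderiv_comp x (hψ.mdifferentiableAt_time hX s _) (hψ.mdifferentiableAt_time hX t _)]
  rfl

lemma IsFlow.hamiltonian_eq (hσ : IsAreaForm σ) (hH : ContMDiff (𝓡 2) 𝓘(ℝ, ℝ) ∞ H)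
    (hHX : ∀ (x : M) (v : TangentSpace (𝓡 2) x), mfderiv (𝓡 2) 𝓘(ℝ, ℝ) H x v = σ x (X x) v)
    (hψ : IsFlow X ψ) (t : ℝ) (x : M) : H (ψ t x) = H x := by
  have h1 : ∀ t, HasDerivAt (fun t ↦ H (ψ t x)) 0 t := by
    intro t
    refine (hasDerivAt_comp_curve (hH.mdifferentiableAt (by simp)) (hψ.curve x t)).congr_deriv ?_
    rw [hHX]
    have : ((1 : ℝ →L[ℝ] ℝ).smulRight (X (ψ t x))) (1 : ℝ) = X (ψ t x) := by
      exact one_smul ℝ (X (ψ t x))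
    rw [this, hσ.alternating]
  have := is_const_of_deriv_eq_zero (fun t ↦ (h1 t).differentiableAt) (fun t ↦ (h1 t).deriv) t 0
  rwa [hψ.zero] at this

lemma IsFlow.mfderiv_hamiltonian (hσ : IsAreaForm σ) (hH : ContMDiff (𝓡 2) 𝓘(ℝ, ℝ) ∞ H)
    (hHX : ∀ (x : M) (v : TangentSpace (𝓡 2) x), mfderiv (𝓡 2) 𝓘(ℝ, ℝ) H x v = σ x (X x) v)
    (hX : IsSmoothField X) (hψ : IsFlow X ψ) (t : ℝ) (x : M) (v : TangentSpace (𝓡 2) x) :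
    σ (ψ t x) (X (ψ t x)) (mfderiv (𝓡 2) (𝓡 2) (ψ t) x v) = σ x (X x) v := by
  have h1 : H ∘ ψ t = H := funext fun x ↦ hψ.hamiltonian_eq hσ hH hHX t x
  rw [← hHX, ← hHX, ← h1, mfderiv_comp x (hH.mdifferentiableAt (by simp))
    (hψ.mdifferentiableAt_time hX t _), h1]
  rfl

/-- The shear of a field `Y` under the flow of `X`: if `σ(X, Y) = 1`, then `ψ_t` maps `Y` to
`Y - (shear) X`, see `IsFlow.mfderiv_transverse`. -/
def shear (σ : BilinField M) (ψ : ℝ → M → M) (Y : ∀ x : M, TangentSpace (𝓡 2) x) (t : ℝ) (x : M) :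
    ℝ :=
  σ (ψ t x) (Y (ψ t x)) (mfderiv (𝓡 2) (𝓡 2) (ψ t) x (Y x))

lemma contDiffOn_shear (hσ : IsAreaForm σ) (hX : IsSmoothField X) (hψ : IsFlow X ψ)
    {Y : ∀ x : M, TangentSpace (𝓡 2) x} (hY : IsSmoothField Y) (x₀ : M) :
    ContDiffOn ℝ ∞ (fun z : EuclideanSpace ℝ (Fin 2) × ℝ ↦
      shear σ ψ Y z.2 ((extChartAt (𝓡 2) x₀).symm z.1)) ((extChartAt (𝓡 2) x₀).target ×ˢ univ) := by
  obtain ⟨η, hη⟩ := hY.exists_isFlow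
  set c := (extChartAt (𝓡 2) x₀).symm with hc
  rintro ⟨e₀, t₀⟩ ⟨he₀, -⟩
  refine ContDiffAt.contDiffWithinAt ?_
  rw [← contMDiffAt_iff_contDiffAt]
  have hcs : ∀ e ∈ (extChartAt (𝓡 2) x₀).target, ContMDiffAt (𝓡 2) (𝓡 2) ∞ c e := fun e he ↦
    (contMDiffOn_extChartAt_symm x₀).contMDiffAt ((isOpen_extChartAt_target x₀).mem_nhds he)
  let f : (EuclideanSpace ℝ (Fin 2) × ℝ) × ℝ → M := fun z ↦ ψ z.1.2 (η z.2 (c z.1.1))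
  have hf : ∀ z, z.1.1 ∈ (extChartAt (𝓡 2) x₀).target →
      ContMDiffAt 𝓘(ℝ, (EuclideanSpace ℝ (Fin 2) × ℝ) × ℝ) (𝓡 2) ∞ f z := by
    intro z hz
    have h1 : ContMDiffAt 𝓘(ℝ, (EuclideanSpace ℝ (Fin 2) × ℝ) × ℝ) (𝓡 2) ∞
        (fun z : (EuclideanSpace ℝ (Fin 2) × ℝ) × ℝ ↦ c z.1.1) z :=
      ContMDiffAt.comp z (hcs _ hz) (contDiff_fst.comp contDiff_fst).contMDiff.contMDiffAt
    have h2 := (hη.contMDiff hY).contMDiffAt.comp z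
      (ContMDiffAt.prodMk (contDiff_snd.contMDiff.contMDiffAt) h1)
    exact (hψ.contMDiff hX).contMDiffAt.comp z
      (ContMDiffAt.prodMk ((contDiff_snd.comp contDiff_fst).contMDiff.contMDiffAt) h2)
  have hV := contMDiffAt_mfderiv_apply (hf ((e₀, t₀), 0) he₀)
    (contMDiff_const_field ((0, 1) : (EuclideanSpace ℝ (Fin 2) × ℝ) × ℝ) _)
  have hV' := hV.comp (e₀, t₀) (f := fun z : EuclideanSpace ℝ (Fin 2) × ℝ ↦ (z, (0 : ℝ)))
    (contDiff_prodMk_left (𝕜 := ℝ) (0 : ℝ)).contMDiff.contMDiffAt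
  have hψc : ContMDiffAt 𝓘(ℝ, EuclideanSpace ℝ (Fin 2) × ℝ) (𝓡 2) ∞
      (fun z : EuclideanSpace ℝ (Fin 2) × ℝ ↦ f (z, 0)) (e₀, t₀) :=
    (hf ((e₀, t₀), 0) he₀).comp (e₀, t₀) (f := fun z : EuclideanSpace ℝ (Fin 2) × ℝ ↦ (z, (0 : ℝ)))
      (contDiff_prodMk_left (𝕜 := ℝ) (0 : ℝ)).contMDiff.contMDiffAt
  have hW := (hY _).comp (e₀, t₀) hψc
  refine (hσ.contMDiffAt_apply (V := fun z ↦ Y (f (z, 0)))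
    (W := fun z ↦ mfderiv 𝓘(ℝ, (EuclideanSpace ℝ (Fin 2) × ℝ) × ℝ) (𝓡 2) f (z, 0) (0, 1))
    hW hV').congr_of_eventuallyEq ?_
  filter_upwards [((isOpen_extChartAt_target x₀).preimage continuous_fst).mem_nhds he₀] with z hz
  have e1 : mfderiv 𝓘(ℝ, (EuclideanSpace ℝ (Fin 2) × ℝ) × ℝ) (𝓡 2) f (z, 0) (0, 1) =
      mfderiv (𝓡 2) (𝓡 2) (ψ z.2) (η 0 (c z.1)) (Y (η 0 (c z.1))) := by
    have h1 : HasMFDerivAt 𝓘(ℝ, ℝ) 𝓘(ℝ, (EuclideanSpace ℝ (Fin 2) × ℝ) × ℝ)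
        (fun r : ℝ ↦ ((z, r) : (EuclideanSpace ℝ (Fin 2) × ℝ) × ℝ)) 0
        (ContinuousLinearMap.inr ℝ (EuclideanSpace ℝ (Fin 2) × ℝ) ℝ) :=
      (hasFDerivAt_prodMk_right z (0 : ℝ)).hasMFDerivAt
    have h2 := HasMFDerivAt.comp (0 : ℝ)
      ((hf (z, 0) hz).mdifferentiableAt (by simp)).hasMFDerivAt h1
    have h3 : HasMFDerivAt 𝓘(ℝ, ℝ) (𝓡 2) (fun r ↦ η r (c z.1)) 0
      ((1 : ℝ →L[ℝ] ℝ).smulRight (Y (η 0 (c z.1)))) := hη.curve _ 0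
    have h4 := HasMFDerivAt.comp (0 : ℝ)
      (hψ.mdifferentiableAt_time hX z.2 (η 0 (c z.1))).hasMFDerivAt h3
    have h5 := congrArg (fun L : ℝ →L[ℝ] EuclideanSpace ℝ (Fin 2) ↦ L 1) (hasMFDerivAt_unique h2 h4)
    have h6 : mfderiv 𝓘(ℝ, (EuclideanSpace ℝ (Fin 2) × ℝ) × ℝ) (𝓡 2) f (z, 0) (0, 1) =
      mfderiv (𝓡 2) (𝓡 2) (ψ z.2) (η 0 (c z.1)) ((1 : ℝ) • Y (η 0 (c z.1))) := h5
    rw [h6, one_smul]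
  rw [e1]
  change _ = σ (ψ z.2 (η 0 (c z.1))) (Y (ψ z.2 (η 0 (c z.1))))
    (mfderiv (𝓡 2) (𝓡 2) (ψ z.2) (η 0 (c z.1)) (Y (η 0 (c z.1))))
  rw [hη.zero]
  rfl

variable {Y : ∀ x : M, TangentSpace (𝓡 2) x}

lemma contMDiff_integral_shear (hσ : IsAreaForm σ) (hX : IsSmoothField X) (hψ : IsFlow X ψ)
    (hY : IsSmoothField Y) (b : ℝ) :
    ContMDiff (𝓡 2) 𝓘(ℝ, ℝ) ∞ fun x ↦ ∫ t in (0 : ℝ)..1, shear σ ψ Y (b * t) x := by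
  refine contMDiff_integral_unitInterval (F := fun x t ↦ shear σ ψ Y (b * t) x) fun x₀ ↦ ?_
  exact (contDiffOn_shear hσ hX hψ hY x₀).comp
    (contDiff_fst.prodMk (contDiff_const.mul contDiff_snd)).contDiffOn fun z hz ↦ ⟨hz.1, trivial⟩

lemma continuous_shear (hσ : IsAreaForm σ) (hX : IsSmoothField X) (hψ : IsFlow X ψ)
    (hY : IsSmoothField Y) (x : M) : Continuous fun t ↦ shear σ ψ Y t x := by
  have h := (contDiffOn_shear hσ hX hψ hY x).continuousOn.comp_continuous
    (f := fun t : ℝ ↦ (extChartAt (𝓡 2) x x, t)) (by fun_prop)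
    fun t ↦ ⟨mem_extChartAt_target x, trivial⟩
  have h1 : ∀ t, shear σ ψ Y t ((extChartAt (𝓡 2) x).symm (extChartAt (𝓡 2) x x)) =
      shear σ ψ Y t x := fun t ↦ by rw [extChartAt_to_inv]
  exact (continuous_congr h1).1 h

lemma IsFlow.mfderiv_transverse (hσ : IsAreaForm σ) (hH : ContMDiff (𝓡 2) 𝓘(ℝ, ℝ) ∞ H)
    (hHX : ∀ (x : M) (v : TangentSpace (𝓡 2) x), mfderiv (𝓡 2) 𝓘(ℝ, ℝ) H x v = σ x (X x) v)
    (hX : IsSmoothField X) (hψ : IsFlow X ψ)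
    {t : ℝ} {x : M} (h0 : σ x (X x) (Y x) = 1)
    (h1 : σ (ψ t x) (X (ψ t x)) (Y (ψ t x)) = 1) :
    mfderiv (𝓡 2) (𝓡 2) (ψ t) x (Y x) = Y (ψ t x) - shear σ ψ Y t x • X (ψ t x) := by
  have h := alternating_expand (σ (ψ t x)) (hσ.alternating _) h1
    (mfderiv (𝓡 2) (𝓡 2) (ψ t) x (Y x))
  have h2 := hψ.mfderiv_hamiltonian hσ hH hHX hX t x (Y x)
  have h3 : σ (ψ t x) (mfderiv (𝓡 2) (𝓡 2) (ψ t) x (Y x)) (Y (ψ t x)) = -shear σ ψ Y t x :=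
    hσ.swap _ _ _
  have h4 : ∀ (a b : EuclideanSpace ℝ (Fin 2)) (r : ℝ), -r • a + (1 : ℝ) • b = b - r • a := by
    intros; module
  have h5 : mfderiv (𝓡 2) (𝓡 2) (ψ t) x (Y x) =
      (-shear σ ψ Y t x • X (ψ t x) + (1 : ℝ) • Y (ψ t x) : EuclideanSpace ℝ (Fin 2)) := by
    rw [← h3, ← h0, ← h2]
    exact h
  exact h5.trans (h4 _ _ _)

/-- The shear is a cocycle over the flow. -/
lemma shear_add (hσ : IsAreaForm σ) (hH : ContMDiff (𝓡 2) 𝓘(ℝ, ℝ) ∞ H)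
    (hHX : ∀ (x : M) (v : TangentSpace (𝓡 2) x), mfderiv (𝓡 2) 𝓘(ℝ, ℝ) H x v = σ x (X x) v)
    (hX : IsSmoothField X) (hψ : IsFlow X ψ)
    {s t : ℝ} {x : M} (h0 : σ x (X x) (Y x) = 1)
    (h1 : σ (ψ t x) (X (ψ t x)) (Y (ψ t x)) = 1)
    (h2 : σ (ψ s (ψ t x)) (X (ψ s (ψ t x))) (Y (ψ s (ψ t x))) = 1) :
    shear σ ψ Y (s + t) x = shear σ ψ Y s (ψ t x) + shear σ ψ Y t x := by
  have e1 : shear σ ψ Y (s + t) x = σ (ψ s (ψ t x)) (Y (ψ s (ψ t x)))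
      (mfderiv (𝓡 2) (𝓡 2) (ψ s) (ψ t x) (mfderiv (𝓡 2) (𝓡 2) (ψ t) x (Y x))) := by
    rw [← hψ.mfderiv_add hX, ← hψ.add hX]
    rfl
  rw [e1, hψ.mfderiv_transverse hσ hH hHX hX h0 h1, map_sub, map_sub, map_smul, map_smul,
    hψ.mfderiv_field hX, hσ.swap _ (Y (ψ s (ψ t x))) (X (ψ s (ψ t x))), h2]
  simp [shear]

/-- On the flow-invariant set `O`, the field `Y` satisfies `σ(X, Y) = 1`, and is
invariant under the flow `ψ` of `X`. So `X` and `Y` form a frame, and `σ(·, Y)` is an invariant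
1-form which is `1` on `X`. -/
structure IsInvariantFrame (σ : BilinField M) (X Y : ∀ x : M, TangentSpace (𝓡 2) x)
    (ψ : ℝ → M → M) (O : Set M) : Prop where
  flow_mem : ∀ x ∈ O, ∀ t, ψ t x ∈ O
  apply_eq_one : ∀ x ∈ O, σ x (X x) (Y x) = 1
  mfderiv_eq : ∀ x ∈ O, ∀ t, mfderiv (𝓡 2) (𝓡 2) (ψ t) x (Y x) = Y (ψ t x)

/-- A smooth field `Y` with `σ(X, Y) = 1` which is invariant under the flow of `X`, on a family of
periodic orbits. It is obtained from any transverse field by averaging its shear over the period. -/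
theorem exists_invariant_field (hσ : IsAreaForm σ) (hH : ContMDiff (𝓡 2) 𝓘(ℝ, ℝ) ∞ H)
    (hHX : ∀ (x : M) (v : TangentSpace (𝓡 2) x), mfderiv (𝓡 2) 𝓘(ℝ, ℝ) H x v = σ x (X x) v)
    (hX : IsSmoothField X) (hψ : IsFlow X ψ) {J : ℝ → EndField M} (hJ : IsSmoothPath J)
    (hc : IsCompatible σ (J 0)) {K A : Set M} (hK : IsCompact K) (hA : IsOpen A) (hKA : K ⊆ A)
    {b : ℝ} (hb : 0 < b) (hper : ∀ x ∈ A, ψ b x = x) (hX0 : ∀ x ∈ K, X x ≠ 0) :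
    ∃ (Y : ∀ x : M, TangentSpace (𝓡 2) x) (O : Set M), IsSmoothField Y ∧ K ⊆ O ∧
      IsInvariantFrame σ X Y ψ O := by
  let D : M → ℝ := fun x ↦ σ x (X x) (J 0 x (X x))
  have hJX : IsSmoothField fun x ↦ J 0 x (X x) := fun x ↦
    hJ.contMDiffAt_apply contMDiffAt_const (hX x)
  have hDs : ContMDiff (𝓡 2) 𝓘(ℝ, ℝ) ∞ D := fun x ↦ hσ.contMDiffAt_apply (hX x) (hJX x)
  have hperK : ∀ y ∈ K, Function.Periodic (fun r ↦ ψ r y) b := fun y hy r ↦ by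
    change ψ (r + b) y = ψ r y
    rw [hψ.add hX, hper y (hKA hy)]
  have hXr : ∀ y ∈ K, ∀ r, X (ψ r y) ≠ 0 := by
    intro y hy r h0
    refine hX0 y hy ?_
    have := hψ.mfderiv_field hX (-r) (ψ r y)
    rw [h0, map_zero, hψ.neg_cancel hX] at this
    exact this.symm
  obtain ⟨d, hd, hdD⟩ : ∃ d > 0, ∀ y ∈ K, ∀ r, d ≤ D (ψ r y) := by
    have hcomp : IsCompact (Icc (0 : ℝ) b ×ˢ K) := isCompact_Icc.prod hK
    obtain ⟨d, hd, h⟩ := hcomp.exists_forall_le' (f := fun z : ℝ × M ↦ D (ψ z.1 z.2)) (a := 0)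
      (hDs.continuous.comp (hψ.continuous hX)).continuousOn
      fun z hz ↦ hc.pos _ _ (hXr z.2 hz.2 z.1)
    refine ⟨d, hd, fun y hy r ↦ ?_⟩
    obtain ⟨r', hr', h1⟩ := (hperK y hy).exists_mem_Ico₀ hb r
    change ψ r y = ψ r' y at h1
    rw [h1]
    exact h (r', y) ⟨⟨hr'.1, hr'.2.le⟩, hy⟩
  -- a smooth function which is `1 / x` for `x ≥ d`
  let ν : ℝ → ℝ := fun x ↦ smoothStep (x / d) / x
  have hν : ContDiff ℝ ∞ ν := by
    rw [contDiff_iff_contDiffAt]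
    intro x
    have h1 : ContDiff ℝ ∞ fun x : ℝ ↦ smoothStep (x / d) :=
      contDiff_smoothStep.comp (contDiff_id.div_const d)
    by_cases hx : x = 0
    · refine (contDiffAt_const (c := (0 : ℝ))).congr_of_eventuallyEq ?_
      have : ∀ᶠ y in 𝓝 x, y < d / 3 := by
        rw [hx]; exact gt_mem_nhds (by positivity)
      filter_upwards [this] with y hy
      simp only [ν]
      rw [smoothStep_of_le, zero_div]
      rw [div_le_iff₀ hd]
      linarith
    · exact h1.contDiffAt.div contDiffAt_id hx
  -- a field with `σ(X, Y₀) = 1`, not yet invariant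
  let Y₀ : ∀ x : M, TangentSpace (𝓡 2) x := fun x ↦ ν (D x) • J 0 x (X x)
  have hY₀ : IsSmoothField Y₀ := fun x ↦
    contMDiffAt_smul_field ((hν.contMDiff.comp hDs) x) (hJX x)
  have h1 : ∀ y ∈ K, ∀ r, σ (ψ r y) (X (ψ r y)) (Y₀ (ψ r y)) = 1 := by
    intro y hy r
    have hdr := hdD y hy r
    have hpos : 0 < D (ψ r y) := hd.trans_le hdr
    have e1 : ν (D (ψ r y)) = 1 / D (ψ r y) := by
      simp only [ν]
      rw [smoothStep_of_ge]
      rw [le_div_iff₀ hd]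
      linarith
    simp only [Y₀, map_smul, smul_eq_mul]
    rw [e1]
    exact one_div_mul_cancel hpos.ne'
  -- the field `Y₀ + μ X` is invariant when `μ` compensates the shear along the flow; the mean of
  -- the shear over the period has this property
  let μ : M → ℝ := fun x ↦ ∫ t in (0 : ℝ)..1, shear σ ψ Y₀ (b * t) x
  have hμ : ContMDiff (𝓡 2) 𝓘(ℝ, ℝ) ∞ μ := contMDiff_integral_shear hσ hX hψ hY₀ b
  have hadd : ∀ y ∈ K, ∀ r s t, shear σ ψ Y₀ (s + t) (ψ r y) =
      shear σ ψ Y₀ s (ψ t (ψ r y)) + shear σ ψ Y₀ t (ψ r y) := by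
    intro y hy r s t
    refine shear_add hσ hH hHX hX hψ (h1 y hy r) ?_ ?_
    · rw [← hψ.add hX]; exact h1 y hy _
    · rw [← hψ.add hX, ← hψ.add hX]; exact h1 y hy _
  have hψb : ∀ y ∈ K, ∀ r, ψ b (ψ r y) = ψ r y := fun y hy r ↦ by
    rw [← hψ.add hX, add_comm]
    exact hperK y hy r
  -- there is no shear over a full period, as `ψ_b` is the identity near the orbit
  have hshb : ∀ y ∈ K, ∀ r, shear σ ψ Y₀ b (ψ r y) = 0 := by
    intro y hy r
    have e1 : ψ b =ᶠ[𝓝 (ψ r y)] id := by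
      have hcont : Continuous (ψ (-r)) := (hψ.contMDiff_time hX _).continuous
      have hmem : ψ (-r) (ψ r y) ∈ A := by rw [hψ.neg_cancel hX]; exact hKA hy
      filter_upwards [(hA.preimage hcont).mem_nhds hmem] with x hx
      have h2 := hper _ hx
      rw [← hψ.add hX, add_comm, hψ.add hX] at h2
      have h3 := congrArg (ψ r) h2
      rwa [hψ.cancel_neg hX, hψ.cancel_neg hX] at h3
    have e2 : mfderiv (𝓡 2) (𝓡 2) (ψ b) (ψ r y) (Y₀ (ψ r y)) =
        (Y₀ (ψ r y) : EuclideanSpace ℝ (Fin 2)) := by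
      have := congrArg (fun L : EuclideanSpace ℝ (Fin 2) →L[ℝ] EuclideanSpace ℝ (Fin 2) ↦
        L (Y₀ (ψ r y))) (e1.mfderiv_eq (I := 𝓡 2) (I' := 𝓡 2))
      refine this.trans ?_
      rw [mfderiv_id]
      rfl
    have e3 : shear σ ψ Y₀ b (ψ r y) = σ (ψ b (ψ r y)) (Y₀ (ψ b (ψ r y))) (Y₀ (ψ r y)) :=
      congrArg (σ (ψ b (ψ r y)) (Y₀ (ψ b (ψ r y)))) e2
    rw [e3, hψb y hy]
    exact hσ.alternating _ _
  have hμflow : ∀ y ∈ K, ∀ r t, μ (ψ t (ψ r y)) = μ (ψ r y) - shear σ ψ Y₀ t (ψ r y) := by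
    intro y hy r t
    have hP : Function.Periodic (fun t ↦ shear σ ψ Y₀ (b * t) (ψ r y)) 1 := fun t ↦ by
      beta_reduce
      rw [mul_add, mul_one, hadd y hy, hψb y hy, hshb y hy, add_zero]
    have hcont : Continuous fun t ↦ shear σ ψ Y₀ (b * t) (ψ r y) :=
      (continuous_shear hσ hX hψ hY₀ _).comp (continuous_const.mul continuous_id)
    have e1 : μ (ψ t (ψ r y)) = ∫ t' in (0 : ℝ)..1,
        (shear σ ψ Y₀ (b * (t' + t / b)) (ψ r y) - shear σ ψ Y₀ t (ψ r y)) := by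
      refine intervalIntegral.integral_congr fun t' _ ↦ ?_
      have : b * (t' + t / b) = b * t' + t := by field_simp
      rw [this, hadd y hy]
      ring
    have hi : IntervalIntegrable (fun t' ↦ shear σ ψ Y₀ (b * (t' + t / b)) (ψ r y)) volume 0 1 :=
      (hcont.comp (continuous_add_const (t / b))).intervalIntegrable _ _
    rw [e1, intervalIntegral.integral_sub hi intervalIntegrable_const,
      intervalIntegral.integral_comp_add_right (fun t ↦ shear σ ψ Y₀ (b * t) (ψ r y)),
      zero_add, add_comm 1, hP.intervalIntegral_add_eq (t / b) 0]
    simp [μ]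
  refine ⟨fun x ↦ Y₀ x + μ x • X x, {x | ∃ y ∈ K, ∃ r, ψ r y = x},
    fun x ↦ contMDiffAt_add_field (hY₀ x) (contMDiffAt_smul_field (hμ x) (hX x)),
    fun y hy ↦ ⟨y, hy, 0, hψ.zero y⟩, ?_, ?_, ?_⟩
  · rintro _ ⟨y, hy, r, rfl⟩ t
    exact ⟨y, hy, t + r, hψ.add hX t r y⟩
  all_goals rintro _ ⟨y, hy, r, rfl⟩
  · have h2 : ∀ (x : M) (v w : TangentSpace (𝓡 2) x) (c : ℝ), σ x v (w + c • v) = σ x v w := by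
      intro x v w c
      rw [map_add, map_smul, hσ.alternating, smul_zero, add_zero]
    exact (h2 _ _ _ _).trans (h1 y hy r)
  · intro t
    have h2 : σ (ψ t (ψ r y)) (X (ψ t (ψ r y))) (Y₀ (ψ t (ψ r y))) = 1 := by
      rw [← hψ.add hX]; exact h1 y hy _
    have h3 : ∀ (L : EuclideanSpace ℝ (Fin 2) →L[ℝ] EuclideanSpace ℝ (Fin 2)) v w (c : ℝ),
        L (w + c • v) = L w + c • L v := by
      intro L v w c
      rw [map_add, map_smul]
    refine (h3 (mfderiv (𝓡 2) (𝓡 2) (ψ t) (ψ r y)) _ _ _).trans ?_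
    have h4 : ∀ (p q x y : EuclideanSpace ℝ (Fin 2)) (m s m' : ℝ), p = y - s • x → q = x →
        m' = m - s → p + m • q = y + m' • x := by
      rintro p q x y m s m' rfl rfl rfl
      module
    exact h4 _ _ _ _ _ _ _ (hψ.mfderiv_transverse hσ hH hHX hX (h1 y hy r) h2)
      (hψ.mfderiv_field hX _ _) (hμflow y hy r t)

end Flow

/-! ### Velocities of curves moved by flows -/

section Velocity

variable {M : Type*} [TopologicalSpace M] [ChartedSpace (EuclideanSpace ℝ (Fin 2)) M]

/-- The velocity of a curve. -/
def vel (c : ℝ → M) (t : ℝ) : TangentSpace (𝓡 2) (c t) := mfderiv 𝓘(ℝ, ℝ) (𝓡 2) c t (1 : ℝ)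

lemma vel_eq {c : ℝ → M} {t : ℝ} {L : ℝ →L[ℝ] TangentSpace (𝓡 2) (c t)}
    (h : HasMFDerivAt 𝓘(ℝ, ℝ) (𝓡 2) c t L) : vel c t = L 1 :=
  congrArg (fun L : ℝ →L[ℝ] EuclideanSpace ℝ (Fin 2) ↦ L 1) h.mfderiv

lemma vel_comp {g : M → M} {c : ℝ → M} {t : ℝ} (hg : MDifferentiableAt (𝓡 2) (𝓡 2) g (c t))
    (hc : MDifferentiableAt 𝓘(ℝ, ℝ) (𝓡 2) c t) :
    vel (fun t ↦ g (c t)) t = mfderiv (𝓡 2) (𝓡 2) g (c t) (vel c t) :=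
  vel_eq (HasMFDerivAt.comp t hg.hasMFDerivAt hc.hasMFDerivAt)

lemma vel_comp_add {c : ℝ → M} {t a : ℝ} (hc : MDifferentiableAt 𝓘(ℝ, ℝ) (𝓡 2) c (t + a)) :
    vel (fun t ↦ c (t + a)) t = vel c (t + a) := by
  have h1 : HasMFDerivAt 𝓘(ℝ, ℝ) 𝓘(ℝ, ℝ) (fun t : ℝ ↦ t + a) t (ContinuousLinearMap.id ℝ ℝ) :=
    ((hasFDerivAt_id t).add_const a).hasMFDerivAt
  exact vel_eq (HasMFDerivAt.comp t hc.hasMFDerivAt h1)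

variable [T2Space M] [CompactSpace M] [IsManifold (𝓡 2) ∞ M]
  {X Y : ∀ x : M, TangentSpace (𝓡 2) x} {ψ : ℝ → M → M} {σ : BilinField M} {H : M → ℝ}

lemma IsFlow.vel_comp (hψ : IsFlow X ψ) (hX : IsSmoothField X) {c : ℝ → M} {τ : ℝ → ℝ} {r τ' : ℝ}
    (hc : MDifferentiableAt 𝓘(ℝ, ℝ) (𝓡 2) c r) (hτ : HasDerivAt τ τ' r) :
    vel (fun r ↦ ψ (τ r) (c r)) r =
      τ' • X (ψ (τ r) (c r)) + mfderiv (𝓡 2) (𝓡 2) (ψ (τ r)) (c r) (vel c r) := by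
  have h1 : HasMFDerivAt 𝓘(ℝ, ℝ) (𝓘(ℝ, ℝ).prod (𝓡 2)) (fun r ↦ (τ r, c r)) r _ :=
    HasMFDerivAt.prodMk hτ.hasFDerivAt.hasMFDerivAt hc.hasMFDerivAt
  have h2 : MDifferentiableAt (𝓘(ℝ, ℝ).prod (𝓡 2)) (𝓡 2) (fun z : ℝ × M ↦ ψ z.1 z.2)
      (τ r, c r) := (hψ.contMDiff hX).mdifferentiableAt (by simp)
  have h3 := vel_eq (HasMFDerivAt.comp r h2.hasMFDerivAt h1)
  refine h3.trans ?_
  have h4 := mfderiv_prod_eq_add_apply (v := ((τ', vel c r) : ℝ × EuclideanSpace ℝ (Fin 2))) h2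
  have h5 : mfderiv 𝓘(ℝ, ℝ) (𝓡 2) (fun t ↦ ψ t (c r)) (τ r) τ' =
      (τ' • X (ψ (τ r) (c r)) : EuclideanSpace ℝ (Fin 2)) :=
    congrArg (fun L : ℝ →L[ℝ] EuclideanSpace ℝ (Fin 2) ↦ L τ') (hψ.curve (c r) (τ r)).mfderiv
  have h6 : ∀ a b d e : EuclideanSpace ℝ (Fin 2), e = a + b → a = d → e = d + b := by
    rintro a b d e rfl rfl; rfl
  refine Eq.trans ?_ (h6 _ _ _ _ h4 h5)
  have h7 : ((ContinuousLinearMap.toSpanSingleton ℝ τ' (1 : ℝ), vel c r) :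
      ℝ × EuclideanSpace ℝ (Fin 2)) = (τ', vel c r) := by
    simp
    rfl
  exact congrArg (mfderiv (𝓘(ℝ, ℝ).prod (𝓡 2)) (𝓡 2) (fun z : ℝ × M ↦ ψ z.1 z.2) (τ r, c r)) h7

omit [CompactSpace M] in
lemma eq_of_vel_eq_zero {c : ℝ → M} (hc : MDifferentiable 𝓘(ℝ, ℝ) (𝓡 2) c)
    (h : ∀ t, vel c t = 0) (t : ℝ) : c t = c 0 := by
  have hX : IsSmoothField (fun x : M ↦ (0 : TangentSpace (𝓡 2) x)) :=
    Bundle.contMDiff_zeroSection ℝ (TangentSpace (𝓡 2) : M → Type _)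
  have hψ : IsFlow (fun x : M ↦ (0 : TangentSpace (𝓡 2) x)) fun _ x ↦ x := by
    refine ⟨fun x ↦ rfl, fun x t ↦ ?_⟩
    have h0 : (0 : ℝ →L[ℝ] EuclideanSpace ℝ (Fin 2)) =
        (1 : ℝ →L[ℝ] ℝ).smulRight (0 : EuclideanSpace ℝ (Fin 2)) := by ext; simp
    exact (hasMFDerivAt_const x t).congr_mfderiv h0
  refine hψ.eq_of_isMIntegralCurve hX (fun t ↦ ?_) t
  have h0 : ∀ L : ℝ →L[ℝ] EuclideanSpace ℝ (Fin 2), L 1 = 0 →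
      L = (1 : ℝ →L[ℝ] ℝ).smulRight (0 : EuclideanSpace ℝ (Fin 2)) := by
    intro L hL
    ext1
    rw [hL]
    simp
  exact (hc t).hasMFDerivAt.congr_mfderiv (h0 _ (h t))

omit [T2Space M] [CompactSpace M] in
lemma contMDiff_vel {c : ℝ → M} (hc : ContMDiff 𝓘(ℝ, ℝ) (𝓡 2) ∞ c) :
    ContMDiff 𝓘(ℝ, ℝ) (𝓡 2).tangent ∞ (fun t ↦ (⟨c t, vel c t⟩ : TangentBundle (𝓡 2) M)) :=
  fun t ↦ contMDiffAt_mfderiv_apply (hc t) (contMDiff_const_field (1 : ℝ) t)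

omit [T2Space M] [CompactSpace M] in
lemma IsInvariantFrame.expand {O : Set M} (hF : IsInvariantFrame σ X Y ψ O) (hσ : IsAreaForm σ)
    {x : M} (hx : x ∈ O) (v : TangentSpace (𝓡 2) x) :
    v = σ x v (Y x) • X x + σ x (X x) v • Y x :=
  alternating_expand (σ x) (hσ.alternating x) (hF.apply_eq_one x hx) v

/-- The 1-form `σ(·, Y)` is invariant under the flow. -/
lemma IsInvariantFrame.apply_flow {O : Set M} (hF : IsInvariantFrame σ X Y ψ O)
    (hσ : IsAreaForm σ) (hX : IsSmoothField X) (hψ : IsFlow X ψ) {x : M} (hx : x ∈ O) (t : ℝ)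
    (v : TangentSpace (𝓡 2) x) :
    σ (ψ t x) (mfderiv (𝓡 2) (𝓡 2) (ψ t) x v) (Y (ψ t x)) = σ x v (Y x) := by
  have h0 : ∀ (L : EuclideanSpace ℝ (Fin 2) →L[ℝ] EuclideanSpace ℝ (Fin 2))
      (B : EuclideanSpace ℝ (Fin 2) →L[ℝ] EuclideanSpace ℝ (Fin 2) →L[ℝ] ℝ)
      (v p q p' q' : EuclideanSpace ℝ (Fin 2)) (a b : ℝ), v = a • p + b • q → L p = p' →
      L q = q' → B p' q' = 1 → B q' q' = 0 → B (L v) q' = a := by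
    rintro L B v p q p' q' a b rfl rfl rfl h1 h2
    simp [h1, h2]
  exact h0 (mfderiv (𝓡 2) (𝓡 2) (ψ t) x) (σ (ψ t x)) v _ _ _ _ _ _ (hF.expand hσ hx v)
    (hψ.mfderiv_field hX t x) (hF.mfderiv_eq x hx t)
    (hF.apply_eq_one _ (hF.flow_mem x hx t)) (hσ.alternating _ _)

/-- If a curve in `O` joins a point to a different point of the same orbit of `X`, then the
integral of the 1-form `σ(·, Y)` along the curve is not zero: otherwise, moving the curve by the
flow of `X` to a curve tangent to `Y`, it could be moved by the flow of `Y` to a point. -/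
theorem IsInvariantFrame.integral_ne_zero {O : Set M} (hF : IsInvariantFrame σ X Y ψ O)
    (hσ : IsAreaForm σ) (hH : ContMDiff (𝓡 2) 𝓘(ℝ, ℝ) ∞ H)
    (hHX : ∀ (x : M) (v : TangentSpace (𝓡 2) x), mfderiv (𝓡 2) 𝓘(ℝ, ℝ) H x v = σ x (X x) v)
    (hX : IsSmoothField X) (hψ : IsFlow X ψ) (hY : IsSmoothField Y) {c : ℝ → M}
    (hc : ContMDiff 𝓘(ℝ, ℝ) (𝓡 2) ∞ c) (hcO : ∀ r, c r ∈ O) {ρ T : ℝ} (hT : ψ T (c 0) = c ρ)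
    (hne : c ρ ≠ c 0) :
    ∫ r in (0 : ℝ)..ρ, σ (c r) (vel c r) (Y (c r)) ≠ 0 := by
  intro hzero
  obtain ⟨η, hη⟩ := hY.exists_isFlow
  set Q : ℝ → ℝ := fun r ↦ σ (c r) (vel c r) (Y (c r)) with hQdef
  have hQ : Continuous Q := by
    have : ContMDiff 𝓘(ℝ, ℝ) 𝓘(ℝ, ℝ) ∞ Q := fun r ↦
      hσ.contMDiffAt_apply (contMDiff_vel hc r) ((hY.comp hc) r)
    exact this.continuous
  -- flowing for the time `τ(r)` removes the component of the velocity along `X`, and flowing along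
  -- `Y` for the time `n(r)` removes the component along `Y`
  let τ : ℝ → ℝ := fun r ↦ -∫ x in (0 : ℝ)..r, Q x
  have hτ : ∀ r, HasDerivAt τ (-Q r) r := fun r ↦ (hQ.integral_hasStrictDerivAt 0 r).hasDerivAt.neg
  let n : ℝ → ℝ := fun r ↦ -(H (c r) - H (c 0))
  have hcd : ∀ r, MDifferentiableAt 𝓘(ℝ, ℝ) (𝓡 2) c r := hc.mdifferentiable (by simp)
  have hn : ∀ r, HasDerivAt n (-σ (c r) (X (c r)) (vel c r)) r := by
    intro r
    refine ((hasDerivAt_comp_curve (hH.mdifferentiableAt (by simp))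
      (hcd r).hasMFDerivAt).sub_const _).neg.congr_deriv ?_
    rw [hHX]
    rfl
  have hτs : ContMDiff 𝓘(ℝ, ℝ) 𝓘(ℝ, ℝ) 1 τ := by
    rw [contMDiff_iff_contDiff, contDiff_one_iff_deriv]
    refine ⟨fun r ↦ (hτ r).differentiableAt, ?_⟩
    rw [show deriv τ = fun r ↦ -Q r from funext fun r ↦ (hτ r).deriv]
    exact hQ.neg
  let d : ℝ → M := fun r ↦ ψ (τ r) (c r)
  have hd : MDifferentiable 𝓘(ℝ, ℝ) (𝓡 2) d := by
    have h1 : ContMDiff 𝓘(ℝ, ℝ) (𝓡 2) 1 d :=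
      ((hψ.contMDiff hX).of_le (by simp)).comp (hτs.prodMk (hc.of_le (by simp)))
    exact h1.mdifferentiable (by simp)
  have hdv : ∀ r, vel d r = σ (c r) (X (c r)) (vel c r) • Y (d r) := by
    intro r
    have h0 : ∀ (L : EuclideanSpace ℝ (Fin 2) →L[ℝ] EuclideanSpace ℝ (Fin 2))
        (v p q p' q' : EuclideanSpace ℝ (Fin 2)) (a b : ℝ), v = a • p + b • q → L p = p' →
        L q = q' → -a • p' + L v = b • q' := by
      rintro L v p q p' q' a b rfl rfl rfl
      rw [map_add, map_smul, map_smul]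
      module
    exact (hψ.vel_comp hX (hcd r) (hτ r)).trans (h0 (mfderiv (𝓡 2) (𝓡 2) (ψ (τ r)) (c r)) _ _ _ _ _
      _ _ (hF.expand hσ (hcO r) (vel c r)) (hψ.mfderiv_field hX _ _) (hF.mfderiv_eq _ (hcO r) _))
  let z : ℝ → M := fun r ↦ η (n r) (d r)
  have hzv : ∀ r, vel z r = 0 := by
    intro r
    have h0 : ∀ (L : EuclideanSpace ℝ (Fin 2) →L[ℝ] EuclideanSpace ℝ (Fin 2))
        (v q q' : EuclideanSpace ℝ (Fin 2)) (b : ℝ), v = b • q → L q = q' →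
        -b • q' + L v = 0 := by
      rintro L v q q' b rfl rfl
      rw [map_smul]
      module
    exact (hη.vel_comp hY (hd r) (hn r)).trans (h0 (mfderiv (𝓡 2) (𝓡 2) (η (n r)) (d r)) _ _ _ _
      (hdv r) (hη.mfderiv_field hY _ _))
  have hns : ContMDiff 𝓘(ℝ, ℝ) 𝓘(ℝ, ℝ) ∞ n := by
    have : ContMDiff 𝓘(ℝ, ℝ) 𝓘(ℝ, ℝ) ∞ fun r ↦ H (c r) := hH.comp hc
    rw [contMDiff_iff_contDiff] at this ⊢
    exact (this.sub contDiff_const).neg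
  have hzd : MDifferentiable 𝓘(ℝ, ℝ) (𝓡 2) z := fun r ↦
    MDifferentiableAt.comp (g := fun y : ℝ × M ↦ η y.1 y.2) (f := fun r ↦ (n r, d r)) r
      ((hη.contMDiff hY).mdifferentiableAt (by simp))
      ((hns.mdifferentiableAt (by simp)).prodMk (hd r))
  have hfin := eq_of_vel_eq_zero hzd hzv ρ
  -- at both ends the two flow times are zero, so the point they are moved to is the point itself
  have e1 : n 0 = 0 := by simp [n]
  have e2 : n ρ = 0 := by
    simp only [n]
    rw [← hT, hψ.hamiltonian_eq hσ hH hHX, sub_self, neg_zero]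
  have e3 : τ 0 = 0 := by simp [τ]
  have e4 : τ ρ = 0 := by simp only [τ]; rw [hzero, neg_zero]
  simp only [z, d, e1, e2, e3, e4, hψ.zero, hη.zero] at hfin
  exact hne hfin

end Velocity

/-! ### Periodic functions on the strip -/

lemma integral_int_mul_of_periodic {f : ℝ → ℝ} (hf : Continuous f) {T : ℝ}
    (hp : Function.Periodic f T) (n : ℤ) :
    ∫ x in (0 : ℝ)..n * T, f x = n * ∫ x in (0 : ℝ)..T, f x := by
  have := hp.intervalIntegral_add_zsmul_eq n 0 (fun a b ↦ hf.intervalIntegrable a b)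
  simpa using this

/-- A function on the strip which is periodic in `p` differs from its average over the circles by
the `p`-derivative of a periodic function. -/
lemma exists_periodic_primitive {Q : ℝ × ℝ → ℝ} (hQ : ContDiffOn ℝ ∞ Q openStrip)
    (hper : ∀ q ∈ Ioo (0 : ℝ) 1, Function.Periodic (fun p ↦ Q (q, p)) 1) :
    ∃ R : ℝ × ℝ → ℝ, ContDiffOn ℝ ∞ R openStrip ∧
      (∀ q ∈ Ioo (0 : ℝ) 1, ∀ (p : ℝ) (n : ℤ), R (q, p + n) = R (q, p)) ∧
      ∀ z ∈ openStrip, fderiv ℝ R z (0, 1) = Q z - ∫ p in (0 : ℝ)..1, Q (z.1, p) := by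
  let R : ℝ × ℝ → ℝ := fun z ↦ z.2 * (∫ x in (0 : ℝ)..1, Q (z.1, z.2 * x)) -
    z.2 * ∫ p in (0 : ℝ)..1, Q (z.1, p)
  have hcont : ∀ q ∈ Ioo (0 : ℝ) 1, Continuous fun p ↦ Q (q, p) := fun q hq ↦
    hQ.continuousOn.comp_continuous (by fun_prop) fun p ↦ ⟨hq, trivial⟩
  have hR : ∀ q p, R (q, p) = (∫ x in (0 : ℝ)..p, Q (q, x)) - p * ∫ p in (0 : ℝ)..1, Q (q, p) := by
    intro q p
    simp only [R]
    rw [intervalIntegral.mul_integral_comp_mul_left (f := fun x ↦ Q (q, x))]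
    simp
  have hRs : ContDiffOn ℝ ∞ R openStrip := by
    have h1 : ContDiffOn ℝ ∞ (fun z : ℝ × ℝ ↦ ∫ x in (0 : ℝ)..1, Q (z.1, z.2 * x)) openStrip := by
      refine contDiffOn_integral_unitInterval (F := fun y : (ℝ × ℝ) × ℝ ↦ Q (y.1.1, y.1.2 * y.2))
        isOpen_openStrip ?_
      exact hQ.comp (f := fun y : (ℝ × ℝ) × ℝ ↦ (y.1.1, y.1.2 * y.2))
        (ContDiff.contDiffOn (by fun_prop)) fun y hy ↦ ⟨hy.1.1, trivial⟩
    have h2 : ContDiffOn ℝ ∞ (fun z : ℝ × ℝ ↦ ∫ p in (0 : ℝ)..1, Q (z.1, p)) openStrip := by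
      refine contDiffOn_integral_unitInterval (F := fun y : (ℝ × ℝ) × ℝ ↦ Q (y.1.1, y.2))
        isOpen_openStrip ?_
      exact hQ.comp (f := fun y : (ℝ × ℝ) × ℝ ↦ (y.1.1, y.2))
        (ContDiff.contDiffOn (by fun_prop)) fun y hy ↦ ⟨hy.1.1, trivial⟩
    exact (contDiff_snd.contDiffOn.mul h1).sub (contDiff_snd.contDiffOn.mul h2)
  refine ⟨R, hRs, ?_, ?_⟩
  · intro q hq p n
    have h1 : ∫ x in p..p + n, Q (q, x) = ∫ x in (0 : ℝ)..n, Q (q, x) := by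
      have := ((hper q hq).int_mul n).intervalIntegral_add_eq p 0
      simpa using this
    have h2 := integral_int_mul_of_periodic (hcont q hq) (hper q hq) n
    rw [mul_one] at h2
    rw [hR, hR, ← intervalIntegral.integral_add_adjacent_intervals (b := p)
      ((hcont q hq).intervalIntegrable _ _) ((hcont q hq).intervalIntegrable _ _), h1, h2]
    ring
  · rintro ⟨q, p⟩ ⟨hq, -⟩
    have h1 : HasDerivAt (fun p ↦ R (q, p)) (fderiv ℝ R (q, p) (0, 1)) p := by
      have hd : DifferentiableAt ℝ R (q, p) := (hRs.contDiffAt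
        (isOpen_openStrip.mem_nhds ⟨hq, trivial⟩)).differentiableAt (by simp)
      have := hd.hasFDerivAt.comp p (hasFDerivAt_prodMk_right q p)
      exact this.hasDerivAt.congr_deriv (by simp)
    have h2 : HasDerivAt (fun p ↦ R (q, p)) (Q (q, p) - 1 * ∫ p in (0 : ℝ)..1, Q (q, p)) p := by
      simp only [hR]
      exact ((hcont q hq).integral_hasStrictDerivAt 0 p).hasDerivAt.sub
        ((hasDerivAt_id p).mul_const _)
    rw [h1.unique h2, one_mul]

/-! ### The invariant 1-form along the circles of the collar -/

section CollarFlow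

variable {M : Type*} [TopologicalSpace M] [ChartedSpace (EuclideanSpace ℝ (Fin 2)) M]
  [T2Space M] [CompactSpace M] [IsManifold (𝓡 2) ∞ M] {m : ℕ} {S : Set M} {κ : Fin m → ℝ × ℝ → M}
  {X Y : ∀ x : M, TangentSpace (𝓡 2) x} {ψ : ℝ → M → M} {σ : BilinField M} {H : M → ℝ}
  {O : Set M} {i : Fin m} {c : ℝ}

omit [CompactSpace M] in
lemma IsFlow.eq_self_of_field_eq_zero (hψ : IsFlow X ψ) (hX : IsSmoothField X) {x : M}
    (hx : X x = 0) (t : ℝ) : ψ t x = x := by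
  refine (hψ.eq_of_isMIntegralCurve hX (γ := fun _ ↦ x) (fun t ↦ ?_) t).symm
  have h0 : ∀ v : EuclideanSpace ℝ (Fin 2), v = 0 → (0 : ℝ →L[ℝ] EuclideanSpace ℝ (Fin 2)) =
      (1 : ℝ →L[ℝ] ℝ).smulRight v := by
    rintro v rfl
    ext
    simp
  exact (hasMFDerivAt_const x t).congr_mfderiv (h0 _ hx)

lemma IsCollar.field_ne_zero (hκ : IsCollar S κ) (hX : IsSmoothField X) (hψ : IsFlow X ψ)
    (hrot : ∀ z ∈ openStrip, ψ 1 (κ i z) = κ i (z.1, z.2 + c)) (hc : ∀ n : ℤ, c ≠ n)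
    {z : ℝ × ℝ} (hz : z ∈ openStrip) : X (κ i z) ≠ 0 := by
  intro h0
  have h1 := hψ.eq_self_of_field_eq_zero hX h0 1
  rw [hrot z hz] at h1
  obtain ⟨-, n, hn⟩ := (hκ.eq_iff i z (openStrip_subset_strip hz) (z.1, z.2 + c)
    (openStrip_subset_strip ⟨hz.1, trivial⟩)).1 h1.symm
  exact hc n (by simpa using hn)

omit [CompactSpace M] in
lemma flow_nat_collar (hX : IsSmoothField X) (hψ : IsFlow X ψ)
    (hrot : ∀ z ∈ openStrip, ψ 1 (κ i z) = κ i (z.1, z.2 + c)) {z : ℝ × ℝ} (hz : z ∈ openStrip)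
    (n : ℕ) : ψ n (κ i z) = κ i (z.1, z.2 + n * c) := by
  induction n with
  | zero => simp [hψ.zero]
  | succ n ih =>
    push_cast
    rw [add_comm (n : ℝ) 1, hψ.add hX, ih, hrot (z.1, z.2 + n * c) ⟨hz.1, trivial⟩]
    congr 2
    ring

/-- The component along `∂_p` of the 1-form `σ(·, Y)`. -/
def circleDensity (σ : BilinField M) (Y : ∀ x : M, TangentSpace (𝓡 2) x) (k : ℝ × ℝ → M)
    (z : ℝ × ℝ) : ℝ :=
  σ (k z) (mfderiv 𝓘(ℝ, ℝ × ℝ) (𝓡 2) k z ((0, 1) : ℝ × ℝ)) (Y (k z))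

omit [T2Space M] [CompactSpace M] in
lemma IsCollar.contDiffOn_circleDensity (hκ : IsCollar S κ) (hσ : IsAreaForm σ)
    (hY : IsSmoothField Y) : ContDiffOn ℝ ∞ (circleDensity σ Y (κ i)) openStrip := by
  intro z hz
  refine ContDiffAt.contDiffWithinAt ?_
  rw [← contMDiffAt_iff_contDiffAt]
  exact hσ.contMDiffAt_apply
    (contMDiffAt_mfderiv_apply (hκ.contMDiffAt i hz) (contMDiff_const_field ((0, 1) : ℝ × ℝ) z))
    ((hY _).comp z (hκ.contMDiffAt i hz))

omit [T2Space M] [CompactSpace M] [IsManifold (𝓡 2) ∞ M] in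
lemma IsCollar.contMDiff_circle (hκ : IsCollar S κ) {q : ℝ} (hq : q ∈ Ioo (0 : ℝ) 1) :
    ContMDiff 𝓘(ℝ, ℝ) (𝓡 2) ∞ fun p ↦ κ i (q, p) := fun p ↦
  (hκ.contMDiffAt i (z := (q, p)) ⟨hq, trivial⟩).comp p
    (contDiff_prodMk_right q).contMDiff.contMDiffAt

omit [T2Space M] [CompactSpace M] in
lemma IsCollar.circleDensity_eq (hκ : IsCollar S κ) {q : ℝ} (hq : q ∈ Ioo (0 : ℝ) 1) (p : ℝ) :
    circleDensity σ Y (κ i) (q, p) =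
      σ (κ i (q, p)) (vel (fun p ↦ κ i (q, p)) p) (Y (κ i (q, p))) := by
  have := partialT_eq ((hκ.contMDiffAt i (z := (q, p)) ⟨hq, trivial⟩).mdifferentiableAt (by simp))
  exact congrArg (fun v ↦ σ (κ i (q, p)) v (Y (κ i (q, p)))) this

omit [T2Space M] [CompactSpace M] [IsManifold (𝓡 2) ∞ M] in
lemma form_vel_comp_add {k : ℝ → M} (hk : ContMDiff 𝓘(ℝ, ℝ) (𝓡 2) ∞ k) (a t : ℝ) :
    σ (k (t + a)) (vel (fun t ↦ k (t + a)) t) (Y (k (t + a))) =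
      σ (k (t + a)) (vel k (t + a)) (Y (k (t + a))) := by
  rw [vel_comp_add (hk.mdifferentiableAt (by simp))]

lemma IsCollar.periodic_circleDensity (hκ : IsCollar S κ) {q : ℝ} (hq : q ∈ Ioo (0 : ℝ) 1) :
    Function.Periodic (fun p ↦ circleDensity σ Y (κ i) (q, p)) 1 := by
  intro p
  have h1 : (fun p ↦ κ i (q, p + 1)) = fun p ↦ κ i (q, p) := by
    ext p
    simpa using hκ.add_int i (Ioo_subset_Icc_self hq) p 1
  have h2 := congrArg (fun k : ℝ → M ↦ σ (k p) (vel k p) (Y (k p))) h1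
  beta_reduce
  rw [hκ.circleDensity_eq hq, hκ.circleDensity_eq hq]
  exact (form_vel_comp_add (hκ.contMDiff_circle hq) 1 p).symm.trans h2

lemma IsCollar.periodic_circleDensity_rotation (hκ : IsCollar S κ) (hσ : IsAreaForm σ)
    (hX : IsSmoothField X) (hψ : IsFlow X ψ)
    (hrot : ∀ z ∈ openStrip, ψ 1 (κ i z) = κ i (z.1, z.2 + c))
    (hF : IsInvariantFrame σ X Y ψ O) {q : ℝ} (hq : q ∈ Ioo (0 : ℝ) 1)
    (hqO : ∀ p, κ i (q, p) ∈ O) :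
    Function.Periodic (fun p ↦ circleDensity σ Y (κ i) (q, p)) c := by
  intro p
  have h1 : (fun p ↦ κ i (q, p + c)) = fun p ↦ ψ 1 (κ i (q, p)) := by
    ext p
    exact (hrot (q, p) ⟨hq, trivial⟩).symm
  have h2 := congrArg (fun k : ℝ → M ↦ σ (k p) (vel k p) (Y (k p))) h1
  have hd : MDifferentiableAt 𝓘(ℝ, ℝ) (𝓡 2) (fun p ↦ κ i (q, p)) p :=
    (hκ.contMDiff_circle hq).mdifferentiableAt (by simp)
  have h3 : σ (ψ 1 (κ i (q, p))) (vel (fun p ↦ ψ 1 (κ i (q, p))) p) (Y (ψ 1 (κ i (q, p)))) =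
      σ (κ i (q, p)) (vel (fun p ↦ κ i (q, p)) p) (Y (κ i (q, p))) := by
    rw [vel_comp (c := fun p ↦ κ i (q, p)) (hψ.mdifferentiableAt_time hX 1 _) hd]
    exact hF.apply_flow hσ hX hψ (hqO p) 1 _
  beta_reduce
  rw [hκ.circleDensity_eq hq, hκ.circleDensity_eq hq]
  exact ((form_vel_comp_add (hκ.contMDiff_circle hq) c p).symm.trans h2).trans h3

/-- The integral of the 1-form `σ(·, Y)` over a circle of the collar is not zero. -/
theorem IsCollar.integral_circleDensity_ne_zero (hκ : IsCollar S κ) (hσ : IsAreaForm σ)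
    (hH : ContMDiff (𝓡 2) 𝓘(ℝ, ℝ) ∞ H)
    (hHX : ∀ (x : M) (v : TangentSpace (𝓡 2) x), mfderiv (𝓡 2) 𝓘(ℝ, ℝ) H x v = σ x (X x) v)
    (hX : IsSmoothField X) (hψ : IsFlow X ψ) (hY : IsSmoothField Y)
    (hrot : ∀ z ∈ openStrip, ψ 1 (κ i z) = κ i (z.1, z.2 + c)) (hc : ∀ n : ℤ, c ≠ n)
    {a : ℤ} {b : ℕ} (hb : 0 < b) (hbc : b * c = a)
    (hF : IsInvariantFrame σ X Y ψ O) {q : ℝ} (hq : q ∈ Ioo (0 : ℝ) 1)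
    (hqO : ∀ p, κ i (q, p) ∈ O) :
    ∫ p in (0 : ℝ)..1, circleDensity σ Y (κ i) (q, p) ≠ 0 := by
  intro h0
  have hcont : Continuous fun p ↦ circleDensity σ Y (κ i) (q, p) :=
    (hκ.contDiffOn_circleDensity hσ hY).continuousOn.comp_continuous (by fun_prop)
      fun p ↦ ⟨hq, trivial⟩
  -- the density has the periods `1` and `c`; over `b c = a` its integral is computed in both ways,
  -- so it vanishes also over `[0, c]`, the part of the circle from `(q, 0)` to `ψ_1(q, 0)`
  have h1 := integral_int_mul_of_periodic hcont (hκ.periodic_circleDensity hq) a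
  have h2 := integral_int_mul_of_periodic hcont
    (hκ.periodic_circleDensity_rotation hσ hX hψ hrot hF hq hqO) b
  rw [mul_one, h0, mul_zero] at h1
  rw [Int.cast_natCast, hbc, h1] at h2
  have h3 : ∫ p in (0 : ℝ)..c, circleDensity σ Y (κ i) (q, p) = 0 := by
    have : (b : ℝ) ≠ 0 := by positivity
    exact (mul_eq_zero.1 h2.symm).resolve_left this
  simp only [hκ.circleDensity_eq hq] at h3
  refine hF.integral_ne_zero hσ hH hHX hX hψ hY (hκ.contMDiff_circle hq) hqO (ρ := c) (T := 1)
    ?_ ?_ h3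
  · simpa using hrot (q, 0) ⟨hq, trivial⟩
  · intro h
    obtain ⟨-, n, hn⟩ := (hκ.eq_iff i (q, 0) ⟨Ioo_subset_Icc_self hq, trivial⟩ (q, c)
      ⟨Ioo_subset_Icc_self hq, trivial⟩).1 h.symm
    exact hc n (by simpa using hn)

end CollarFlow

/-! ### Vanishing of the weighted area swept out by the flow -/

lemma fderiv_snd_eq {F : ℝ × ℝ → ℝ} {q p d : ℝ} (hF : DifferentiableAt ℝ F (q, p))
    (h : HasDerivAt (fun p ↦ F (q, p)) d p) : fderiv ℝ F (q, p) (0, 1) = d := by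
  have h1 := (hF.hasFDerivAt.comp p (hasFDerivAt_prodMk_right q p)).hasDerivAt
  have h2 : HasDerivAt (fun p ↦ F (q, p)) (fderiv ℝ F (q, p) (0, 1)) p :=
    h1.congr_deriv (by simp)
  exact h2.unique h

section Weight

variable {M : Type*} [TopologicalSpace M] [ChartedSpace (EuclideanSpace ℝ (Fin 2)) M]
  {m : ℕ} {S : Set M} {κ : Fin m → ℝ × ℝ → M}
  {X Y : ∀ x : M, TangentSpace (𝓡 2) x} {ψ : ℝ → M → M} {σ : BilinField M} {H : M → ℝ}
  {O : Set M} {i : Fin m} {c : ℝ}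

lemma IsCollar.mfderiv_surjective (hκ : IsCollar S κ) {z : ℝ × ℝ} (hz : z ∈ openStrip)
    (v : TangentSpace (𝓡 2) (κ i z)) :
    ∃ ξ : ℝ × ℝ, mfderiv 𝓘(ℝ, ℝ × ℝ) (𝓡 2) (κ i) z ξ = v := by
  let L : ℝ × ℝ →ₗ[ℝ] EuclideanSpace ℝ (Fin 2) :=
    (mfderiv 𝓘(ℝ, ℝ × ℝ) (𝓡 2) (κ i) z : ℝ × ℝ →L[ℝ] EuclideanSpace ℝ (Fin 2)).toLinearMap
  have hL : Function.Surjective L :=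
    (LinearMap.injective_iff_surjective_of_finrank_eq_finrank (by simp)).1
      (hκ.mfderiv_injective i hz)
  exact hL v

lemma IsStandardFormOn.area_eq (hσκ : IsStandardFormOn κ σ) {z : ℝ × ℝ}
    (hz : z ∈ openStrip) (ξ ζ : ℝ × ℝ) :
    σ (κ i z) (mfderiv 𝓘(ℝ, ℝ × ℝ) (𝓡 2) (κ i) z ξ) (mfderiv 𝓘(ℝ, ℝ × ℝ) (𝓡 2) (κ i) z ζ) =
      ξ.1 * ζ.2 - ξ.2 * ζ.1 := by
  have := hσκ i z (openStrip_subset_strip hz) ξ ζ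
  rwa [stripDeriv_eq hz] at this

variable [IsManifold (𝓡 2) ∞ M]

lemma IsCollar.mfderiv_pushForward (hκ : IsCollar S κ) {F : ℝ × ℝ → ℝ}
    (hF : ∀ q p : ℝ, ∀ n : ℤ, F (q, p + n) = F (q, p)) {z : ℝ × ℝ} (hz : z ∈ openStrip)
    (hs : MDifferentiableAt (𝓡 2) 𝓘(ℝ, ℝ) (pushForward κ i F) (κ i z)) (ξ : ℝ × ℝ) :
    mfderiv (𝓡 2) 𝓘(ℝ, ℝ) (pushForward κ i F) (κ i z)
      (mfderiv 𝓘(ℝ, ℝ × ℝ) (𝓡 2) (κ i) z ξ) = fderiv ℝ F z ξ := by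
  have h1 : pushForward κ i F ∘ κ i =ᶠ[𝓝 z] F := by
    filter_upwards [isOpen_openStrip.mem_nhds hz] with w hw
    exact hκ.pushForward_apply i hF hw
  have h2 := HasMFDerivAt.comp z hs.hasMFDerivAt
    ((hκ.contMDiffAt i hz).mdifferentiableAt (by simp)).hasMFDerivAt
  have h3 := congrArg (fun L : ℝ × ℝ →L[ℝ] ℝ ↦ L ξ)
    (h2.mfderiv.symm.trans (h1.mfderiv_eq (I := 𝓘(ℝ, ℝ × ℝ)) (I' := 𝓘(ℝ, ℝ))))
  refine Eq.trans h3 ?_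
  rw [mfderiv_eq_fderiv]

omit [IsManifold (𝓡 2) ∞ M] in
/-- On a collar, `e · A · σ = A dk ∧ θ + dρ ∧ dk` for `k = q`, `A = A(q)`, `θ = σ(·, Y)` and
`∂_p ρ = A · (θ(∂_p) - e)`. -/
lemma IsCollar.weight_identity (hκ : IsCollar S κ) (hσκ : IsStandardFormOn κ σ) {z : ℝ × ℝ}
    (hz : z ∈ openStrip) {dA dk dρ : TangentSpace (𝓡 2) (κ i z) →L[ℝ] ℝ} {FA Fk Fρ : ℝ × ℝ → ℝ}
    {e : ℝ} (hA : ∀ ξ : ℝ × ℝ, dA (mfderiv 𝓘(ℝ, ℝ × ℝ) (𝓡 2) (κ i) z ξ) = fderiv ℝ FA z ξ)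
    (hk : ∀ ξ : ℝ × ℝ, dk (mfderiv 𝓘(ℝ, ℝ × ℝ) (𝓡 2) (κ i) z ξ) = fderiv ℝ Fk z ξ)
    (hρ : ∀ ξ : ℝ × ℝ, dρ (mfderiv 𝓘(ℝ, ℝ × ℝ) (𝓡 2) (κ i) z ξ) = fderiv ℝ Fρ z ξ)
    (hFA : fderiv ℝ FA z (0, 1) = 0) (hFk : ∀ ξ, fderiv ℝ Fk z ξ = ξ.1)
    (hFρ : fderiv ℝ Fρ z (0, 1) = FA z * (circleDensity σ Y (κ i) z - e))
    (v w : TangentSpace (𝓡 2) (κ i z)) :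
    FA z * e * σ (κ i z) v w = FA z * dk v * σ (κ i z) w (Y (κ i z)) -
        FA z * dk w * σ (κ i z) v (Y (κ i z)) + (dρ v * dk w - dρ w * dk v) ∧
      dA v * dk w = dA w * dk v := by
  obtain ⟨ξ, hξ⟩ := hκ.mfderiv_surjective hz v
  obtain ⟨ζ, hζ⟩ := hκ.mfderiv_surjective hz w
  have hdec : ∀ ξ : ℝ × ℝ, ξ = ξ.1 • ((1, 0) : ℝ × ℝ) + ξ.2 • ((0, 1) : ℝ × ℝ) := by
    intro ξ
    ext <;> simp
  have hlin : ∀ (L : ℝ × ℝ →L[ℝ] ℝ) (ξ : ℝ × ℝ), L ξ = ξ.1 * L (1, 0) + ξ.2 * L (0, 1) := by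
    intro L ξ
    conv_lhs => rw [hdec ξ, map_add, map_smul, map_smul]
    rfl
  have hlin' : ∀ (L : ℝ × ℝ →L[ℝ] EuclideanSpace ℝ (Fin 2))
      (B : EuclideanSpace ℝ (Fin 2) →L[ℝ] EuclideanSpace ℝ (Fin 2) →L[ℝ] ℝ)
      (y : EuclideanSpace ℝ (Fin 2)) (ξ : ℝ × ℝ),
      B (L ξ) y = ξ.1 * B (L (1, 0)) y + ξ.2 * B (L (0, 1)) y := fun L B y ξ ↦
    hlin ((B.flip y).comp L) ξ
  set P := σ (κ i z) (mfderiv 𝓘(ℝ, ℝ × ℝ) (𝓡 2) (κ i) z ((1, 0) : ℝ × ℝ)) (Y (κ i z)) with hP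
  have hval : ∀ (v : TangentSpace (𝓡 2) (κ i z)) (ξ : ℝ × ℝ),
      mfderiv 𝓘(ℝ, ℝ × ℝ) (𝓡 2) (κ i) z ξ = v → dA v = ξ.1 * fderiv ℝ FA z (1, 0) ∧ dk v = ξ.1 ∧
      dρ v = ξ.1 * fderiv ℝ Fρ z (1, 0) + ξ.2 * (FA z * (circleDensity σ Y (κ i) z - e)) ∧
      σ (κ i z) v (Y (κ i z)) = ξ.1 * P + ξ.2 * circleDensity σ Y (κ i) z := by
    rintro _ ξ rfl
    refine ⟨(hA ξ).trans ?_, (hk ξ).trans (hFk ξ), (hρ ξ).trans ?_,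
      hlin' (mfderiv 𝓘(ℝ, ℝ × ℝ) (𝓡 2) (κ i) z) (σ (κ i z)) (Y (κ i z)) ξ⟩
    · rw [hlin, hFA, mul_zero, add_zero]
    · rw [hlin, hFρ]
  obtain ⟨v1, v2, v3, v4⟩ := hval v ξ hξ
  obtain ⟨w1, w2, w3, w4⟩ := hval w ζ hζ
  have harea : σ (κ i z) v w = ξ.1 * ζ.2 - ξ.2 * ζ.1 := by
    rw [← hξ, ← hζ]
    exact hσκ.area_eq hz ξ ζ
  rw [v1, v2, v3, v4, w1, w2, w3, w4, harea]
  constructor <;> ring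

omit [IsManifold (𝓡 2) ∞ M] in
lemma fderiv_comp_map {f : M → ℝ} (hf : ContMDiff (𝓡 2) 𝓘(ℝ, ℝ) ∞ f) {w : ℝ × ℝ → M}
    (hw : ContMDiff 𝓘(ℝ, ℝ × ℝ) (𝓡 2) ∞ w) (z v : ℝ × ℝ) :
    fderiv ℝ (fun z ↦ f (w z)) z v =
      mfderiv (𝓡 2) 𝓘(ℝ, ℝ) f (w z) (mfderiv 𝓘(ℝ, ℝ × ℝ) (𝓡 2) w z v) := by
  have h := (HasMFDerivAt.comp z (hf.mdifferentiableAt (x := w z) (by simp)).hasMFDerivAt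
    (hw.mdifferentiableAt (x := z) (by simp)).hasMFDerivAt).mfderiv
  have h1 := congrArg (fun L : ℝ × ℝ →L[ℝ] ℝ ↦ L v) h
  refine Eq.trans ?_ h1
  rw [mfderiv_eq_fderiv]
  rfl

variable [T2Space M] [CompactSpace M]

lemma partialT_flowSquare (hX : IsSmoothField X) (hψ : IsFlow X ψ) {γ : ℝ → M}
    (hγ : ContMDiff 𝓘(ℝ, ℝ) (𝓡 2) ∞ γ) (s t : ℝ) :
    partialT (flowSquare ψ γ) (s, t) =
      -deriv smoothStep t • X (flowSquare ψ γ (s, t)) := by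
  rw [partialT_eq ((contMDiff_flowSquare hX hψ hγ).mdifferentiableAt (by simp))]
  have h1 : HasDerivAt (fun t ↦ -smoothStep t) (-deriv smoothStep t) t :=
    (contDiff_smoothStep.differentiable (by simp) t).hasDerivAt.neg
  have h2 := hψ.vel_comp hX (c := fun _ ↦ γ s) (mdifferentiableAt_const) h1
  have h3 : vel (fun _ : ℝ ↦ γ s) t = 0 := vel_eq (hasMFDerivAt_const (γ s) t)
  rw [h3, map_zero, add_zero] at h2
  exact h2

lemma partialS_flowSquare (hX : IsSmoothField X) (hψ : IsFlow X ψ) {γ : ℝ → M}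
    (hγ : ContMDiff 𝓘(ℝ, ℝ) (𝓡 2) ∞ γ) (s t : ℝ) :
    partialS (flowSquare ψ γ) (s, t) =
      mfderiv (𝓡 2) (𝓡 2) (ψ (-smoothStep t)) (γ s) (vel γ s) := by
  rw [partialS_eq ((contMDiff_flowSquare hX hψ hγ).mdifferentiableAt (by simp))]
  exact vel_comp (c := γ) (t := s) (g := ψ (-smoothStep t)) 
    (hψ.mdifferentiableAt_time hX _ _) (hγ.mdifferentiableAt (by simp))

end Weight

section Vanishing

variable {M : Type*} [TopologicalSpace M] [ChartedSpace (EuclideanSpace ℝ (Fin 2)) M]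
  [T2Space M] [CompactSpace M] [IsManifold (𝓡 2) ∞ M]
  {m : ℕ} {S : Set M} {κ : Fin m → ℝ × ℝ → M}
  {X Y : ∀ x : M, TangentSpace (𝓡 2) x} {ψ : ℝ → M → M} {σ : BilinField M} {H : M → ℝ}
  {O : Set M} {i : Fin m} {c : ℝ}

/-- The weighted area swept out by the backward flow of `γ` is zero for a weight as in
`IsCollar.weight_identity`: the 2-form given there has the shape required in
`integral_square_eq_zero`. -/
theorem IsCollar.integral_sweepRate_eq_zero (hκ : IsCollar S κ) (hσ : IsAreaForm σ)
    (hσκ : IsStandardFormOn κ σ) (hX : IsSmoothField X) (hψ : IsFlow X ψ)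
    (hrot : ∀ z ∈ openStrip, ψ 1 (κ i z) = κ i (z.1, z.2 + c))
    (hF : IsInvariantFrame σ X Y ψ O) {Q : Set ℝ} (hQc : IsCompact Q) (hQ : Q ⊆ Ioo 0 1)
    (hO : κ i '' (Q ×ˢ univ) ⊆ O) {FA Fk Fρ : ℝ × ℝ → ℝ} {e : ℝ → ℝ}
    (hFA : ∀ q p : ℝ, ∀ n : ℤ, FA (q, p + n) = FA (q, p))
    (hFk : ∀ q p : ℝ, ∀ n : ℤ, Fk (q, p + n) = Fk (q, p))
    (hFρ : ∀ q p : ℝ, ∀ n : ℤ, Fρ (q, p + n) = Fρ (q, p))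
    (hA : ContMDiff (𝓡 2) 𝓘(ℝ, ℝ) ∞ (pushForward κ i FA))
    (hk : ContMDiff (𝓡 2) 𝓘(ℝ, ℝ) ∞ (pushForward κ i Fk))
    (hρ : ContMDiff (𝓡 2) 𝓘(ℝ, ℝ) ∞ (pushForward κ i Fρ))
    (hA0 : ∀ z : ℝ × ℝ, z.1 ∉ Q → FA z = 0) (hρ0 : ∀ z : ℝ × ℝ, z.1 ∉ Q → Fρ z = 0)
    (hdA : ∀ z ∈ openStrip, z.1 ∈ Q → fderiv ℝ FA z (0, 1) = 0)
    (hdk : ∀ z ∈ openStrip, z.1 ∈ Q → ∀ ξ, fderiv ℝ Fk z ξ = ξ.1)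
    (hdρ : ∀ z ∈ openStrip, z.1 ∈ Q →
      fderiv ℝ Fρ z (0, 1) = FA z * (circleDensity σ Y (κ i) z - e z.1))
    {γ : ℝ → M} (hγ : ContMDiff 𝓘(ℝ, ℝ) (𝓡 2) ∞ γ) (hγQ : ∀ s, γ s ∉ κ i '' (Q ×ˢ univ))
    (h0 : ∀ t, ψ t (γ 0) = γ 0) (h1 : ∀ t, ψ t (γ 1) = γ 1) :
    ∫ s in (0 : ℝ)..1,
      sweepRate σ (pushForward κ i fun z ↦ FA z * e z.1) (flowSquare ψ γ) s = 0 := by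
  set w := flowSquare ψ γ with hw
  have hws := contMDiff_flowSquare hX hψ hγ
  have hQ' : Q ⊆ Icc 0 1 := hQ.trans Ioo_subset_Icc_self
  have hcl : IsClosed (κ i '' (Q ×ˢ univ)) := (hκ.isCompact_image i hQ' hQc).isClosed
  have hFg : ∀ q p : ℝ, ∀ n : ℤ, FA (q, p + n) * e q = FA (q, p) * e q := fun q p n ↦ by
    rw [hFA]
  have hg0 : ∀ z : ℝ × ℝ, z.1 ∉ Q → FA z * e z.1 = 0 := fun z hz ↦ by rw [hA0 z hz, zero_mul]
  -- the square avoids the support of the weight on its boundary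
  have hbd0 : ∀ s, w (s, 0) ∉ κ i '' (Q ×ˢ univ) := by
    intro s
    rw [hw, flowSquare, smoothStep_of_le (by norm_num), neg_zero, hψ.zero]
    exact hγQ s
  have hbd1 : ∀ s, w (s, 1) ∉ κ i '' (Q ×ˢ univ) := by
    rintro s ⟨z, hz, h⟩
    rw [hw, flowSquare, smoothStep_of_ge (by norm_num)] at h
    have h2 := congrArg (ψ 1) h
    rw [hψ.cancel_neg hX, hrot z ⟨hQ hz.1, trivial⟩] at h2
    exact hγQ s ⟨(z.1, z.2 + c), ⟨hz.1, trivial⟩, h2⟩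
  have hbd2 : ∀ t, w (0, t) ∉ κ i '' (Q ×ˢ univ) := by
    intro t
    rw [hw, flowSquare, h0]
    exact hγQ 0
  have hbd3 : ∀ t, w (1, t) ∉ κ i '' (Q ×ˢ univ) := by
    intro t
    rw [hw, flowSquare, h1]
    exact hγQ 1
  have hpA : ∀ {x}, x ∉ κ i '' (Q ×ˢ univ) → pushForward κ i FA x = 0 := fun hx ↦
    hκ.pushForward_eq_zero i hFA hA0 hx
  have hpρ : ∀ {x}, x ∉ κ i '' (Q ×ˢ univ) → pushForward κ i Fρ x = 0 := fun hx ↦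
    hκ.pushForward_eq_zero i hFρ hρ0 hx
  have hpg : ∀ {x}, x ∉ κ i '' (Q ×ˢ univ) → pushForward κ i (fun z ↦ FA z * e z.1) x = 0 :=
    fun hx ↦ hκ.pushForward_eq_zero i hFg hg0 hx
  have hcd : ∀ {f : M → ℝ}, ContMDiff (𝓡 2) 𝓘(ℝ, ℝ) ∞ f → ContDiff ℝ ∞ fun z ↦ f (w z) :=
    fun hf ↦ contMDiff_iff_contDiff.1 (hf.comp hws)
  have hzero : ∀ {f : M → ℝ}, (∀ {x}, x ∉ κ i '' (Q ×ˢ univ) → f x = 0) → ∀ z,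
      w z ∉ κ i '' (Q ×ˢ univ) → fderiv ℝ (fun z ↦ f (w z)) z = 0 := by
    intro f hf z hz
    have : (fun z ↦ f (w z)) =ᶠ[𝓝 z] fun _ ↦ (0 : ℝ) := by
      filter_upwards [(hcl.isOpen_compl.preimage hws.continuous).mem_nhds hz] with y hy
      exact hf hy
    rw [this.fderiv_eq]
    simp
  let d : (ℝ × ℝ → ℝ) → ∀ x : M, TangentSpace (𝓡 2) x →L[ℝ] ℝ := fun F x ↦
    mfderiv (𝓡 2) 𝓘(ℝ, ℝ) (pushForward κ i F) x
  have hid : ∀ x ∈ κ i '' (Q ×ˢ univ), ∀ v u : TangentSpace (𝓡 2) x,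
      pushForward κ i (fun z ↦ FA z * e z.1) x * σ x v u =
        pushForward κ i FA x * d Fk x v * σ x u (Y x) -
        pushForward κ i FA x * d Fk x u * σ x v (Y x) +
        (d Fρ x v * d Fk x u - d Fρ x u * d Fk x v) ∧
        d FA x v * d Fk x u = d FA x u * d Fk x v := by
    rintro _ ⟨z, hz, rfl⟩ v u
    have hz' : z ∈ openStrip := ⟨hQ hz.1, trivial⟩
    rw [hκ.pushForward_apply i hFg hz', hκ.pushForward_apply i hFA hz']
    exact hκ.weight_identity hσκ hz'
      (hκ.mfderiv_pushForward hFA hz' (hA.mdifferentiableAt (by simp)))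
      (hκ.mfderiv_pushForward hFk hz' (hk.mdifferentiableAt (by simp)))
      (hκ.mfderiv_pushForward hFρ hz' (hρ.mdifferentiableAt (by simp)))
      (hdA z hz' hz.1) (hdk z hz' hz.1) (hdρ z hz' hz.1) v u
  have hd : ∀ {F : ℝ × ℝ → ℝ}, ContMDiff (𝓡 2) 𝓘(ℝ, ℝ) ∞ (pushForward κ i F) → ∀ z,
      fderiv ℝ (fun z ↦ pushForward κ i F (w z)) z (0, 1) = d F (w z) (partialT w z) ∧
      fderiv ℝ (fun z ↦ pushForward κ i F (w z)) z (1, 0) = d F (w z) (partialS w z) :=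
    fun hF z ↦ ⟨fderiv_comp_map hF hws z (0, 1), fderiv_comp_map hF hws z (1, 0)⟩
  refine integral_square_eq_zero (G := fun z ↦ pushForward κ i (fun z ↦ FA z * e z.1) (w z) *
      areaDensity σ w z) (α := fun s ↦ σ (γ s) (vel γ s) (Y (γ s))) (β := deriv smoothStep)
    (hcd hA) (hcd hρ) (hcd hk) (contDiff_smoothStep.continuous_deriv (by simp)) ?_
    (fun s ↦ ⟨hpA (hbd0 s), hpA (hbd1 s)⟩) (fun t ↦ ⟨hpA (hbd2 t), hpA (hbd3 t)⟩)
    (fun s ↦ ⟨hpρ (hbd0 s), hpρ (hbd1 s)⟩) (fun t ↦ ⟨hpρ (hbd2 t), hpρ (hbd3 t)⟩) ?_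
  · intro z
    by_cases hz : w z ∈ κ i '' (Q ×ˢ univ)
    · rw [(hd hA z).1, (hd hA z).2, (hd hk z).1, (hd hk z).2]
      exact (hid _ hz _ _).2
    · rw [hzero hpA z hz]
      simp
  · intro s t
    by_cases hz : w (s, t) ∈ κ i '' (Q ×ˢ univ)
    · have hwO : w (s, t) ∈ O := hO hz
      have hγO : γ s ∈ O := by
        have := hF.flow_mem _ hwO (smoothStep t)
        rwa [hw, flowSquare, hψ.cancel_neg hX] at this
      have hS : σ (w (s, t)) (partialS w (s, t)) (Y (w (s, t))) =
          σ (γ s) (vel γ s) (Y (γ s)) := by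
        rw [hw, partialS_flowSquare hX hψ hγ]
        exact hF.apply_flow hσ hX hψ hγO _ _
      have hT : σ (w (s, t)) (partialT w (s, t)) (Y (w (s, t))) = -deriv smoothStep t := by
        have h0 : ∀ (B : EuclideanSpace ℝ (Fin 2) →L[ℝ] EuclideanSpace ℝ (Fin 2) →L[ℝ] ℝ)
            (v x y : EuclideanSpace ℝ (Fin 2)) (a : ℝ), v = a • x → B x y = 1 → B v y = a := by
          rintro B v x y a rfl h
          simp [h]
        exact h0 (σ (w (s, t))) _ _ _ _ (partialT_flowSquare hX hψ hγ s t)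
          (hF.apply_eq_one _ hwO)
      rw [(hd hk _).1, (hd hk _).2, (hd hρ _).1, (hd hρ _).2]
      refine ((hid _ hz (partialT w (s, t)) (partialS w (s, t))).1).trans ?_
      rw [hS, hT]
      ring
    · rw [hzero hpρ _ hz, hpA hz, hpg hz]
      simp

end Vanishing

/-- A continuous function with the period `1` and an irrational period is constant. -/
lemma eq_of_periodic_of_irrational {f : ℝ → ℝ} (hf : Continuous f) {c : ℝ} (hc : Irrational c)
    (h1 : Function.Periodic f 1) (h2 : Function.Periodic f c) (p : ℝ) : f p = f 0 := by
  have hd : Dense ((AddSubgroup.closure {c, 1} : AddSubgroup ℝ) : Set ℝ) :=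
    dense_addSubgroupClosure_pair_iff.2 (by simpa using hc)
  have hcl : IsClosed {x | f x = f 0} := isClosed_eq hf continuous_const
  have hsub : ((AddSubgroup.closure {c, 1} : AddSubgroup ℝ) : Set ℝ) ⊆ {x | f x = f 0} := by
    intro x hx
    obtain ⟨m, n, rfl⟩ := AddSubgroup.mem_closure_pair.1 hx
    have e1 := (h2.zsmul m) 0
    have e2 := (h1.zsmul n) (m • c)
    rw [mem_ofPred_eq, e2]
    simpa using e1
  exact hcl.closure_subset_iff.2 hsub (hd p)

section Vanishing

variable {M : Type*} [TopologicalSpace M] [ChartedSpace (EuclideanSpace ℝ (Fin 2)) M]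
  [T2Space M] [CompactSpace M] [IsManifold (𝓡 2) ∞ M]
  {m : ℕ} {S : Set M} {κ : Fin m → ℝ × ℝ → M}
  {X Y : ∀ x : M, TangentSpace (𝓡 2) x} {ψ : ℝ → M → M} {σ : BilinField M} {H : M → ℝ}
  {O : Set M} {i : Fin m} {c : ℝ}

omit [CompactSpace M] in
/-- If `H` is constant on the circles of the collar, then these are invariant under the flow. -/
lemma IsCollar.flow_mem_circle (hκ : IsCollar S κ) (hσ : IsAreaForm σ)
    (hσκ : IsStandardFormOn κ σ) (hH : ContMDiff (𝓡 2) 𝓘(ℝ, ℝ) ∞ H)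
    (hHX : ∀ (x : M) (v : TangentSpace (𝓡 2) x), mfderiv (𝓡 2) 𝓘(ℝ, ℝ) H x v = σ x (X x) v)
    (hX : IsSmoothField X) (hψ : IsFlow X ψ)
    (hconst : ∀ q ∈ Ioo (0 : ℝ) 1, ∀ p, H (κ i (q, p)) = H (κ i (q, 0))) {z : ℝ × ℝ}
    (hz : z ∈ openStrip) (t : ℝ) : ψ t (κ i z) ∈ κ i '' ({z.1} ×ˢ univ) := by
  let G : ℝ × ℝ → ℝ := fun z ↦ H (κ i z)
  have hGs : ContDiffOn ℝ ∞ G openStrip := fun w hw ↦ by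
    refine ContDiffAt.contDiffWithinAt ?_
    rw [← contMDiffAt_iff_contDiffAt]
    exact (hH _).comp w (hκ.contMDiffAt i hw)
  have hGd : ∀ w ∈ openStrip, DifferentiableAt ℝ G w := fun w hw ↦
    (hGs.contDiffAt (isOpen_openStrip.mem_nhds hw)).differentiableAt (by simp)
  obtain ⟨q, p⟩ := z
  have hq : q ∈ Ioo (0 : ℝ) 1 := hz.1
  let a : ℝ := deriv (fun q ↦ G (q, 0)) q
  -- the field is `-a ∂_p`
  have hfield : ∀ p, X (κ i (q, p)) =
      mfderiv 𝓘(ℝ, ℝ × ℝ) (𝓡 2) (κ i) (q, p) ((0, -a) : ℝ × ℝ) := by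
    intro p
    have hqp : (q, p) ∈ openStrip := ⟨hq, trivial⟩
    have d1 : fderiv ℝ G (q, p) (0, 1) = 0 := by
      refine fderiv_snd_eq (hGd _ hqp) ?_
      have : (fun p ↦ G (q, p)) = fun _ ↦ G (q, 0) := funext fun p ↦ hconst q hq p
      rw [this]
      exact hasDerivAt_const p _
    have d2 : fderiv ℝ G (q, p) (1, 0) = a := by
      have h1 := ((hGd _ hqp).hasFDerivAt.comp q (hasFDerivAt_prodMk_left q p)).hasDerivAt
      have h2 : HasDerivAt (fun q ↦ G (q, p)) (fderiv ℝ G (q, p) (1, 0)) q :=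
        h1.congr_deriv (by simp)
      have h3 : (fun q ↦ G (q, p)) =ᶠ[𝓝 q] fun q ↦ G (q, 0) := by
        filter_upwards [isOpen_Ioo.mem_nhds hq] with q' hq'
        exact hconst q' hq' p
      rw [← h2.deriv, h3.deriv_eq]
    have hdiff : ∀ v : TangentSpace (𝓡 2) (κ i (q, p)), σ (κ i (q, p)) (X (κ i (q, p))) v =
        σ (κ i (q, p)) (mfderiv 𝓘(ℝ, ℝ × ℝ) (𝓡 2) (κ i) (q, p) ((0, -a) : ℝ × ℝ)) v := by
      intro v
      obtain ⟨ξ, hξ⟩ := hκ.mfderiv_surjective hqp v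
      have e1 : mfderiv (𝓡 2) 𝓘(ℝ, ℝ) H (κ i (q, p)) v = fderiv ℝ G (q, p) ξ := by
        rw [← hξ]
        have h2 := HasMFDerivAt.comp (q, p) (hH.mdifferentiableAt (x := κ i (q, p))
          (by simp)).hasMFDerivAt ((hκ.contMDiffAt i hqp).mdifferentiableAt (by simp)).hasMFDerivAt
        have h3 := congrArg (fun L : ℝ × ℝ →L[ℝ] ℝ ↦ L ξ) h2.mfderiv
        refine Eq.trans h3.symm ?_
        rw [mfderiv_eq_fderiv]
        rfl
      have e2 : fderiv ℝ G (q, p) ξ = a * ξ.1 := by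
        have : ξ = ξ.1 • ((1, 0) : ℝ × ℝ) + ξ.2 • ((0, 1) : ℝ × ℝ) := by ext <;> simp
        conv_lhs => rw [this, map_add, map_smul, map_smul, d1, d2]
        simp [mul_comm]
      have e3 : σ (κ i (q, p)) (mfderiv 𝓘(ℝ, ℝ × ℝ) (𝓡 2) (κ i) (q, p) ((0, -a) : ℝ × ℝ)) v =
          a * ξ.1 := by
        rw [← hξ]
        refine (hσκ.area_eq hqp (0, -a) ξ).trans ?_
        simp
      rw [← hHX, e1, e2, e3]
    by_contra hne
    obtain ⟨v, hv⟩ := hσ.nondegenerate _ _ (sub_ne_zero.2 hne)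
    refine hv ?_
    rw [map_sub, sub_apply, hdiff v, sub_self]
  have hcurve : IsMIntegralCurve (I := 𝓡 2) (fun t ↦ κ i (q, p - a * t)) X := by
    intro t
    have h1 : HasFDerivAt (fun t : ℝ ↦ ((q, p - a * t) : ℝ × ℝ))
        ((1 : ℝ →L[ℝ] ℝ).smulRight ((0, -a) : ℝ × ℝ)) t := by
      have : HasDerivAt (fun t : ℝ ↦ ((q, p - a * t) : ℝ × ℝ)) (0, -a) t := by
        refine (hasDerivAt_const t q).prodMk ?_
        simpa using ((hasDerivAt_id t).const_mul a).const_sub p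
      exact this.hasFDerivAt
    have h2 := HasMFDerivAt.comp t ((hκ.contMDiffAt i (z := (q, p - a * t))
      ⟨hq, trivial⟩).mdifferentiableAt (by simp)).hasMFDerivAt h1.hasMFDerivAt
    have h3 : ∀ (L : ℝ × ℝ →L[ℝ] EuclideanSpace ℝ (Fin 2)) (v : ℝ × ℝ)
        (x : EuclideanSpace ℝ (Fin 2)), x = L v →
        L.comp ((1 : ℝ →L[ℝ] ℝ).smulRight v) = (1 : ℝ →L[ℝ] ℝ).smulRight x := by
      rintro L v x rfl
      ext1
      simp
    exact h2.congr_mfderiv (h3 _ _ _ (hfield (p - a * t)))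
  have := hψ.eq_of_isMIntegralCurve hX hcurve t
  simp only [mul_zero, sub_zero] at this
  rw [← this]
  exact ⟨(q, p - a * t), ⟨rfl, trivial⟩, rfl⟩

/-- Around every interior circle of the collar there is a weight for which the backward flow of a
path sweeps out no area, provided that the path does not meet the support of the weight. -/
theorem IsCollar.exists_weight (hκ : IsCollar S κ) (hσ : IsAreaForm σ)
    (hσκ : IsStandardFormOn κ σ) (hH : ContMDiff (𝓡 2) 𝓘(ℝ, ℝ) ∞ H)
    (hHX : ∀ (x : M) (v : TangentSpace (𝓡 2) x), mfderiv (𝓡 2) 𝓘(ℝ, ℝ) H x v = σ x (X x) v)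
    (hX : IsSmoothField X) (hψ : IsFlow X ψ) {J : ℝ → EndField M} (hJ : IsSmoothPath J)
    (hcomp : IsCompatible σ (J 0)) (hrot : ∀ z ∈ openStrip, ψ 1 (κ i z) = κ i (z.1, z.2 + c))
    (hc : ∀ n : ℤ, c ≠ n) {q₀ : ℝ} (hq₀ : q₀ ∈ Ioo (0 : ℝ) 1) :
    ∃ (h : ℝ → ℝ) (a b : ℝ), 0 < a ∧ b < 1 ∧ ContDiffOn ℝ ∞ h (Ioo 0 1) ∧ (∀ q, 0 ≤ h q) ∧
      (∀ q ∉ Icc a b, h q = 0) ∧ 0 < h q₀ ∧ ∀ γ : ℝ → M, ContMDiff 𝓘(ℝ, ℝ) (𝓡 2) ∞ γ →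
        (∀ s, γ s ∉ κ i '' (Icc a b ×ˢ univ)) → (∀ t, ψ t (γ 0) = γ 0) →
        (∀ t, ψ t (γ 1) = γ 1) →
        ∫ s in (0 : ℝ)..1, sweepRate σ (pushForward κ i fun z ↦ h z.1) (flowSquare ψ γ) s = 0 := by
  obtain ⟨r, hr, hr0, hr1⟩ : ∃ r > 0, 4 * r < q₀ ∧ q₀ + 4 * r < 1 := by
    refine ⟨min q₀ (1 - q₀) / 8, ?_, ?_, ?_⟩
    · have := lt_min hq₀.1 (sub_pos.2 hq₀.2)
      positivity
    · linarith [min_le_left q₀ (1 - q₀), hq₀.1]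
    · linarith [min_le_right q₀ (1 - q₀), hq₀.2]
  let f : ContDiffBump q₀ := ⟨r, 2 * r, hr, by linarith⟩
  have hf0 : ∀ q ∉ Icc (q₀ - 2 * r) (q₀ + 2 * r), f q = 0 := by
    intro q hq
    refine f.zero_of_le_dist ?_
    by_contra hlt
    rw [not_le, Real.dist_eq, abs_lt] at hlt
    exact hq ⟨by linarith [hlt.1], by linarith [hlt.2]⟩
  have hfq : f q₀ = 1 := f.one_of_mem_closedBall (Metric.mem_closedBall_self hr.le)
  have hIcc : Icc (q₀ - 2 * r) (q₀ + 2 * r) ⊆ Ioo 0 1 := fun q hq ↦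
    ⟨by linarith [hq.1], by linarith [hq.2]⟩
  have ha : 0 < q₀ - 2 * r := by linarith
  have hb : q₀ + 2 * r < 1 := by linarith
  -- for an irrational rotation the flow preserves the circles, and any weight will do
  by_cases hirr : Irrational c
  · refine ⟨f, q₀ - 2 * r, q₀ + 2 * r, ha, hb, f.contDiff.contDiffOn, fun q ↦ f.nonneg, hf0,
      by rw [hfq]; norm_num, fun γ hγ hγQ _ _ ↦ ?_⟩
    have hconst : ∀ q ∈ Ioo (0 : ℝ) 1, ∀ p, H (κ i (q, p)) = H (κ i (q, 0)) := by
      intro q hq p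
      refine eq_of_periodic_of_irrational (f := fun p ↦ H (κ i (q, p)))
        (hH.continuous.comp (hκ.contMDiff_circle hq).continuous) hirr (fun p ↦ ?_) (fun p ↦ ?_) p
      · have := hκ.add_int i (Ioo_subset_Icc_self hq) p 1
        rw [Int.cast_one] at this
        beta_reduce
        rw [this]
      · have := hrot (q, p) ⟨hq, trivial⟩
        beta_reduce
        rw [← this, hψ.hamiltonian_eq hσ hH hHX]
    have hzero : ∀ z, pushForward κ i (fun z ↦ f z.1) (flowSquare ψ γ z) = 0 := by
      intro z
      refine hκ.pushForward_eq_zero i (fun _ _ _ ↦ rfl) (fun w hw ↦ hf0 _ hw) ?_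
      rintro ⟨w, hw, h⟩
      have h1 := hκ.flow_mem_circle hσ hσκ hH hHX hX hψ hconst (z := w) ⟨hIcc hw.1, trivial⟩
        (smoothStep z.2)
      rw [h, flowSquare, hψ.cancel_neg hX] at h1
      exact hγQ z.1 (image_mono (prod_mono_left (singleton_subset_iff.2 hw.1)) h1)
    simp [sweepRate, hzero]
  · obtain ⟨x, hx⟩ := not_not.1 hirr
    have hbc : (x.den : ℝ) * c = x.num := by
      rw [← hx]
      exact_mod_cast Rat.den_mul_eq_num x
    have hQ' : Icc (q₀ - 2 * r) (q₀ + 2 * r) ⊆ Icc 0 1 := hIcc.trans Ioo_subset_Icc_self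
    obtain ⟨Y, O, hY, hKO, hF⟩ := exists_invariant_field hσ hH hHX hX hψ hJ hcomp
      (K := κ i '' (Icc (q₀ - 2 * r) (q₀ + 2 * r) ×ˢ univ)) (A := κ i '' openStrip)
      (hκ.isCompact_image i hQ' isCompact_Icc) (hκ.isOpen_image i isOpen_openStrip le_rfl)
      (image_mono (prod_mono_left hIcc)) (b := x.den) (mod_cast x.den_pos)
      (by
        rintro _ ⟨z, hz, rfl⟩
        rw [flow_nat_collar hX hψ hrot hz, hbc]
        exact hκ.add_int i (Ioo_subset_Icc_self hz.1) z.2 x.num)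
      (by
        rintro _ ⟨z, hz, rfl⟩
        exact hκ.field_ne_zero hX hψ hrot hc ⟨hIcc hz.1, trivial⟩)
    have hD := hκ.contDiffOn_circleDensity (i := i) hσ hY
    obtain ⟨R, hRs, hRper, hRd⟩ := exists_periodic_primitive hD
      fun q hq ↦ hκ.periodic_circleDensity hq
    let e : ℝ → ℝ := fun q ↦ ∫ p in (0 : ℝ)..1, circleDensity σ Y (κ i) (q, p)
    have he : ContDiffOn ℝ ∞ e (Ioo 0 1) :=
      contDiffOn_integral_unitInterval (F := circleDensity σ Y (κ i)) isOpen_Ioo hD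
    have he0 : e q₀ ≠ 0 := hκ.integral_circleDensity_ne_zero hσ hH hHX hX hψ hY hrot hc x.den_pos
      hbc hF hq₀ fun p ↦ hKO ⟨(q₀, p), ⟨⟨by simp [hr.le], by simp [hr.le]⟩, trivial⟩, rfl⟩
    -- `χ(q) q` is globally defined on the collar, and agrees with `q` on the support of `f`
    let χ : ContDiffBump q₀ := ⟨3 * r, 4 * r, by linarith, by linarith⟩
    let FA : ℝ × ℝ → ℝ := fun z ↦ f z.1 * e z.1
    let Fk : ℝ × ℝ → ℝ := fun z ↦ χ z.1 * z.1
    let Fρ : ℝ × ℝ → ℝ := fun z ↦ f z.1 * e z.1 * R z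
    have hfst : ContDiffOn ℝ ∞ (fun z : ℝ × ℝ ↦ f z.1 * e z.1) openStrip :=
      (f.contDiff.comp contDiff_fst).contDiffOn.mul
        (he.comp contDiff_fst.contDiffOn fun z hz ↦ hz.1)
    have hFA : ∀ q p : ℝ, ∀ n : ℤ, FA (q, p + n) = FA (q, p) := fun _ _ _ ↦ rfl
    have hFk : ∀ q p : ℝ, ∀ n : ℤ, Fk (q, p + n) = Fk (q, p) := fun _ _ _ ↦ rfl
    have hFρ : ∀ q p : ℝ, ∀ n : ℤ, Fρ (q, p + n) = Fρ (q, p) := by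
      intro q p n
      simp only [Fρ]
      by_cases hq : q ∈ Icc (q₀ - 2 * r) (q₀ + 2 * r)
      · rw [hRper q (hIcc hq)]
      · rw [hf0 q hq]; simp
    have hFA0 : ∀ z : ℝ × ℝ, z.1 ∉ Icc (q₀ - 2 * r) (q₀ + 2 * r) → FA z = 0 := fun z hz ↦ by
      simp only [FA, hf0 _ hz, zero_mul]
    have hFρ0 : ∀ z : ℝ × ℝ, z.1 ∉ Icc (q₀ - 2 * r) (q₀ + 2 * r) → Fρ z = 0 := fun z hz ↦ by
      simp only [Fρ, hf0 _ hz, zero_mul]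
    have hFk0 : ∀ z : ℝ × ℝ, z.1 ∉ Icc (q₀ - 4 * r) (q₀ + 4 * r) → Fk z = 0 := by
      intro z hz
      have : χ z.1 = 0 := by
        refine χ.zero_of_le_dist ?_
        by_contra hlt
        rw [not_le, Real.dist_eq, abs_lt] at hlt
        exact hz ⟨by linarith [hlt.1], by linarith [hlt.2]⟩
      simp only [Fk, this, zero_mul]
    have hFks : ContDiff ℝ ∞ Fk := (χ.contDiff.comp contDiff_fst).mul contDiff_fst
    refine ⟨fun q ↦ f q * e q * e q, q₀ - 2 * r, q₀ + 2 * r, ha, hb,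
      (f.contDiff.contDiffOn.mul he).mul he, fun q ↦ ?_, fun q hq ↦ by simp [hf0 q hq], ?_,
      fun γ hγ hγQ h0 h1 ↦ ?_⟩
    · beta_reduce
      rw [mul_assoc]
      exact mul_nonneg f.nonneg (mul_self_nonneg _)
    · simp only [hfq, one_mul]
      exact mul_self_pos.2 he0
    · refine hκ.integral_sweepRate_eq_zero (FA := FA) (Fk := Fk) (Fρ := Fρ) (e := e) hσ hσκ hX hψ
        hrot hF isCompact_Icc hIcc hKO hFA hFk hFρ
        (hκ.contMDiff_pushForward i hFA hfst ha hb hFA0)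
        (hκ.contMDiff_pushForward i hFk hFks.contDiffOn (by linarith) (by linarith) hFk0)
        (hκ.contMDiff_pushForward i hFρ (hfst.mul hRs) ha hb hFρ0) hFA0 hFρ0 ?_ ?_ ?_ hγ hγQ h0 h1
      · rintro ⟨q, p⟩ hz -
        exact fderiv_snd_eq ((hfst.contDiffAt (isOpen_openStrip.mem_nhds hz)).differentiableAt
          (by simp)) (hasDerivAt_const p (f q * e q))
      · rintro z - hz ξ
        have : Fk =ᶠ[𝓝 z] Prod.fst := by
          have hball : z.1 ∈ Metric.ball q₀ (3 * r) := by
            rw [Metric.mem_ball, Real.dist_eq, abs_lt]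
            exact ⟨by linarith [hz.1], by linarith [hz.2]⟩
          filter_upwards [(Metric.isOpen_ball.preimage continuous_fst).mem_nhds hball] with w hw
          simp only [Fk]
          rw [χ.one_of_mem_closedBall (Metric.ball_subset_closedBall hw), one_mul]
        rw [this.fderiv_eq, fderiv_fst]
        rfl
      · rintro ⟨q, p⟩ hz -
        have hRdiff : DifferentiableAt ℝ R (q, p) :=
          (hRs.contDiffAt (isOpen_openStrip.mem_nhds hz)).differentiableAt (by simp)
        refine fderiv_snd_eq (((hfst.mul hRs).contDiffAt
          (isOpen_openStrip.mem_nhds hz)).differentiableAt (by simp)) ?_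
        have h1 : HasDerivAt (fun p ↦ R (q, p)) (fderiv ℝ R (q, p) (0, 1)) p :=
          (hRdiff.hasFDerivAt.comp p (hasFDerivAt_prodMk_right q p)).hasDerivAt.congr_deriv
            (by simp)
        rw [hRd _ hz] at h1
        exact h1.const_mul (f q * e q)

end Vanishing

/-! ### Connecting orbits do not meet the open collar -/

section Avoidance

variable {M : Type*} [TopologicalSpace M] [ChartedSpace (EuclideanSpace ℝ (Fin 2)) M]
  [IsManifold (𝓡 2) ∞ M] {m : ℕ} {S : Set M} {κ : Fin m → ℝ × ℝ → M}
  {σ : BilinField M} {J : ℝ → EndField M} {H g : M → ℝ} {u : ℝ × ℝ → M} {xm xp : M} {δ : ℝ}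

/-- A smooth map with vanishing derivative wherever it takes values in an open set `W` is
constant, if it takes a value in `W`. -/
lemma eq_of_mfderiv_eq_zero [T2Space M] (hu : ContMDiff 𝓘(ℝ, ℝ × ℝ) (𝓡 2) ∞ u) {W : Set M}
    (hW : IsOpen W)
    (h : ∀ z, u z ∈ W → mfderiv 𝓘(ℝ, ℝ × ℝ) (𝓡 2) u z = 0) {z₀ : ℝ × ℝ} (hz₀ : u z₀ ∈ W)
    (z : ℝ × ℝ) : u z = u z₀ := by
  have hclosed : IsClosed {z | u z = u z₀} := isClosed_eq hu.continuous continuous_const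
  have hopen : IsOpen {z | u z = u z₀} := by
    rw [isOpen_iff_mem_nhds]
    intro z hz
    have hz' : u z = u z₀ := hz
    have hnhds : u ⁻¹' (W ∩ (chartAt (EuclideanSpace ℝ (Fin 2)) (u z₀)).source) ∈ 𝓝 z := by
      refine hu.continuous.continuousAt.preimage_mem_nhds (IsOpen.mem_nhds (hW.inter
        (chartAt _ _).open_source) ?_)
      rw [hz']
      exact ⟨hz₀, mem_chart_source _ _⟩
    obtain ⟨r, hr, hball⟩ := Metric.mem_nhds_iff.1 hnhds
    let f : ℝ × ℝ → EuclideanSpace ℝ (Fin 2) := fun w ↦ extChartAt (𝓡 2) (u z₀) (u w)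
    have hf : ∀ w ∈ Metric.ball z r,
        HasFDerivAt f (0 : ℝ × ℝ →L[ℝ] EuclideanSpace ℝ (Fin 2)) w := by
      intro w hw
      have h1 := (mdifferentiableAt_extChartAt (𝕜 := ℝ) (I := 𝓡 2) (x := u z₀) (y := u w)
        (hball hw).2).hasMFDerivAt
      have h2 := ((hu w).mdifferentiableAt (by simp)).hasMFDerivAt
      rw [h w (hball hw).1] at h2
      have h3 := h1.comp w h2
      rw [ContinuousLinearMap.comp_zero] at h3
      exact h3.hasFDerivAt
    have hconst : ∀ w ∈ Metric.ball z r, f w = f z := fun w hw ↦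
      (convex_ball z r).is_const_of_fderivWithin_eq_zero (𝕜 := ℝ)
        (fun w hw ↦ (hf w hw).differentiableAt.differentiableWithinAt)
        (fun w hw ↦ by
          rw [fderivWithin_of_isOpen Metric.isOpen_ball hw, (hf w hw).fderiv])
        hw (Metric.mem_ball_self hr)
    filter_upwards [Metric.ball_mem_nhds z hr] with w hw
    have h4 := (extChartAt (𝓡 2) (u z₀)).injOn
      (by simpa only [extChartAt_source] using (hball hw).2)
      (by simpa only [extChartAt_source] using (hball (Metric.mem_ball_self hr)).2) (hconst w hw)
    exact h4.trans hz'
  have huniv := IsClopen.eq_univ ⟨hclosed, hopen⟩ ⟨z₀, rfl⟩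
  have : z ∈ {z | u z = u z₀} := huniv ▸ mem_univ z
  exact this

omit [IsManifold (𝓡 2) ∞ M] in
/-- By Floer's equation, the area density of a connecting orbit is minus the energy density. -/
lemma IsConnectingOrbit.areaDensity_eq {Φ : M → M} (hu : IsConnectingOrbit σ Φ J xm xp u)
    (z : ℝ × ℝ) : areaDensity σ u z = -energyDensity σ J u z := by
  have h : partialS u z = -J z.2 (u z) (partialT u z) :=
    eq_neg_of_add_eq_zero_left (hu.floer z.1 z.2)
  rw [areaDensity, energyDensity, h, map_neg]

omit [IsManifold (𝓡 2) ∞ M] in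
/-- The derivative of a connecting orbit vanishes where the energy density does. -/
lemma IsConnectingOrbit.mfderiv_eq_zero {Φ : M → M} (hu : IsConnectingOrbit σ Φ J xm xp u)
    (hc : ∀ t, IsCompatible σ (J t)) {z : ℝ × ℝ} (hz : energyDensity σ J u z = 0) :
    mfderiv 𝓘(ℝ, ℝ × ℝ) (𝓡 2) u z = 0 := by
  have hT : partialT u z = 0 := by
    by_contra h
    exact ((hc z.2).pos _ _ h).ne' hz
  have hS : partialS u z = 0 := by
    have h : partialS u z = -J z.2 (u z) (partialT u z) :=
      eq_neg_of_add_eq_zero_left (hu.floer z.1 z.2)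
    rw [h, hT, map_zero, neg_zero]
  have h0 : ∀ L : ℝ × ℝ →L[ℝ] EuclideanSpace ℝ (Fin 2), L (1, 0) = 0 → L (0, 1) = 0 → L = 0 := by
    intro L h1 h2
    ext1
    · ext1; simpa using h1
    · ext1; simpa using h2
  exact h0 _ hS hT

/-- The energy density descends to the twisted cylinder. -/
lemma IsConnectingOrbit.energyDensity_add_one {Φ : M ≃ₘ^∞⟮𝓡 2, 𝓡 2⟯ M}
    (hu : IsConnectingOrbit σ Φ J xm xp u) (hΦ : IsInvariantForm Φ σ)
    (hJΦ : ∀ (t : ℝ) (x : M) (v : TangentSpace (𝓡 2) x),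
      mfderiv (𝓡 2) (𝓡 2) Φ x (J (t + 1) x v) = J t (Φ x) (mfderiv (𝓡 2) (𝓡 2) Φ x v))
    (s t : ℝ) : energyDensity σ J u (s, t + 1) = energyDensity σ J u (s, t) := by
  have hd : ∀ t, MDifferentiableAt 𝓘(ℝ, ℝ × ℝ) (𝓡 2) u (s, t) := fun t ↦
    (hu.smooth _).mdifferentiableAt (by simp)
  have hcurve : ∀ t, HasMFDerivAt 𝓘(ℝ, ℝ) (𝓡 2) (fun t ↦ u (s, t)) t
      ((mfderiv 𝓘(ℝ, ℝ × ℝ) (𝓡 2) u (s, t)).comp (ContinuousLinearMap.inr ℝ ℝ ℝ)) := fun t ↦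
    (hd t).hasMFDerivAt.comp t (hasFDerivAt_prodMk_right s t).hasMFDerivAt
  have hshift : HasMFDerivAt 𝓘(ℝ, ℝ) 𝓘(ℝ, ℝ) (fun t : ℝ ↦ t + 1) t (ContinuousLinearMap.id ℝ ℝ) :=
    ((hasFDerivAt_id t).add_const 1).hasMFDerivAt
  have hΦd := ((Φ.contMDiff (u (s, t + 1))).mdifferentiableAt (by simp)).hasMFDerivAt
  have h1 := hΦd.comp t ((hcurve (t + 1)).comp t hshift)
  have h2 : (fun t ↦ u (s, t)) = (Φ ∘ (fun t ↦ u (s, t)) ∘ fun t ↦ t + 1) :=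
    funext fun t ↦ hu.twisted s t
  have key : ∀ x : M, x = u (s, t) → ∀ v : TangentSpace (𝓡 2) x,
      HasMFDerivAt 𝓘(ℝ, ℝ) (𝓡 2) (fun t ↦ u (s, t)) t
        ((1 : ℝ →L[ℝ] ℝ).smulRight (v : EuclideanSpace ℝ (Fin 2))) →
      σ x v (J t x v) = energyDensity σ J u (s, t) := by
    rintro x rfl v hv
    have h3 := hasMFDerivAt_unique hv (hcurve t)
    have h4 := congrArg (fun L : ℝ →L[ℝ] EuclideanSpace ℝ (Fin 2) ↦ L 1) h3
    have h5 : v = partialT u (s, t) := by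
      have h6 : ∀ (v : EuclideanSpace ℝ (Fin 2)) (L : ℝ × ℝ →L[ℝ] EuclideanSpace ℝ (Fin 2)),
          (1 : ℝ →L[ℝ] ℝ).smulRight v 1 = L.comp (ContinuousLinearMap.inr ℝ ℝ ℝ) 1 →
          v = L (0, 1) := by
        intro v L h
        simpa using h
      exact h6 _ _ h4
    rw [h5]
    rfl
  rw [← key (Φ (u (s, t + 1))) (hu.twisted s t).symm
    (mfderiv (𝓡 2) (𝓡 2) Φ (u (s, t + 1)) (partialT u (s, t + 1))) ?_, ← hJΦ, hΦ]
  · rfl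
  · rw [h2]
    refine h1.congr_mfderiv ?_
    have h7 : ∀ (A : EuclideanSpace ℝ (Fin 2) →L[ℝ] EuclideanSpace ℝ (Fin 2))
        (L : ℝ × ℝ →L[ℝ] EuclideanSpace ℝ (Fin 2)),
        A.comp ((L.comp (ContinuousLinearMap.inr ℝ ℝ ℝ)).comp (ContinuousLinearMap.id ℝ ℝ)) =
          (1 : ℝ →L[ℝ] ℝ).smulRight (A (L (0, 1))) := by
      intro A L
      ext1
      simp
    exact h7 _ _

end Avoidance

section Energy

variable {M : Type*} [TopologicalSpace M] [ChartedSpace (EuclideanSpace ℝ (Fin 2)) M]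
  [T2Space M] [CompactSpace M] [IsManifold (𝓡 2) ∞ M]
  {m : ℕ} {S : Set M} {κ : Fin m → ℝ × ℝ → M}
  {σ : BilinField M} {J : ℝ → EndField M} {H g : M → ℝ} {u : ℝ × ℝ → M} {xm xp : M} {δ : ℝ}
  {X : ∀ x : M, TangentSpace (𝓡 2) x} {ψ : ℝ → M → M} {Φ : M ≃ₘ^∞⟮𝓡 2, 𝓡 2⟯ M}

/-- The `g`-weighted energy of a connecting orbit is the `g`-weighted area swept out by any other
path of twisted curves with the same ends; it vanishes if that area does. -/
theorem IsConnectingOrbit.weight_mul_energyDensity_eq_zero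
    (hu : IsConnectingOrbit σ Φ J xm xp u) (hσ : IsAreaForm σ) (hΦ : IsInvariantForm Φ σ)
    (h4 : HypH4 σ Φ κ) (h5 : HypH5 σ Φ κ J)
    (hg : ContMDiff (𝓡 2) 𝓘(ℝ, ℝ) ∞ g) (hg0 : ∀ x, 0 ≤ g x) (hgΦ : ∀ x, g (Φ x) = g x)
    (hgκ : ∀ x ∉ collarSet κ, g x = 0)
    (hX : IsSmoothField X) (hψ : IsFlow X ψ) (hΦS : Φ '' S = S) (hΦψ : ∀ x ∈ S, Φ x = ψ 1 x)
    (hxm : ∀ t, ψ t xm = xm) (hxp : ∀ t, ψ t xp = xp) (hSm : S ∈ 𝓝 xm) (hSp : S ∈ 𝓝 xp)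
    (hgm : ∀ᶠ x in 𝓝 xm, g x = 0) (hgp : ∀ᶠ x in 𝓝 xp, g x = 0)
    (hpath : SweepsArea Φ σ g (fun _ ↦ xm) (fun _ ↦ xp) 0) (z : ℝ × ℝ) :
    g (u z) * energyDensity σ J u z = 0 := by
  obtain ⟨hJ, hc, -, hJΦ⟩ := h5
  obtain ⟨Bm, hBm, hcapm⟩ := exists_nhds_sweepsArea_zero (σ := σ) hX hψ hΦS hΦψ hxm hSm hgm
  obtain ⟨Bp, hBp, hcapp⟩ := exists_nhds_sweepsArea_zero (σ := σ) hX hψ hΦS hΦψ hxp hSp hgp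
  have hcont : Continuous fun z ↦ g (u z) * energyDensity σ J u z :=
    (hg.continuous.comp hu.smooth.continuous).mul (continuous_energyDensity hσ hJ hu.smooth)
  have hpos : ∀ z, 0 ≤ g (u z) * energyDensity σ J u z := fun z ↦
    mul_nonneg (hg0 _) (energyDensity_nonneg hc u z)
  have hslice : ∀ s, Continuous fun t ↦ g (u (s, t)) * energyDensity σ J u (s, t) := fun s ↦
    hcont.comp (Continuous.prodMk_right s)
  have hrate : ∀ s, sweepRate σ g u s =
      -∫ t in (0 : ℝ)..1, g (u (s, t)) * energyDensity σ J u (s, t) := by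
    intro s
    rw [sweepRate, ← intervalIntegral.integral_neg]
    simp only [hu.areaDensity_eq, mul_neg]
  have hcurve : ∀ s, ContMDiff 𝓘(ℝ, ℝ) (𝓡 2) ∞ fun t ↦ u (s, t) := fun s ↦
    hu.smooth.comp (contDiff_prodMk_right s).contMDiff
  have hunit : ∀ t ∈ Icc (0 : ℝ) 1, ∀ s, g (u (s, t)) * energyDensity σ J u (s, t) = 0 := by
    intro t ht s
    -- slices `a ≤ s ≤ b` near the ends, where the orbit can be capped off
    obtain ⟨a, hua, has⟩ := ((frequently_forall_mem hσ hJ hc hu.smooth hu.energy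
      (fun A hA ↦ by
        obtain ⟨N, hN⟩ := mem_atBot_sets.1 hA
        exact top_unique (Real.volume_Iic (a := N) ▸ measure_mono hN))
      (hu.lim_neg 0) hBm).and_eventually (eventually_le_atBot s)).exists
    obtain ⟨b, hub, hsb⟩ := ((frequently_forall_mem hσ hJ hc hu.smooth hu.energy
      (fun A hA ↦ by
        obtain ⟨N, hN⟩ := mem_atTop_sets.1 hA
        exact top_unique (Real.volume_Ici (a := N) ▸ measure_mono hN))
      (hu.lim_pos 0) hBp).and_eventually (eventually_ge_atTop (s + 1))).exists
    -- from `x⁻` along the cap, the orbit, and the other cap to `x⁺`, and back along the given path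
    have hloop := (((hcapm _ (hcurve a) (hu.twisted a) hua).symm hσ hg.continuous).trans hσ
      hg.continuous ((SweepsArea.of_segment hσ hg.continuous hu.smooth hu.twisted a b).trans hσ
        hg.continuous ((hcapp _ (hcurve b) (hu.twisted b) hub).trans hσ hg.continuous
          (hpath.symm hσ hg.continuous))))
    have hzero := hloop.eq_zero h4 hσ hΦ hg hg0 hgΦ hgκ
    have hint : ∫ s in a..b, -sweepRate σ g u s = 0 := by
      rw [intervalIntegral.integral_neg]
      linarith
    have hneg : ∀ s, 0 ≤ -sweepRate σ g u s := by
      intro s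
      rw [hrate, neg_neg]
      exact intervalIntegral.integral_nonneg zero_le_one fun t _ ↦ hpos _
    have hs0 : ¬ 0 < -sweepRate σ g u s := fun hlt ↦
      (intervalIntegral.integral_pos (by linarith)
        (continuous_sweepRate hσ hg.continuous hu.smooth).neg.continuousOn (fun s _ ↦ hneg s)
        ⟨s, ⟨has, by linarith⟩, hlt⟩).ne' hint
    rw [hrate, neg_neg] at hs0
    by_contra hne
    exact hs0 (intervalIntegral.integral_pos zero_lt_one (hslice s).continuousOn
      (fun t _ ↦ hpos _) ⟨t, ht, lt_of_le_of_ne (hpos _) (Ne.symm hne)⟩)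
  refine forall_of_periodic (P := fun t ↦ ∀ s, g (u (s, t)) * energyDensity σ J u (s, t) = 0)
    (fun t ↦ ?_) hunit z.2 z.1
  simp only [hu.energyDensity_add_one hΦ hJΦ, hu.twisted _ t, hgΦ]

end Energy

section Avoidance

variable {M : Type*} [TopologicalSpace M] [ChartedSpace (EuclideanSpace ℝ (Fin 2)) M]
  {m : ℕ} {S : Set M} {κ : Fin m → ℝ × ℝ → M} {Φ : M → M} {δ : ℝ}

lemma HypH2.exists_rotation (h2 : HypH2 Φ κ δ) (i : Fin m) :
    ∃ c : ℝ, (∀ n : ℤ, c ≠ n) ∧ ∀ z ∈ strip, Φ (κ i z) = κ i (z.1, z.2 + c) := by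
  obtain ⟨h0, h1, h⟩ := h2
  rcases h i with h | h
  · refine ⟨-δ, fun n hn ↦ ?_, fun z hz ↦ h z.1 hz.1 z.2⟩
    have ha : (-1 : ℝ) < n := by rw [← hn]; linarith
    have hb : (n : ℝ) < 0 := by rw [← hn]; linarith
    have ha' : -1 < n := by exact_mod_cast ha
    have hb' : n < 0 := by exact_mod_cast hb
    omega
  · refine ⟨δ, fun n hn ↦ ?_, fun z hz ↦ h z.1 hz.1 z.2⟩
    have ha : (0 : ℝ) < n := by rw [← hn]; linarith
    have hb : (n : ℝ) < 1 := by rw [← hn]; linarith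
    have ha' : 0 < n := by exact_mod_cast ha
    have hb' : n < 1 := by exact_mod_cast hb
    omega

/-- Fixed points are not in the collar, as the rotation by `±δ` has none. -/
lemma IsCollar.notMem_collarSet (hκ : IsCollar S κ) (h2 : HypH2 Φ κ δ) {x : M} (hx : Φ x = x) :
    x ∉ collarSet κ := by
  intro hmem
  obtain ⟨i, z, hz, rfl⟩ := mem_iUnion.1 hmem
  obtain ⟨c, hc, hrot⟩ := h2.exists_rotation i
  rw [hrot z hz] at hx
  obtain ⟨-, n, hn⟩ := (hκ.eq_iff i (z.1, z.2 + c) ⟨hz.1, trivial⟩ z hz).1 hx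
  refine hc (-n) ?_
  push_cast
  dsimp only at hn
  linarith

lemma IsCollar.isClosed_collarSet [T2Space M] [IsManifold (𝓡 2) ∞ M] (hκ : IsCollar S κ) :
    IsClosed (collarSet κ) := isClosed_iUnion_of_finite fun i ↦ hκ.isClosed_image i

/-- Functions of the radial collar coordinate are invariant under rotations of the collar. -/
lemma IsCollar.pushForward_invariant [IsManifold (𝓡 2) ∞ M] (hκ : IsCollar S κ)
    (hΦ : Function.Injective Φ) {i : Fin m}
    {c : ℝ} (hrot : ∀ z ∈ strip, Φ (κ i z) = κ i (z.1, z.2 + c)) (h : ℝ → ℝ) (x : M) :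
    pushForward κ i (fun z ↦ h z.1) (Φ x) = pushForward κ i (fun z ↦ h z.1) x := by
  by_cases hx : x ∈ κ i '' openStrip
  · obtain ⟨z, hz, rfl⟩ := hx
    rw [hrot z (openStrip_subset_strip hz), hκ.pushForward_apply i (fun _ _ _ ↦ rfl) hz,
      hκ.pushForward_apply i (fun _ _ _ ↦ rfl)
        (show (z.1, z.2 + c) ∈ openStrip from ⟨hz.1, trivial⟩)]
  · rw [pushForward_of_notMem i hx, pushForward_of_notMem i]
    rintro ⟨w, hw, hwx⟩
    have hw' : (w.1, w.2 - c) ∈ openStrip := ⟨hw.1, trivial⟩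
    refine hx ⟨_, hw', hΦ ?_⟩
    rw [hrot _ (openStrip_subset_strip hw'), sub_add_cancel]
    exact hwx

variable [T2Space M] [CompactSpace M] [IsManifold (𝓡 2) ∞ M]
  {σ : BilinField M} {J : ℝ → EndField M} {H : M → ℝ} {u : ℝ × ℝ → M} {xm xp : M}
  {Φ : M ≃ₘ^∞⟮𝓡 2, 𝓡 2⟯ M}

/-- A connecting orbit does not meet the open collar. -/
theorem IsConnectingOrbit.notMem_collar (hu : IsConnectingOrbit σ Φ J xm xp u)
    (hS : IsCompactSubsurface S) (hκ : IsCollar S κ) (hσ : IsAreaForm σ)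
    (hσκ : IsStandardFormOn κ σ) (hΦ : IsInvariantForm Φ σ)
    (hH : ContMDiff (𝓡 2) 𝓘(ℝ, ℝ) ∞ H) (h1 : HypH1 σ Φ H S) (h2 : HypH2 Φ κ δ)
    (h3 : HypH3 Φ H S) (h4 : HypH4 σ Φ κ) (h5 : HypH5 σ Φ κ J)
    (hxm : Φ xm = xm) (hxp : Φ xp = xp) (hxmS : xm ∈ S) (hcomp : xp ∈ connectedComponentIn S xm)
    (i : Fin m) (z : ℝ × ℝ) : u z ∉ κ i '' openStrip := by
  rintro ⟨⟨q₀, p₀⟩, hw, hwz⟩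
  obtain ⟨hΦS, ψ, ⟨X, hHX, hflow⟩, hΦψ⟩ := h1
  have hψ : IsFlow X ψ := ⟨fun x ↦ (hflow x).1, fun x ↦ (hflow x).2⟩
  have hX : IsSmoothField X := hσ.isSmoothField_hamiltonian hH hHX
  have hxpS : xp ∈ S := connectedComponentIn_subset _ _ hcomp
  have hfix : ∀ x ∈ S, Φ x = x → (∀ t, ψ t x = x) ∧ x ∉ collarSet κ ∧ S ∈ 𝓝 x := by
    intro x hxS hx
    have hxκ := hκ.notMem_collarSet h2 hx
    refine ⟨hψ.eq_self_of_field_eq_zero hX ?_, hxκ, mem_interior_iff_mem_nhds.1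
      (hS.mem_interior hxS fun hf ↦ hxκ ?_)⟩
    · have hcrit : x ∈ {x | Φ x = x} ∩ S := ⟨hx, hxS⟩
      rw [h3] at hcrit
      have hdH : mfderiv (𝓡 2) 𝓘(ℝ, ℝ) H x = 0 := hcrit.1
      by_contra hne
      obtain ⟨w, hw⟩ := hσ.nondegenerate x _ hne
      rw [← hHX, hdH] at hw
      exact hw rfl
    · rw [hκ.boundary] at hf
      exact iUnion_mono (fun i ↦ image_mono (prod_mono_left (by simp))) hf
  obtain ⟨hψm, hmκ, hSm⟩ := hfix xm hxmS hxm
  obtain ⟨hψp, hpκ, hSp⟩ := hfix xp hxpS hxp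
  obtain ⟨c, hc, hrot⟩ := h2.exists_rotation i
  obtain ⟨h, a, b, ha, hb, hsm, h0, hsupp, hq, hvan⟩ := hκ.exists_weight hσ hσκ hH hHX hX hψ h5.1
    (h5.2.1 0) (c := c) (i := i) (fun w hw ↦ by
      have hw' := openStrip_subset_strip hw
      rw [← hΦψ _ (hκ.subset i ⟨w, hw', rfl⟩), hrot w hw']) hc hw.1
  have hper : ∀ q p : ℝ, ∀ n : ℤ, (fun z : ℝ × ℝ ↦ h z.1) (q, p + n) = h q := fun _ _ _ ↦ rfl
  set g : M → ℝ := IsCollar.pushForward κ i fun z ↦ h z.1 with hg_def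
  have hg : ContMDiff (𝓡 2) 𝓘(ℝ, ℝ) ∞ g := hκ.contMDiff_pushForward i hper
    (hsm.comp contDiff_fst.contDiffOn fun z hz ↦ hz.1) ha hb fun z hz ↦ hsupp _ hz
  have hg0 : ∀ x, 0 ≤ g x := by
    intro x
    by_cases hx : x ∈ κ i '' openStrip
    · obtain ⟨w, hw, rfl⟩ := hx
      rw [hg_def, hκ.pushForward_apply i hper hw]
      exact h0 _
    · rw [hg_def, IsCollar.pushForward_of_notMem i hx]
  have hgκ : ∀ x ∉ collarSet κ, g x = 0 := fun x hx ↦ IsCollar.pushForward_of_notMem i fun hx' ↦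
    hx (mem_iUnion.2 ⟨i, image_mono openStrip_subset_strip hx'⟩)
  have hnear : ∀ x ∉ collarSet κ, ∀ᶠ y in 𝓝 x, g y = 0 := fun x hx ↦
    Filter.mem_of_superset (hκ.isClosed_collarSet.isOpen_compl.mem_nhds hx) hgκ
  -- a path from `x⁻` to `x⁺` in the part of `S` where `q < a`, off the support of the weight
  obtain ⟨C, hCcore, hCp, hmC, hpC⟩ := hκ.exists_preconnected_core hS hmκ hpκ hxmS hcomp ha
  have hab : a ≤ 1 := by
    by_contra hlt
    exact hq.ne' (hsupp _ fun hq' ↦ hlt (hq'.1.trans hw.1.2.le))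
  obtain ⟨γ, hγ, hγ0, hγ1, hγO⟩ := exists_smooth_path (hκ.isOpen_core hS ha.le hab) hCp hCcore
    hmC hpC
  have hpath := sweepsArea_flowSquare (σ := σ) (g := g) hX hψ hΦS hΦψ hγ (fun s ↦ (hγO s).1)
    (hγ0 ▸ hψm) (hγ1 ▸ hψp)
  rw [hvan γ hγ (fun s hs ↦ (hγO s).2 (mem_iUnion.2
    ⟨i, image_mono (prod_mono_left (Icc_subset_Icc_right hb.le)) hs⟩)) (hγ0 ▸ hψm) (hγ1 ▸ hψp),
    hγ0, hγ1] at hpath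
  have hzero := hu.weight_mul_energyDensity_eq_zero hσ hΦ h4 h5 hg hg0
    (hκ.pushForward_invariant Φ.injective hrot h) hgκ hX hψ hΦS hΦψ hψm hψp hSm hSp
    (hnear _ hmκ) (hnear _ hpκ) hpath
  -- an orbit that meets the circle `q = q₀` is constant, in contradiction to its limit `x⁻`
  have hconst := eq_of_mfderiv_eq_zero hu.smooth (W := {x | 0 < g x})
    (isOpen_lt continuous_const hg.continuous)
    (fun z hz ↦ hu.mfderiv_eq_zero h5.2.1 ((mul_eq_zero.1 (hzero z)).resolve_left hz.ne'))
    (z₀ := z) (by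
      show 0 < g (u z)
      rw [← hwz, hg_def, hκ.pushForward_apply i hper hw]
      exact hq)
  have hlim := hu.lim_neg 0
  simp only [hconst] at hlim
  refine hmκ ?_
  rw [← tendsto_nhds_unique hlim tendsto_const_nhds |>.symm, ← hwz]
  exact mem_iUnion.2 ⟨i, _, openStrip_subset_strip hw, rfl⟩

end Avoidance

/-! ### The distance of the inner collar boundary to the complement of the collar -/

section Metric

variable {M : Type*} [TopologicalSpace M] [ChartedSpace (EuclideanSpace ℝ (Fin 2)) M]
  [IsManifold (𝓡 2) ∞ M] {σ : BilinField M} {j : EndField M}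

lemma sqrt_metric_smul (x : M) (c : ℝ) (v : TangentSpace (𝓡 2) x) :
    Real.sqrt (σ x (c • v) (j x (c • v))) = ‖c‖ * Real.sqrt (σ x v (j x v)) := by
  have h : σ x (c • v) (j x (c • v)) = c ^ 2 * σ x v (j x v) := by
    simp only [map_smul, smul_apply, smul_eq_mul]
    ring
  rw [h, Real.sqrt_mul (sq_nonneg c), Real.sqrt_sq_eq_abs, Real.norm_eq_abs]

lemma metricDist_self (x : M) : metricDist σ j x x = 0 := by
  let _ : ∀ x : M, ENorm (TangentSpace (𝓡 2) x) :=
    fun x ↦ ⟨fun v ↦ ENNReal.ofReal (Real.sqrt (σ x v (j x v)))⟩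
  have : ∀ x : M, ENormSMulClass ℝ (TangentSpace (𝓡 2) x) := fun x ↦ ⟨fun c v ↦ by
    show ENNReal.ofReal (Real.sqrt (σ x (c • v) (j x (c • v)))) =
      ‖c‖ₑ * ENNReal.ofReal (Real.sqrt (σ x v (j x v)))
    rw [sqrt_metric_smul, ENNReal.ofReal_mul (norm_nonneg c), ofReal_norm]⟩
  exact Manifold.riemannianEDist_self

lemma metricDist_le_lintegral {γ : ℝ → M} {a b : ℝ}
    (hγ : ContMDiffOn 𝓘(ℝ, ℝ) (𝓡 2) 1 γ (Icc a b)) (hab : a ≤ b) :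
    metricDist σ j (γ a) (γ b) ≤ ∫⁻ t in Icc a b, ENNReal.ofReal (Real.sqrt
      (σ (γ t) (mfderiv 𝓘(ℝ, ℝ) (𝓡 2) γ t (1 : ℝ))
        (j (γ t) (mfderiv 𝓘(ℝ, ℝ) (𝓡 2) γ t (1 : ℝ))))) := by
  let _ : ∀ x : M, ENorm (TangentSpace (𝓡 2) x) :=
    fun x ↦ ⟨fun v ↦ ENNReal.ofReal (Real.sqrt (σ x v (j x v)))⟩
  have : ∀ x : M, ENormSMulClass ℝ (TangentSpace (𝓡 2) x) := fun x ↦ ⟨fun c v ↦ by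
    show ENNReal.ofReal (Real.sqrt (σ x (c • v) (j x (c • v)))) =
      ‖c‖ₑ * ENNReal.ofReal (Real.sqrt (σ x v (j x v)))
    rw [sqrt_metric_smul, ENNReal.ofReal_mul (norm_nonneg c), ofReal_norm]⟩
  have h := Manifold.riemannianEDist_le_pathELength (I := 𝓡 2) hγ rfl rfl hab
  rw [Manifold.pathELength_eq_lintegral_mfderiv_Icc] at h
  exact h

/-- Short pieces of a smooth curve have small length. -/
lemma eventually_metricDist_lt {J : ℝ → EndField M} (hσ : IsAreaForm σ) (hJ : IsSmoothPath J)
    (t : ℝ) {γ : ℝ → M} (hγ : ∀ᶠ r in 𝓝 (0 : ℝ), ContMDiffAt 𝓘(ℝ, ℝ) (𝓡 2) ∞ γ r) {ε : ℝ}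
    (hε : 0 < ε) :
    ∀ᶠ r in 𝓝[<] (0 : ℝ), metricDist σ (J t) (γ r) (γ 0) < ENNReal.ofReal ε := by
  let f : ℝ → ℝ := fun r ↦ σ (γ r) (mfderiv 𝓘(ℝ, ℝ) (𝓡 2) γ r (1 : ℝ))
        (J t (γ r) (mfderiv 𝓘(ℝ, ℝ) (𝓡 2) γ r (1 : ℝ)))
  have hV := contMDiffAt_mfderiv_apply hγ.self_of_nhds
    (V := fun _ ↦ (1 : ℝ)) (contMDiff_const_field (1 : ℝ) 0)
  have hf : ContinuousAt f 0 :=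
    (hσ.contMDiffAt_apply hV (hJ.contMDiffAt_apply contMDiffAt_const hV)).continuousAt
  -- a bound `B` of the speed near `0`; the piece over `[r, 0]` has length at most `B |r|`
  obtain ⟨B, hB⟩ : ∃ B : ℝ, f 0 < B ^ 2 ∧ 0 < B := by
    refine ⟨|f 0| + 1, ?_, by positivity⟩
    nlinarith [le_abs_self (f 0), abs_nonneg (f 0)]
  obtain ⟨r₀, hr₀, hball⟩ := Metric.eventually_nhds_iff.1
    (hγ.and (hf.eventually (eventually_lt_nhds hB.1)))
  have hmin : (0 : ℝ) < min r₀ (ε / (2 * B)) := lt_min hr₀ (div_pos hε (by linarith [hB.2]))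
  filter_upwards [Ioo_mem_nhdsLT (neg_lt_zero.2 hmin)] with r hr
  have hr1 : -r < r₀ := by linarith [hr.1, min_le_left r₀ (ε / (2 * B))]
  have hr2 : -r < ε / (2 * B) := by linarith [hr.1, min_le_right r₀ (ε / (2 * B))]
  have hd : ∀ s ∈ Icc r 0, dist s 0 < r₀ := by
    intro s hs
    rw [Real.dist_eq, sub_zero, abs_lt]
    constructor <;> linarith [hs.1, hs.2]
  have h1 : metricDist σ (J t) (γ r) (γ 0) ≤ _ := metricDist_le_lintegral
    (fun s hs ↦ ((hball (hd s hs)).1.of_le (by simp)).contMDiffWithinAt) hr.2.le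
  refine (h1.trans (setLIntegral_mono (g := fun _ ↦ ENNReal.ofReal B) measurable_const
    fun s hs ↦ ENNReal.ofReal_le_ofReal ?_)).trans_lt ?_
  · exact (Real.sqrt_le_left hB.2.le).2 (hball (hd s hs)).2.le
  · rw [setLIntegral_const, Real.volume_Icc, ← ENNReal.ofReal_mul hB.2.le]
    refine (ENNReal.ofReal_lt_ofReal_iff hε).2 ?_
    have := mul_lt_mul_of_pos_left hr2 hB.2
    have h3 : B * (ε / (2 * B)) = ε / 2 := by field_simp [hB.2.ne']
    linarith

end Metric

section InnerBoundary

variable {M : Type*} [TopologicalSpace M] [T2Space M]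
  [ChartedSpace (EuclideanSpace ℝ (Fin 2)) M] [IsManifold (𝓡 2) ∞ M]
  {m : ℕ} {S : Set M} {κ : Fin m → ℝ × ℝ → M}

/-- Points of the collar close to `κ i z` are images of points of the strip close to `z`. -/
lemma IsCollar.eventually_exists_preimage (hκ : IsCollar S κ) {i : Fin m} {z : ℝ × ℝ}
    (hz : z ∈ strip) {V : Set (ℝ × ℝ)} (hV : V ∈ 𝓝 z) :
    ∀ᶠ x in 𝓝 (κ i z), x ∈ collarSet κ → ∃ w ∈ strip ∩ V, κ i w = x := by
  obtain ⟨U, hUV, hU, hzU⟩ := mem_nhds_iff.1 hV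
  -- the part of a fundamental domain off `U` has a compact image, which does not contain `κ i z`
  let K : Set (ℝ × ℝ) := (Icc 0 1 ×ˢ Icc (z.2 - 1 / 2) (z.2 - 1 / 2 + 1)) \ U
  have hKs : K ⊆ strip := fun w hw ↦ ⟨hw.1.1, trivial⟩
  have hK : IsClosed (κ i '' K) :=
    (((isCompact_Icc.prod isCompact_Icc).diff hU).image_of_continuousOn
      ((hκ.smooth i).continuousOn.mono hKs)).isClosed
  have h1 : κ i z ∉ κ i '' K := by
    rintro ⟨w, hw, hwz⟩
    obtain ⟨h1, n, hn⟩ := (hκ.eq_iff i w (hKs hw) z hz).1 hwz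
    have h2 := hw.1.2
    rw [show w.2 = z.2 - n by linarith] at h2
    have ha : ((-1 : ℤ) : ℝ) < n := by push_cast; linarith [h2.2]
    have hb : (n : ℝ) < (1 : ℤ) := by push_cast; linarith [h2.1]
    have hn0 : n = 0 := by
      have := Int.cast_lt.1 ha
      have := Int.cast_lt.1 hb
      omega
    refine hw.2 ?_
    have : w = z := Prod.ext h1 (by rw [hn, hn0]; simp)
    rwa [this]
  have h2 : ∀ j, j ≠ i → (κ j '' strip)ᶜ ∈ 𝓝 (κ i z) := fun j hj ↦
    (hκ.isClosed_image j).isOpen_compl.mem_nhds fun h ↦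
      (hκ.disjoint j i hj).le_bot ⟨h, z, hz, rfl⟩
  have h3 : ∀ᶠ x in 𝓝 (κ i z), ∀ j, j ≠ i → x ∉ κ j '' strip :=
    eventually_all.2 fun j ↦ by
      by_cases hj : j = i
      · simp [hj]
      · filter_upwards [h2 j hj] with x hx _ using hx
  filter_upwards [hK.isOpen_compl.mem_nhds h1, h3] with x hx hx3 hxκ
  obtain ⟨j, hj⟩ := mem_iUnion.1 hxκ
  obtain rfl : j = i := by
    by_contra hne
    exact hx3 j hne hj
  rw [strip, hκ.image_eq j le_rfl (z.2 - 1 / 2)] at hj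
  obtain ⟨w, hw, rfl⟩ := hj
  refine ⟨w, ⟨⟨hw.1, trivial⟩, hUV ?_⟩, rfl⟩
  by_contra hwU
  exact hx ⟨w, ⟨hw, hwU⟩, rfl⟩

/-- Moving inwards from the circle `q = 0` in the direction of `-∂_q`, one leaves the collar. -/
lemma IsCollar.exists_curve_leaving (hκ : IsCollar S κ) (i : Fin m) (p : ℝ) :
    ∃ γ : ℝ → M, γ 0 = κ i (0, p) ∧ (∀ᶠ r in 𝓝 (0 : ℝ), ContMDiffAt 𝓘(ℝ, ℝ) (𝓡 2) ∞ γ r) ∧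
      ∀ᶠ r in 𝓝[<] (0 : ℝ), γ r ∉ collarSet κ := by
  have hz : ((0, p) : ℝ × ℝ) ∈ strip := ⟨by simp, trivial⟩
  let e := extChartAt (𝓡 2) (κ i (0, p))
  -- the derivative of the collar coordinates in a chart; the curve is a line in the chart with the
  -- direction of `L ∂_q`, followed backwards
  obtain ⟨L, hL, hLinj⟩ : ∃ L : ℝ × ℝ →L[ℝ] EuclideanSpace ℝ (Fin 2),
      HasFDerivWithinAt (fun w ↦ e (κ i w)) L strip (0, p) ∧ Function.Injective L := by
    have h1 := ((hκ.smooth i _ hz).mdifferentiableWithinAt (by simp)).hasMFDerivWithinAt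
    have h2 := (mdifferentiableAt_extChartAt (𝕜 := ℝ) (I := 𝓡 2) (x := κ i (0, p))
      (y := κ i (0, p)) (mem_chart_source _ _)).hasMFDerivAt
    have h3 := h2.comp_hasMFDerivWithinAt _ h1
    refine ⟨_, h3.hasFDerivWithinAt, ?_⟩
    have h4 := (isInvertible_mfderiv_extChartAt (I := 𝓡 2) (x := κ i (0, p)) (y := κ i (0, p))
      (mem_extChartAt_source _)).injective
    exact h4.comp (hκ.immersion i _ hz)
  let ℓ : ℝ → EuclideanSpace ℝ (Fin 2) := fun r ↦ e (κ i (0, p)) + r • L (1, 0)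
  have hℓ : ContDiff ℝ ∞ ℓ := contDiff_const.add (contDiff_id.smul contDiff_const)
  have hℓ0 : ℓ 0 = e (κ i (0, p)) := by simp [ℓ]
  have htarget : ∀ᶠ r in 𝓝 (0 : ℝ), ℓ r ∈ e.target := by
    refine hℓ.continuous.continuousAt.eventually_mem ?_
    rw [hℓ0]
    exact extChartAt_target_mem_nhds _
  have hγ : ∀ᶠ r in 𝓝 (0 : ℝ), ContMDiffAt 𝓘(ℝ, ℝ) (𝓡 2) ∞ (fun r ↦ e.symm (ℓ r)) r := by
    filter_upwards [htarget] with r hr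
    exact ((contMDiffOn_extChartAt_symm (κ i (0, p))).contMDiffAt
      ((isOpen_extChartAt_target _).mem_nhds hr)).comp r hℓ.contMDiff.contMDiffAt
  have hγ0 : e.symm (ℓ 0) = κ i (0, p) := by
    rw [hℓ0]
    exact extChartAt_to_inv _
  refine ⟨fun r ↦ e.symm (ℓ r), hγ0, hγ, ?_⟩
  obtain ⟨K, hK, hanti⟩ := L.toLinearMap.exists_antilipschitzWith
    (LinearMap.ker_eq_bot.2 hLinj)
  have hK' : (0 : ℝ) < K := hK
  have hsmall := hL.isLittleO.def (c := 1 / (2 * K)) (by positivity)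
  obtain ⟨V, hV, hVs⟩ : ∃ V ∈ 𝓝 ((0, p) : ℝ × ℝ), ∀ w ∈ strip ∩ V,
      ‖e (κ i w) - e (κ i (0, p)) - L (w - (0, p))‖ ≤ 1 / (2 * K) * ‖w - (0, p)‖ := by
    obtain ⟨V, hV, hVs⟩ := mem_nhdsWithin_iff_exists_mem_nhds_inter.1 hsmall
    exact ⟨V, hV, fun w hw ↦ hVs ⟨hw.2, hw.1⟩⟩
  have hpre := hκ.eventually_exists_preimage (i := i) hz hV
  have hcont : Tendsto (fun r ↦ e.symm (ℓ r)) (𝓝 0) (𝓝 (κ i (0, p))) := by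
    have := hγ.self_of_nhds.continuousAt.tendsto
    rwa [hγ0] at this
  filter_upwards [self_mem_nhdsWithin, nhdsWithin_le_nhds htarget,
    nhdsWithin_le_nhds (hcont.eventually hpre)] with r hr hrt hrpre hmem
  have hr0 : r < 0 := hr
  obtain ⟨w, hw, hwr⟩ := hrpre hmem
  have h1 : e (κ i w) = ℓ r := by rw [hwr]; exact e.right_inv hrt
  have h2 := hVs w hw
  have h3 : e (κ i w) - e (κ i (0, p)) - L (w - (0, p)) = -L (w - (0, p) - r • (1, 0)) := by
    rw [h1, map_sub L (w - (0, p)), map_smul]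
    simp only [ℓ]
    abel
  rw [h3, norm_neg] at h2
  have h4 : ‖w - (0, p) - r • ((1 : ℝ), (0 : ℝ))‖ ≤ K * ‖L (w - (0, p) - r • (1, 0))‖ := by
    have := hanti.le_mul_norm_sub (w - (0, p) - r • ((1 : ℝ), (0 : ℝ))) 0
    simpa only [ContinuousLinearMap.coe_coe, map_zero, add_zero,
      norm_neg] using this
  have h5 : K * ‖L (w - (0, p) - r • (1, 0))‖ ≤ ‖w - (0, p)‖ / 2 := by
    calc K * ‖L (w - (0, p) - r • (1, 0))‖ ≤ K * (1 / (2 * K) * ‖w - (0, p)‖) :=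
          mul_le_mul_of_nonneg_left h2 hK'.le
      _ = ‖w - (0, p)‖ / 2 := by field_simp
  -- since `q ≥ 0` in the strip, subtracting `r ∂_q` with `r < 0` increases the norm
  have hq : 0 ≤ w.1 := hw.1.1.1
  have h6 : ‖w - (0, p)‖ ≤ ‖w - (0, p) - r • ((1 : ℝ), (0 : ℝ))‖ := by
    simp only [Prod.norm_def]
    refine max_le_max ?_ (by simp)
    simp only [Prod.fst_sub, Prod.smul_fst, smul_eq_mul, mul_one, sub_zero, Real.norm_eq_abs]
    rw [abs_of_nonneg hq, abs_of_nonneg (by linarith)]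
    linarith
  have h7 : 0 < ‖w - (0, p) - r • ((1 : ℝ), (0 : ℝ))‖ := by
    refine lt_of_lt_of_le ?_ (norm_fst_le _)
    simp only [Prod.fst_sub, Prod.smul_fst, smul_eq_mul, mul_one, sub_zero, Real.norm_eq_abs]
    rw [abs_of_nonneg (by linarith)]
    linarith
  linarith [norm_nonneg (w - (0, p))]

end InnerBoundary

section Conclusion

variable {M : Type*} [TopologicalSpace M] [T2Space M]
  [ChartedSpace (EuclideanSpace ℝ (Fin 2)) M] [IsManifold (𝓡 2) ∞ M]
  {m : ℕ} {S : Set M} {κ : Fin m → ℝ × ℝ → M} {σ : BilinField M} {J : ℝ → EndField M}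

/-- The complement of the collar together with the inner boundary circles `q = 0` lies in every
metric neighborhood of that complement. -/
lemma IsCollar.diff_collar_subset_metricNhd (hκ : IsCollar S κ) (hS : IsCompactSubsurface S)
    (hσ : IsAreaForm σ) (hJ : IsSmoothPath J) (t : ℝ) {ε : ℝ} (hε : 0 < ε) :
    S \ ⋃ j, κ j '' (Ioc 0 1 ×ˢ univ) ⊆ metricNhd σ (J t) ε (S \ collarSet κ) := by
  rintro x ⟨hxS, hx⟩
  by_cases hxκ : x ∈ collarSet κ
  · obtain ⟨i, ⟨q, p⟩, hz, rfl⟩ := mem_iUnion.1 hxκ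
    obtain rfl : q = 0 := by
      by_contra hq
      exact hx (mem_iUnion.2 ⟨i, _, ⟨⟨lt_of_le_of_ne hz.1.1 (Ne.symm hq), hz.1.2⟩, trivial⟩, rfl⟩)
    obtain ⟨γ, hγ0, hγ, hγκ⟩ := hκ.exists_curve_leaving i p
    have hint : S ∈ 𝓝 (γ 0) := by
      rw [hγ0, ← mem_interior_iff_mem_nhds]
      refine hS.mem_interior hxS fun hf ↦ ?_
      rw [hκ.mem_frontier_iff hz] at hf
      norm_num at hf
    have hγS : ∀ᶠ r in 𝓝[<] (0 : ℝ), γ r ∈ S :=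
      nhdsWithin_le_nhds (hγ.self_of_nhds.continuousAt.eventually_mem hint)
    obtain ⟨r, hr1, hr2, hr3⟩ :=
      (hγκ.and (hγS.and (eventually_metricDist_lt hσ hJ t hγ hε))).exists
    exact ⟨γ r, ⟨hr2, hr1⟩, hγ0 ▸ hr3⟩
  · exact ⟨x, ⟨hxS, hxκ⟩, by rw [metricDist_self]; exact ENNReal.ofReal_pos.2 hε⟩

/-- A connected set that avoids the open collar and contains a point of the interior of `S` stays
on the inner side of the collar. -/
lemma IsCollar.subset_diff_collar (hκ : IsCollar S κ) (hS : IsCompactSubsurface S) {R : Set M}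
    (hR : IsPreconnected R) (hav : ∀ i, Disjoint R (κ i '' openStrip))
    (hne : (R ∩ interior S).Nonempty) : R ⊆ S \ ⋃ j, κ j '' (Ioc 0 1 ×ˢ univ) := by
  have hcover : ∀ x ∈ R, x ∈ interior S → x ∈ S \ ⋃ j, κ j '' (Ioc 0 1 ×ˢ univ) := by
    intro x hxR hxi
    refine ⟨interior_subset hxi, fun hx ↦ ?_⟩
    obtain ⟨i, z, hz, rfl⟩ := mem_iUnion.1 hx
    rcases hz.1.2.eq_or_lt with h1 | h1
    · exact ((hκ.mem_frontier_iff (show z ∈ strip from ⟨⟨hz.1.1.le, hz.1.2⟩, trivial⟩)).2 h1).2 hxi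
    · exact (hav i).le_bot ⟨hxR, z, ⟨⟨hz.1.1, h1⟩, trivial⟩, rfl⟩
  obtain ⟨y, hyR, hyi⟩ := hne
  intro x hx
  refine hcover x hx ?_
  by_contra hxi
  obtain ⟨w, -, hwY, hwi⟩ := isPreconnected_closed_iff.1 hR _ _ (hκ.isClosed_diff_collar hS)
    isOpen_interior.isClosed_compl (fun w hw ↦ (em (w ∈ interior S)).imp (hcover w hw) id)
    ⟨y, hyR, hcover y hyR hyi⟩ ⟨x, hx, hxi⟩
  have hwf : w ∈ frontier S := ⟨subset_closure hwY.1, hwi⟩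
  rw [hκ.boundary] at hwf
  exact hwY.2 (iUnion_mono (fun i ↦ image_mono (prod_mono_left (by simp))) hwf)

end Conclusion

end ConnectingOrbits

end

theorem mainTheorem6 {M : Type*} [TopologicalSpace M] [T2Space M] [CompactSpace M]
    [ConnectedSpace M] [ChartedSpace (EuclideanSpace ℝ (Fin 2)) M] [IsManifold (𝓡 2) ∞ M]
    (S : Set M) (hS : ConnectingOrbits.IsCompactSubsurface S)
    (m : ℕ) (κ : Fin m → ℝ × ℝ → M) (hκ : ConnectingOrbits.IsCollar S κ)
    (σ : ConnectingOrbits.BilinField M) (hσ : ConnectingOrbits.IsAreaForm σ)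
    (hσκ : ConnectingOrbits.IsStandardFormOn κ σ)
    (Φ : M ≃ₘ^∞⟮𝓡 2, 𝓡 2⟯ M) (hΦ : ConnectingOrbits.IsInvariantForm Φ σ)
    (H : M → ℝ) (hH : ContMDiff (𝓡 2) 𝓘(ℝ, ℝ) ∞ H)
    (J : ℝ → ConnectingOrbits.EndField M) (δ : ℝ)
    (h1 : ConnectingOrbits.HypH1 σ Φ H S)
    (h2 : ConnectingOrbits.HypH2 Φ κ δ)
    (h3 : ConnectingOrbits.HypH3 Φ H S)
    (h4 : ConnectingOrbits.HypH4 σ Φ κ)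
    (h5 : ConnectingOrbits.HypH5 σ Φ κ J)
    (xm xp : M) (hxm : Φ xm = xm) (hxp : Φ xp = xp) (hxmS : xm ∈ S)
    (hcomp : xp ∈ connectedComponentIn S xm)
    (u : ℝ × ℝ → M) (hu : ConnectingOrbits.IsConnectingOrbit σ Φ J xm xp u) :
    ∀ t : ℝ, range u ⊆
      ConnectingOrbits.metricNhd σ (J t) δ (S \ ConnectingOrbits.collarSet κ) := by
  intro t
  obtain ⟨hJ, -⟩ := id h5
  refine Subset.trans ?_ (hκ.diff_collar_subset_metricNhd hS hσ hJ t h2.1)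
  refine hκ.subset_diff_collar hS (isPreconnected_range hu.smooth.continuous) (fun i ↦ ?_) ?_
  · rw [disjoint_left]
    rintro _ ⟨z, rfl⟩
    exact hu.notMem_collar hS hκ hσ hσκ hΦ hH h1 h2 h3 h4 h5 hxm hxp hxmS hcomp i z
  · have hxmκ := hκ.notMem_collarSet h2 hxm
    have hint : interior S ∈ 𝓝 xm := isOpen_interior.mem_nhds (hS.mem_interior hxmS fun hf ↦ by
      rw [hκ.boundary] at hf
      exact hxmκ (iUnion_mono (fun i ↦ image_mono (prod_mono_left (by simp))) hf))
    obtain ⟨s, hs⟩ := ((hu.lim_neg 0).eventually_mem hint).exists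
    exact ⟨_, ⟨_, rfl⟩, hs⟩
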